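/- A \emph{metric graph} is a compact connected metric space $\Gamma$ in which every point $p$ has a neighbourhood isometric to a star with centre $p$ and some number $n_p\ge 1$ of branches (the valence of $p$). A \emph{tropical curve} is a connected (extended) metric space $T$ that is the union of a metric graph $\Gamma$ and finitely many unbounded edges $e$, each isometric to $[0,\infty]$ and such that $\overline{T\setminus e}\cap e$ consists of the single point $e(0)$, which lies on $\Gamma$; it carries the topology in which each unbounded edge is homeomorphic to $[0,\infty]$. Let $X$ be a metric graph or a tropical curve. Its vertices are the points of valence $\neq 2$ (points at infinity included), its edges are the connected components of the complement of the set of vertices, and its genus is $g(X)=1+\#\{\text{edges}\}-\#\{\text{vertices}\}$, with $g(X)=1$ if $X$ has no vertices (a circle). A \emph{real structure} on $X$ is an isometry $\iota:X\to X$ (also a homeomorphism at the points at infinity) with $\iota^2=\mathrm{id}$; the real locus is $X(\mathbb R)=\{p\in X:\iota(p)=p\}$. With a real structure, $X$ is called \emph{strong M} if $X(\mathbb R)$ has exactly $g(X)+1$ connected components. A divisor is a finite $\mathbb Z$-linear combination of points of $X$; it is real if it is invariant under $\iota$. A rational function is a continuous function $f:X\to\mathbb R\cup\{\pm\infty\}$,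 with infinite values at most at points at infinity, that is piecewise affine with integer slopes and finitely many pieces on every edge; its principal divisor $\Delta(f)$ has at $p$ the sum of the slopes of $f$ in all directions going out of $p$. Two divisors are linearly equivalent if their difference is some $\Delta(f)$. The complete linear system $|D|$ is the set of effective divisors linearly equivalent to $D$. If $|D|\neq\emptyset$, the rank $\mathrm{rk}(D)$ is the largest integer $r\geq 0$ such that for each effective divisor $E$ of degree $r$ there is $D'\in|D|$ with $D'\ge E$. \textbf{Proposition.} Let $X$ be a strong M-metric graph or a strong M-tropical curve. Then $X$ has a real linear system $g^1_2$: there is a real effective divisor $D$ of degree $2$ on $X$ with $\mathrm{rk}(D)\geq 1$, and $\mathrm{rk}(D)=1$ if $g(X)\geq 1$. -/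

import Mathlib

open Set Topology
open scoped ENNReal NNReal

universe u

namespace RealGraph

/-! Throughout, `X` carries a topology and an extended distance `edist`.  For a metric graph both come
from a metric.  For a tropical curve the topology is the one in which an unbounded edge is a copy of
`[0, ∞]`, and the end points of the unbounded edges are at infinite distance from all other points. -/

section Charts

variable {X : Type u} [TopologicalSpace X] [EDist X]

/-- `φ` parametrizes a neighbourhood of `p` by the star with `n` branches of length `r`; the point at
distance `t` from the centre on the branch `k` goes to `φ k t`, for `0 ≤ t < r`.  Every branch is
embedded isometrically.  Distances between points of different branches are left free, so both usual
conventions for them (chords, with the star inside `ℂ`, or lengths of paths) are covered. -/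
structure IsStarChart (p : X) (n : ℕ) (r : ℝ) (φ : Fin n → ℝ → X) : Prop where
  radius_pos : 0 < r
  center : ∀ k, φ k 0 = p
  isometric : ∀ k, ∀ s ∈ Ico 0 r, ∀ t ∈ Ico 0 r,
    edist (φ k s) (φ k t) = ENNReal.ofReal |s - t|
  disjoint : ∀ k l, ∀ s ∈ Ioo 0 r, ∀ t ∈ Ioo 0 r, φ k s = φ l t → k = l
  nhds : (⋃ k, φ k '' Ico 0 r) ∈ 𝓝 p

/-- `p` has valence `n`: some neighbourhood of `p` is a star with `n` branches centred at `p`. -/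
def HasValence (p : X) (n : ℕ) : Prop :=
  ∃ (r : ℝ) (φ : Fin n → ℝ → X), IsStarChart p n r φ

/-- The map `γ` from `[0, ∞]` is isometric; truncated subtraction makes `(s - t) + (t - s)` the
extended distance `|s - t|`, which is `∞` if exactly one of `s`, `t` is `∞`. -/
def IsIsometricRay (γ : ℝ≥0∞ → X) : Prop :=
  ∀ s t, edist (γ s) (γ t) = (s - t) + (t - s)

/-- `p` is the point at infinity of the unbounded edge `γ`, which is a neighbourhood of `p`. -/
structure IsEndChart (p : X) (γ : ℝ≥0∞ → X) : Prop where
  isometric : IsIsometricRay γ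
  continuous : Continuous γ
  end_eq : γ ⊤ = p
  nhds : range γ ∈ 𝓝 p

/-- The function `f` is affine with an integer slope in every direction at `p`, and the sum of its
outgoing slopes at `p` is `m`.  At a point at infinity the outgoing slope is minus the slope of `f`
towards infinity. -/
def HasOrder (f : X → EReal) (p : X) (m : ℤ) : Prop :=
  (∃ (n : ℕ) (r : ℝ) (φ : Fin n → ℝ → X) (a : ℝ) (σ : Fin n → ℤ),
    IsStarChart p n r φ ∧
    (∀ k, ∀ t ∈ Ico 0 r, f (φ k t) = ((a + (σ k : ℝ) * t : ℝ) : EReal)) ∧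
    m = ∑ k, σ k) ∨
  (∃ (γ : ℝ≥0∞ → X) (a : ℝ) (c : ℤ),
    IsEndChart p γ ∧
    (∀ t : ℝ≥0, f (γ (t : ℝ≥0∞)) = ((a + (c : ℝ) * (t : ℝ) : ℝ) : EReal)) ∧
    m = -c)

/-- The set of vertices: all points of valence different from `2` (so points at infinity too). -/
def vertices (X : Type u) [TopologicalSpace X] [EDist X] : Set X :=
  {p | ¬ HasValence p 2}

open Classical in
/-- The genus `1 + e - v`, where `v` is the number of vertices and `e` the number of edges, the edges
being the connected components of the complement of the set of vertices.  If there are no vertices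
the space is a circle, which has genus `1` (one edge, after any of its points is made a vertex). -/
noncomputable def genus (X : Type u) [TopologicalSpace X] [EDist X] : ℤ :=
  if vertices X = ∅ then 1
  else 1 + (Nat.card (ConnectedComponents ((vertices X)ᶜ : Set X)) : ℤ) - ((vertices X).ncard : ℤ)

end Charts

/-- A metric graph: a compact connected metric space in which each point has a neighbourhood that is
a star of some valence `n ≥ 1`. -/
structure IsMetricGraph (Γ : Type u) [MetricSpace Γ] : Prop where
  compact : CompactSpace Γ
  connected : ConnectedSpace Γ
  star : ∀ p : Γ, ∃ n : ℕ, 1 ≤ n ∧ HasValence p n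

/-- A tropical curve: a connected extended metric space which is the union of a metric graph `Γ` and
finitely many unbounded edges `e i`, each isometric and homeomorphic to `[0, ∞]` and meeting the
closure of its complement only in the point `e i 0`, which lies on `Γ`.  The topology is given by the
distance at every point that is not at infinity. -/
structure IsTropicalCurve (T : Type u) [TopologicalSpace T] [EDist T] : Prop where
  edist_eq_zero : ∀ x y : T, edist x y = 0 ↔ x = y
  edist_comm : ∀ x y : T, edist x y = edist y x
  edist_triangle : ∀ x y z : T, edist x z ≤ edist x y + edist y z
  nhds_basis : ∀ x : T, (∃ y, y ≠ x ∧ edist x y < ⊤) →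
    (𝓝 x).HasBasis (fun ε : ℝ≥0∞ => 0 < ε) (fun ε => {y | edist x y < ε})
  t2 : T2Space T
  connected : ConnectedSpace T
  decomposition : ∃ (Γ : Type u) (_ : MetricSpace Γ) (j : Γ → T) (N : ℕ) (e : Fin N → ℝ≥0∞ → T),
    IsMetricGraph Γ ∧
    IsEmbedding j ∧ (∀ x y, edist (j x) (j y) = edist x y) ∧
    (∀ i, IsEmbedding (e i)) ∧ (∀ i, IsIsometricRay (e i)) ∧
    (∀ i, closure (range (e i))ᶜ ∩ range (e i) = {e i 0}) ∧
    (∀ i, e i 0 ∈ range j) ∧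
    range j ∪ ⋃ i, range (e i) = univ

section Divisors

variable {X : Type u}

/-- The degree of a divisor (a finite integer linear combination of points). -/
noncomputable def degree (D : X →₀ ℤ) : ℤ := D.sum fun _ n => n

variable [TopologicalSpace X] [EDist X]

/-- `f` is a rational function with principal divisor `D`: it is continuous, with values in
`ℝ ∪ {±∞}` that can be infinite only at points at infinity, it is affine with integer slopes in all
directions at each point (on a compact edge: piecewise affine with finitely many pieces), and the sum
of its outgoing slopes at `p` is `D p`. -/
def HasPrincipalDivisor (f : X → EReal) (D : X →₀ ℤ) : Prop :=
  Continuous f ∧ ∀ p, HasOrder f p (D p)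

/-- Linear equivalence of divisors: the difference is a principal divisor. -/
def LinEquiv (D D' : X →₀ ℤ) : Prop :=
  ∃ f : X → EReal, HasPrincipalDivisor f (D' - D)

/-- For each effective divisor `E` of degree `r` some `D'` in the complete linear system of `D`
satisfies `E ≤ D'`. -/
def RankAtLeast (D : X →₀ ℤ) (r : ℕ) : Prop :=
  ∀ E : X →₀ ℤ, 0 ≤ E → degree E = r → ∃ D' : X →₀ ℤ, LinEquiv D D' ∧ 0 ≤ D' ∧ E ≤ D'

/-- The rank of `D` is the natural number `r`. -/
def HasRank (D : X →₀ ℤ) (r : ℕ) : Prop :=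
  IsGreatest {r : ℕ | RankAtLeast D r} r

/-- A real structure: an isometry (for a tropical curve, also continuous at the points at infinity)
whose square is the identity. -/
structure IsRealStructure (ι : X → X) : Prop where
  continuous : Continuous ι
  involutive : Function.Involutive ι
  isometric : ∀ x y, edist (ι x) (ι y) = edist x y

/-- The real locus, the set of points fixed by conjugation, has `g + 1` connected components. -/
def IsStrongM (ι : X → X) : Prop :=
  (Nat.card (ConnectedComponents {x : X // ι x = x}) : ℤ) = genus X + 1

/-- A divisor that is equal to its conjugate. -/
def IsRealDivisor (ι : X → X) (D : X →₀ ℤ) : Prop :=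
  ∀ p, D (ι p) = D p

/-- `D` is a real effective divisor of degree `2` which defines a `g^1_2`: its rank is `1`.  In genus
`0`, where each divisor of degree `2` has rank `2`, only rank at least `1` is asked for. -/
structure IsRealG12 (ι : X → X) (D : X →₀ ℤ) : Prop where
  real : IsRealDivisor ι D
  effective : 0 ≤ D
  degree_eq : degree D = 2
  rank_ge : RankAtLeast D 1
  rank_eq : genus X ≠ 0 → HasRank D 1

end Divisors

end RealGraph

/-! ### Extended distances, arcs and star charts. -/

namespace RealGraph

/-! The strong M condition makes the quotient of `X` by `ι` a tree, and `p + ι p` is the pullback of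
a point of this tree. Points of a tree are linearly equivalent, so all the divisors `p + ι p` are
equivalent. Hence the class of one of them has a member through any given point, which is rank at
least 1.

In terms of finite graphs: divide `X` into a set N of nodes and a set I of links on which `ι` acts
by involutions σ and τ without reversing a link (`exists_equivariant_model`). The genus is 1 + |I| -
|N| for every subdivision (`Model.genus_eq`), and the real locus is the subgraph of fixed nodes and
links, so the strong M condition says that this subgraph has c = |I| - |N| + 2 components. The
coboundary from σ-invariant functions on N to τ-invariant functions on I has only the constants in
its kernel, so its rank is (|N| + |N^σ|)/2 - 1. Its range dies in the first cohomology of the fixed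
graph, of dimension |I^τ| - |N^σ| + c. Counting dimensions gives c ≤ |N^σ| - |I^τ|, and the opposite
inequality holds for any graph. With equality the rank is (|I| + |I^τ|)/2, so every invariant
function on the links has an invariant primitive (`exists_invariant_primitive`).

Given `p` and `q`, an integer flow with divisor `q - p` (`Model.exists_flow`) plus its conjugate is
an invariant flow. Multiplied by the lengths of the edges it has a primitive, whose values at the
nodes extend to a rational function with the flow as slopes (`Model.exists_hasPrincipalDivisor`).
Its divisor is `q + ι q - p - ι p` (`rankAtLeast_one`).

If the genus is not 0, some point `x` of valence 2 does not separate `X` (`exists_nonseparating`).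
If `x + ι x` had rank at least 2, there would be a principal divisor with a positive coefficient at
some `y ≠ x` and no negative coefficient except possibly -1 at `x`. A maximum principle rules this
out (`not_hasPrincipalDivisor`).

Metric graphs and tropical curves are treated together as compact connected spaces with charts,
`IsCurve`. For tropical curves the charts must be assembled from those of the compact part and the
unbounded edges (`IsTropicalCurve.isCurve`). -/

/-- A Hausdorff space with an extended distance that induces the topology at every point which has
another point at finite distance. -/
structure IsEDistSpace (X : Type u) [TopologicalSpace X] [EDist X] : Prop where
  edist_eq_zero : ∀ x y : X, edist x y = 0 ↔ x = y
  edist_comm : ∀ x y : X, edist x y = edist y x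
  edist_triangle : ∀ x y z : X, edist x z ≤ edist x y + edist y z
  nhds_basis : ∀ x : X, (∃ y, y ≠ x ∧ edist x y < ⊤) →
    (𝓝 x).HasBasis (fun ε : ℝ≥0∞ => 0 < ε) (fun ε => {y | edist x y < ε})
  t2 : T2Space X

/-- The common properties of metric graphs and tropical curves. -/
structure IsCurve (X : Type u) [TopologicalSpace X] [EDist X] : Prop extends IsEDistSpace X where
  compact : CompactSpace X
  connected : ConnectedSpace X
  charts : ∀ p : X, (∃ n, HasValence p n) ∨ ∃ γ, IsEndChart p γ

section ENNReal

lemma ofReal_abs_toReal_sub {s t : ℝ≥0∞} (hs : s ≠ ⊤) (ht : t ≠ ⊤) :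
    ENNReal.ofReal |s.toReal - t.toReal| = (s - t) + (t - s) := by
  lift s to ℝ≥0 using hs
  lift t to ℝ≥0 using ht
  simp only [ENNReal.coe_toReal]
  rcases le_total s t with h | h
  · rw [tsub_eq_zero_of_le (ENNReal.coe_le_coe.2 h), zero_add, abs_sub_comm,
      abs_of_nonneg (sub_nonneg.2 (NNReal.coe_le_coe.2 h)), ENNReal.ofReal_sub _ s.coe_nonneg]
    simp
  · rw [tsub_eq_zero_of_le (ENNReal.coe_le_coe.2 h), add_zero,
      abs_of_nonneg (sub_nonneg.2 (NNReal.coe_le_coe.2 h)), ENNReal.ofReal_sub _ t.coe_nonneg]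
    simp

lemma sub_add_sub_eq_zero {s t : ℝ≥0∞} : (s - t) + (t - s) = 0 ↔ s = t := by
  rw [add_eq_zero, tsub_eq_zero_iff_le, tsub_eq_zero_iff_le]
  exact ⟨fun h => le_antisymm h.1 h.2, fun h => ⟨h.le, h.ge⟩⟩

lemma tendsto_sub_add_sub {s : ℝ≥0∞} (hs : s ≠ ⊤) :
    Filter.Tendsto (fun t => (s - t) + (t - s)) (𝓝 s) (𝓝 0) := by
  have h1 : Filter.Tendsto (fun t => s - t) (𝓝 s) (𝓝 (s - s)) :=
    ENNReal.Tendsto.sub tendsto_const_nhds Filter.tendsto_id (Or.inl hs)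
  have h2 : Filter.Tendsto (fun t => t - s) (𝓝 s) (𝓝 (s - s)) :=
    ENNReal.Tendsto.sub Filter.tendsto_id tendsto_const_nhds (Or.inl hs)
  simpa using h1.add h2

lemma sub_add_sub_reverse {L s t : ℝ≥0∞} (hL : L ≠ ⊤) (hs : s ≤ L) (ht : t ≤ L) :
    ((L - s) - (L - t)) + ((L - t) - (L - s)) = (s - t) + (t - s) := by
  have hs' := ne_top_of_le_ne_top hL hs
  have ht' := ne_top_of_le_ne_top hL ht
  rw [← ofReal_abs_toReal_sub (by finiteness) (by finiteness), ← ofReal_abs_toReal_sub hs' ht',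
    ENNReal.toReal_sub_of_le hs hL, ENNReal.toReal_sub_of_le ht hL,
    show L.toReal - s.toReal - (L.toReal - t.toReal) = -(s.toReal - t.toReal) by ring, abs_neg]

lemma sub_add_sub_top {t : ℝ≥0∞} (ht : t ≠ ⊤) : (⊤ - t) + (t - ⊤) = ⊤ := by
  rw [ENNReal.top_sub ht]; simp

end ENNReal

variable {X : Type u} [TopologicalSpace X] [EDist X]

/-- An isometric and continuous parametrization of an arc by `[0, L]`, where `L` may be infinite. -/
structure IsArc (L : ℝ≥0∞) (α : ℝ≥0∞ → X) : Prop where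
  pos : 0 < L
  isometric : ∀ s ≤ L, ∀ t ≤ L, edist (α s) (α t) = (s - t) + (t - s)
  continuousOn : ContinuousOn α (Iic L)

namespace IsEDistSpace

variable (hX : IsEDistSpace X)
include hX

lemma edist_self (x : X) : edist x x = 0 := (hX.edist_eq_zero x x).2 rfl

lemma isOpen_ball {p : X} (hp : ∃ y, y ≠ p ∧ edist p y < ⊤) {ε : ℝ≥0∞} :
    IsOpen {y | edist p y < ε} := by
  rw [isOpen_iff_mem_nhds]
  intro y hy
  have hy' : ∃ z, z ≠ y ∧ edist y z < ⊤ := by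
    by_cases h : y = p
    · subst h; exact hp
    · exact ⟨p, fun h' => h h'.symm, by
        rw [hX.edist_comm]; exact lt_of_lt_of_le hy le_top⟩
  refine (hX.nhds_basis y hy').mem_iff.2 ⟨ε - edist p y, tsub_pos_of_lt hy, fun z hz => ?_⟩
  have h1 : edist p y ≠ ⊤ := ne_top_of_lt hy
  calc edist p z ≤ edist p y + edist y z := hX.edist_triangle _ _ _
    _ < edist p y + (ε - edist p y) := (ENNReal.add_lt_add_iff_left h1).2 hz
    _ = ε := add_tsub_cancel_of_le (le_of_lt hy)

lemma continuousOn_of_isometric {L : ℝ≥0∞} {α : ℝ≥0∞ → X} (hL : 0 < L) (hL' : L ≠ ⊤)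
    (h : ∀ s ≤ L, ∀ t ≤ L, edist (α s) (α t) = (s - t) + (t - s)) : ContinuousOn α (Iic L) := by
  intro s hs
  have hs' : s ≠ ⊤ := ne_top_of_le_ne_top hL' hs
  have hp : ∃ y, y ≠ α s ∧ edist (α s) y < ⊤ := by
    have key : ∀ t ≤ L, t ≠ s → ∃ y, y ≠ α s ∧ edist (α s) y < ⊤ := by
      intro t ht hts
      have ht' : t ≠ ⊤ := ne_top_of_le_ne_top hL' ht
      refine ⟨α t, fun h' => hts ?_, ?_⟩
      · have := (hX.edist_eq_zero _ _).2 h'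
        rw [h t ht s hs] at this
        exact sub_add_sub_eq_zero.1 this
      · rw [h s hs t ht]; finiteness
    by_cases h0 : s = 0
    · exact key L le_rfl (by rw [h0]; exact hL.ne')
    · exact key 0 zero_le (Ne.symm h0)
  rw [ContinuousWithinAt, (hX.nhds_basis _ hp).tendsto_right_iff]
  intro ε hε
  have h1 := (tendsto_sub_add_sub hs').eventually (gt_mem_nhds hε)
  filter_upwards [nhdsWithin_le_nhds h1, self_mem_nhdsWithin] with t ht ht'
  show edist (α s) (α t) < ε
  rw [h s hs t ht']; exact ht

end IsEDistSpace

namespace IsArc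

variable {L : ℝ≥0∞} {α : ℝ≥0∞ → X}

lemma of_le (h : IsArc L α) {L' : ℝ≥0∞} (h0 : 0 < L') (hL : L' ≤ L) : IsArc L' α :=
  ⟨h0, fun s hs t ht => h.isometric s (hs.trans hL) t (ht.trans hL),
    h.continuousOn.mono (Iic_subset_Iic.2 hL)⟩

lemma shift (h : IsArc L α) {a b : ℝ≥0∞} (hab : a < b) (hb : b ≤ L) :
    IsArc (b - a) (fun t => α (a + t)) := by
  have ha : a ≠ ⊤ := ne_top_of_lt hab
  have key : ∀ t ≤ b - a, a + t ≤ L := fun t ht => by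
    refine le_trans ?_ hb
    calc a + t ≤ a + (b - a) := by gcongr
      _ = b := add_tsub_cancel_of_le hab.le
  refine ⟨tsub_pos_of_lt hab, fun s hs t ht => ?_, ?_⟩
  · rw [h.isometric _ (key s hs) _ (key t ht), ENNReal.add_sub_add_eq_sub_left ha,
      ENNReal.add_sub_add_eq_sub_left ha]
  · exact h.continuousOn.comp (by fun_prop) key

lemma reverse (h : IsArc L α) (hL : L ≠ ⊤) : IsArc L (fun t => α (L - t)) := by
  refine ⟨h.pos, fun s hs t ht => ?_, ?_⟩
  · rw [h.isometric _ tsub_le_self _ tsub_le_self, sub_add_sub_reverse hL hs ht]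
  · refine h.continuousOn.comp (ENNReal.continuous_sub_left hL).continuousOn
      fun t _ => mem_Iic.2 tsub_le_self

lemma edist_zero (h : IsArc L α) {t : ℝ≥0∞} (ht : t ≤ L) : edist (α 0) (α t) = t := by
  rw [h.isometric 0 zero_le t ht]; simp

lemma injOn (h : IsArc L α) (hX : IsEDistSpace X) : InjOn α (Iic L) := by
  intro s hs t ht hst
  have := (hX.edist_eq_zero _ _).2 hst
  rw [h.isometric s hs t ht] at this
  exact sub_add_sub_eq_zero.1 this

lemma isCompact_image (h : IsArc L α) {s : Set ℝ≥0∞} (hs : IsClosed s) (hsL : s ⊆ Iic L) :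
    IsCompact (α '' s) := hs.isCompact.image_of_continuousOn (h.continuousOn.mono hsL)

lemma isClosed_image (h : IsArc L α) (hX : IsEDistSpace X) {s : Set ℝ≥0∞} (hs : IsClosed s)
    (hsL : s ⊆ Iic L) : IsClosed (α '' s) :=
  haveI := hX.t2
  (h.isCompact_image hs hsL).isClosed

lemma isPreconnected_image (h : IsArc L α) {s : Set ℝ≥0∞} (hs : s.OrdConnected)
    (hsL : s ⊆ Iic L) : IsPreconnected (α '' s) :=
  hs.isPreconnected.image _ (h.continuousOn.mono hsL)

lemma exists_finite_edist (h : IsArc L α) (hX : IsEDistSpace X) {s : ℝ≥0∞} (hs : s ≤ L)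
    (hs' : s ≠ ⊤) : ∃ y, y ≠ α s ∧ edist (α s) y < ⊤ := by
  have key : ∀ t ≤ L, t ≠ ⊤ → t ≠ s → ∃ y, y ≠ α s ∧ edist (α s) y < ⊤ := by
    intro t ht ht' hts
    refine ⟨α t, fun h' => hts (h.injOn hX ht hs h'), ?_⟩
    rw [h.isometric s hs t ht]; finiteness
  by_cases h0 : s = 0
  · obtain ⟨t, ht0, htL⟩ := exists_between h.pos
    exact key t htL.le htL.ne_top (by rw [h0]; exact ht0.ne')
  · exact key 0 zero_le (by simp) (Ne.symm h0)

lemma isOpen_image_Ioo (h : IsArc L α) (hX : IsEDistSpace X) (ho : IsOpen (α '' Ioo 0 L))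
    {a b : ℝ≥0∞} (hb : b ≤ L) : IsOpen (α '' Ioo a b) := by
  rcases le_or_gt L a with ha | ha
  · rw [Ioo_eq_empty (by exact fun h' => absurd (h'.trans_le hb) ha.not_gt)]; simp
  have hsub : ∀ t ∈ Iic a ∪ Icc b L, t ∈ Iic L := by
    rintro t (ht | ht)
    · exact le_trans ht ha.le
    · exact ht.2
  have : α '' Ioo a b = (α '' Ioo 0 L) \ (α '' Iic a ∪ α '' Icc b L) := by
    rw [← image_union]
    ext y
    constructor
    · rintro ⟨t, ht, rfl⟩
      refine ⟨⟨t, ⟨pos_of_gt ht.1, ht.2.trans_le hb⟩, rfl⟩, ?_⟩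
      rintro ⟨s, hs, hst⟩
      rw [h.injOn hX (hsub s hs) (mem_Iic.2 (ht.2.le.trans hb)) hst] at hs
      exact hs.elim (fun h' => absurd ht.1 (not_lt.2 h')) fun h' => absurd ht.2 (not_lt.2 h'.1)
    · rintro ⟨⟨t, ht, rfl⟩, hn⟩
      refine ⟨t, ⟨lt_of_not_ge fun h' => hn ⟨t, Or.inl h', rfl⟩,
        lt_of_not_ge fun h' => hn ⟨t, Or.inr ⟨h', ht.2.le⟩, rfl⟩⟩, rfl⟩
  rw [this]
  refine ho.sdiff ((h.isClosed_image hX isClosed_Iic (Iic_subset_Iic.2 ha.le)).union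
    (h.isClosed_image hX isClosed_Icc fun t ht => ht.2))

end IsArc

/-- Finitely many arcs that start at `p`, are disjoint otherwise and cover a neighbourhood of `p` make
up a star. -/
lemma exists_isStarChart_of_arcs (hX : IsEDistSpace X) {K : Type*} [Finite K] [Nonempty K] {p : X}
    {L : K → ℝ≥0∞} {α : K → ℝ≥0∞ → X} (harc : ∀ k, IsArc (L k) (α k)) (h0 : ∀ k, α k 0 = p)
    (hdisj : ∀ k l s t, s ∈ Ioo 0 (L k) → t ∈ Ioo 0 (L l) → α k s = α l t → k = l)
    (hn : {p} ∪ ⋃ k, α k '' Ioo 0 (L k) ∈ 𝓝 p) :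
    ∃ r : ℝ, 0 < r ∧ (∀ k, ENNReal.ofReal r < L k) ∧ ∀ n, ∀ σ : Fin n ≃ K,
      IsStarChart p n r (fun k t => α (σ k) (ENNReal.ofReal t)) := by
  obtain ⟨r, hr0, hr⟩ : ∃ r : ℝ, 0 < r ∧ ∀ k, ENNReal.ofReal r < L k := by
    obtain ⟨k0, hk0⟩ := Finite.exists_min L
    obtain ⟨ρ, h1, h2⟩ := exists_between (harc k0).pos
    exact ⟨ρ.toReal, ENNReal.toReal_pos h1.ne' h2.ne_top,
      fun k => by rw [ENNReal.ofReal_toReal h2.ne_top]; exact h2.trans_le (hk0 k)⟩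
  refine ⟨r, hr0, hr, fun n σ => ?_⟩
  have hlt : ∀ {t : ℝ}, t ∈ Ico 0 r → ENNReal.ofReal t < ENNReal.ofReal r := fun ht =>
    (ENNReal.ofReal_lt_ofReal_iff hr0).2 ht.2
  refine ⟨hr0, fun k => by simp [h0], fun k s hs t ht => ?_, fun k l s hs t ht hst => ?_, ?_⟩
  · rw [(harc _).isometric _ ((hlt hs).le.trans (hr _).le) _ ((hlt ht).le.trans (hr _).le),
      ← ofReal_abs_toReal_sub (by simp) (by simp), ENNReal.toReal_ofReal hs.1,
      ENNReal.toReal_ofReal ht.1]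
  · refine σ.injective (hdisj _ _ _ _ ⟨ENNReal.ofReal_pos.2 hs.1, ?_⟩
      ⟨ENNReal.ofReal_pos.2 ht.1, ?_⟩ hst)
    · exact (hlt ⟨hs.1.le, hs.2⟩).trans (hr _)
    · exact (hlt ⟨ht.1.le, ht.2⟩).trans (hr _)
  -- The outer parts of the arcs form a closed set that misses `p`; removing it from the given
  -- neighbourhood leaves only points at parameter less than `r`.
  · have hcl : IsClosed (⋃ k, α k '' Icc (ENNReal.ofReal r) (L k)) :=
      isClosed_iUnion_of_finite fun k => (harc k).isClosed_image hX isClosed_Icc fun t ht => ht.2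
    have hp : p ∉ ⋃ k, α k '' Icc (ENNReal.ofReal r) (L k) := by
      simp only [mem_iUnion, not_exists]
      rintro k ⟨t, ht, htp⟩
      rw [← h0 k] at htp
      have := (harc k).injOn hX (show t ∈ Iic (L k) from ht.2) (mem_Iic.2 zero_le) htp
      rw [this] at ht
      exact absurd ht.1 (by simpa using hr0)
    filter_upwards [hn, hcl.isOpen_compl.mem_nhds hp] with y hy hy'
    rw [mem_iUnion]
    rcases hy with hy | hy
    · obtain ⟨k⟩ := ‹Nonempty K›
      exact ⟨σ.symm k, 0, ⟨le_rfl, hr0⟩, by rw [mem_singleton_iff.1 hy]; simp [h0]⟩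
    · obtain ⟨k, t, ht, rfl⟩ := mem_iUnion.1 hy
      have htr : t < ENNReal.ofReal r := by
        by_contra hcon
        exact hy' (mem_iUnion.2 ⟨k, t, ⟨not_lt.1 hcon, ht.2.le⟩, rfl⟩)
      have htop : t ≠ ⊤ := ne_top_of_lt htr
      refine ⟨σ.symm k, t.toReal, ⟨ENNReal.toReal_nonneg, ?_⟩, ?_⟩
      · exact (ENNReal.lt_ofReal_iff_toReal_lt htop).1 htr
      · simp [ENNReal.ofReal_toReal htop]

namespace IsStarChart

variable {p : X} {n : ℕ} {r : ℝ} {φ : Fin n → ℝ → X}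

lemma edist_center (h : IsStarChart p n r φ) (k : Fin n) {t : ℝ} (ht : t ∈ Ico 0 r) :
    edist p (φ k t) = ENNReal.ofReal t := by
  rw [← h.center k, h.isometric k 0 ⟨le_rfl, h.radius_pos⟩ t ht]
  simp [abs_of_nonneg ht.1]

lemma pos (h : IsStarChart p n r φ) : 0 < n := by
  rcases Nat.eq_zero_or_pos n with rfl | h'
  · have := mem_of_mem_nhds h.nhds
    simp at this
  · exact h'

lemma exists_finite_edist (h : IsStarChart p n r φ) (hX : IsEDistSpace X) :
    ∃ y, y ≠ p ∧ edist p y < ⊤ := by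
  have hr := h.radius_pos
  have h1 := h.edist_center ⟨0, h.pos⟩ (t := r / 2) ⟨by positivity, by linarith⟩
  refine ⟨_, fun h' => ?_, h1 ▸ ENNReal.ofReal_lt_top⟩
  rw [h', hX.edist_self] at h1
  exact absurd h1.symm (by simpa using hr)

lemma isArc (h : IsStarChart p n r φ) (hX : IsEDistSpace X) (k : Fin n) {ρ : ℝ} (h0 : 0 < ρ)
    (hρ : ρ < r) : IsArc (ENNReal.ofReal ρ) (fun t => φ k t.toReal) := by
  have hpos : 0 < ENNReal.ofReal ρ := ENNReal.ofReal_pos.2 h0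
  have hiso : ∀ s ≤ ENNReal.ofReal ρ, ∀ t ≤ ENNReal.ofReal ρ,
      edist (φ k s.toReal) (φ k t.toReal) = (s - t) + (t - s) := by
    intro s hs t ht
    have hs' := ne_top_of_le_ne_top ENNReal.ofReal_ne_top hs
    have ht' := ne_top_of_le_ne_top ENNReal.ofReal_ne_top ht
    rw [h.isometric k _ ⟨ENNReal.toReal_nonneg, ?_⟩ _ ⟨ENNReal.toReal_nonneg, ?_⟩,
      ofReal_abs_toReal_sub hs' ht']
    · exact ((ENNReal.toReal_le_of_le_ofReal h0.le hs)).trans_lt hρ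
    · exact ((ENNReal.toReal_le_of_le_ofReal h0.le ht)).trans_lt hρ
  exact ⟨hpos, hiso, hX.continuousOn_of_isometric hpos ENNReal.ofReal_ne_top hiso⟩

/-- Small balls around the centre of a star consist of points of the star. -/
lemma exists_ball (h : IsStarChart p n r φ) (hX : IsEDistSpace X) :
    ∃ ε : ℝ, 0 < ε ∧ ε ≤ r ∧ ∀ y, edist p y < ENNReal.ofReal ε →
      ∃ k, φ k (edist p y).toReal = y := by
  obtain ⟨ε, hε, hsub⟩ := (hX.nhds_basis p (h.exists_finite_edist hX)).mem_iff.1 h.nhds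
  obtain ⟨δ, hδ0, hδ⟩ := exists_between (lt_min hε (ENNReal.ofReal_pos.2 h.radius_pos))
  have hδt : δ ≠ ⊤ := ne_top_of_lt hδ
  refine ⟨δ.toReal, ENNReal.toReal_pos hδ0.ne' hδt, ?_, fun y hy => ?_⟩
  · exact ENNReal.toReal_le_of_le_ofReal h.radius_pos.le (hδ.le.trans (min_le_right _ _))
  · rw [ENNReal.ofReal_toReal hδt] at hy
    have := hsub (show y ∈ {y | edist p y < ε} from hy.trans (hδ.trans_le (min_le_left _ _)))
    obtain ⟨k, t, ht, rfl⟩ := mem_iUnion.1 this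
    refine ⟨k, ?_⟩
    rw [h.edist_center k ht, ENNReal.toReal_ofReal ht.1]

/-- Points of a star are parametrized by their distance from the centre, so near `p` each point of a
branch of `φ` is the point with the same parameter on some branch of `ψ`. By connectedness that
branch is the same along the whole of a short branch of `φ`, which gives an injection of the
branches. -/
lemma le_of_isStarChart (h : IsStarChart p n r φ) (hX : IsEDistSpace X) {m : ℕ} {r' : ℝ}
    {ψ : Fin m → ℝ → X} (h' : IsStarChart p m r' ψ) : n ≤ m := by
  have := hX.t2
  obtain ⟨ε, hε0, hεr, hε⟩ := h'.exists_ball hX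
  have hr := h.radius_pos
  set ρ := min ε r / 2 with hρ
  have hm : 0 < min ε r := lt_min hε0 hr
  have hρ0 : 0 < ρ := by positivity
  have hρε : ρ < ε := by have := min_le_left ε r; linarith
  have hρr : ρ < r := by have := min_le_right ε r; linarith
  have key : ∀ k, ∃ l, ∀ t ∈ Ioo 0 (ENNReal.ofReal ρ), φ k t.toReal = ψ l t.toReal := by
    intro k
    have ha := h.isArc hX k hρ0 hρr
    have hb := fun l => h'.isArc hX l hρ0 (hρε.trans_le hεr)
    have hlt : ∀ t ∈ Ioo 0 (ENNReal.ofReal ρ), t.toReal ∈ Ioo 0 ρ := fun t ht =>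
      ⟨ENNReal.toReal_pos ht.1.ne' ht.2.ne_top,
        (ENNReal.lt_ofReal_iff_toReal_lt ht.2.ne_top).1 ht.2⟩
    have hex : ∀ t ∈ Ioo 0 (ENNReal.ofReal ρ), ∃ l, φ k t.toReal = ψ l t.toReal := by
      intro t ht
      have ht' := hlt t ht
      have hd := h.edist_center k (t := t.toReal) ⟨ht'.1.le, ht'.2.trans hρr⟩
      obtain ⟨l, hl⟩ := hε (φ k t.toReal) (by
        rw [hd]; exact (ENNReal.ofReal_lt_ofReal_iff hε0).2 (ht'.2.trans hρε))
      rw [hd, ENNReal.toReal_ofReal ht'.1.le] at hl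
      exact ⟨l, hl.symm⟩
    have : Nonempty (Fin m) := ⟨⟨0, h'.pos⟩⟩
    choose! l hl using hex
    obtain ⟨t0, ht0⟩ : (Ioo 0 (ENNReal.ofReal ρ)).Nonempty :=
      nonempty_Ioo.2 (ENNReal.ofReal_pos.2 hρ0)
    refine ⟨l t0, fun t ht => ?_⟩
    have hpre : IsPreconnected (Ioo 0 (ENNReal.ofReal ρ)) := isPreconnected_Ioo
    -- The set where `φ k` agrees with a given branch of `ψ` is closed, and there are finitely many
    -- branches. Disjointness of the branches of `ψ` makes the chosen one unique.
    have hcont : ContinuousOn (fun t => l t) (Ioo 0 (ENNReal.ofReal ρ)) := by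
      rw [continuousOn_iff_isClosed]
      intro S hS
      refine ⟨⋃ l' ∈ S, {t | t ≤ ENNReal.ofReal ρ ∧ φ k t.toReal = ψ l' t.toReal}, ?_, ?_⟩
      · refine S.toFinite.isClosed_biUnion fun l' _ => ?_
        have h1 : ContinuousOn (fun t : ℝ≥0∞ => (φ k t.toReal, ψ l' t.toReal))
            (Iic (ENNReal.ofReal ρ)) := ha.continuousOn.prodMk (hb l').continuousOn
        exact h1.preimage_isClosed_of_isClosed isClosed_Iic isClosed_diagonal
      · ext t
        simp only [mem_inter_iff, mem_preimage, mem_iUnion, mem_ofPred_eq, exists_prop]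
        refine ⟨fun ⟨h1, h2⟩ => ⟨⟨l t, h1, h2.2.le, hl t h2⟩, h2⟩, fun ⟨⟨l', h1, _, h3⟩, h2⟩ => ⟨?_, h2⟩⟩
        have h4 := hl t h2
        rw [h3] at h4
        have h5 : t.toReal ∈ Ioo 0 r' := ⟨(hlt t h2).1, (hlt t h2).2.trans (hρε.trans_le hεr)⟩
        rwa [← h'.disjoint _ _ _ h5 _ h5 h4]
    have := hpre.constant hcont ht ht0
    rw [← this]; exact hl t ht
  choose l hl using key
  have hinj : Function.Injective l := by
    intro k k' hkk
    have ht : ENNReal.ofReal (ρ / 2) ∈ Ioo 0 (ENNReal.ofReal ρ) :=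
      ⟨ENNReal.ofReal_pos.2 (by positivity), (ENNReal.ofReal_lt_ofReal_iff hρ0).2 (by linarith)⟩
    have h1 := hl k _ ht
    rw [hkk, ← hl k' _ ht, ENNReal.toReal_ofReal (by positivity)] at h1
    have h2 : ρ / 2 ∈ Ioo 0 r := ⟨by positivity, by linarith⟩
    exact h.disjoint _ _ _ h2 _ h2 h1
  simpa using Fintype.card_le_of_injective l hinj

end IsStarChart

lemma HasValence.unique (hX : IsEDistSpace X) {p : X} {n m : ℕ} (h : HasValence p n)
    (h' : HasValence p m) : n = m := by
  obtain ⟨r, φ, hφ⟩ := h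
  obtain ⟨r', ψ, hψ⟩ := h'
  exact le_antisymm (hφ.le_of_isStarChart hX hψ) (hψ.le_of_isStarChart hX hφ)

/-- A point that is a limit of points at infinite distance has only itself at finite distance. -/
lemma IsArc.no_finite_edist (hX : IsEDistSpace X) {α : ℝ≥0∞ → X} (h : IsArc ⊤ α) :
    ¬ ∃ y, y ≠ α ⊤ ∧ edist (α ⊤) y < ⊤ := by
  intro hy
  have h1 : {y | edist (α ⊤) y < 1} ∈ 𝓝 (α ⊤) := (hX.nhds_basis _ hy).mem_of_mem one_pos
  have h2 : ContinuousWithinAt α (Iic ⊤) ⊤ := h.continuousOn ⊤ (by simp)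
  rw [Iic_top, continuousWithinAt_univ] at h2
  obtain ⟨a, ha, hsub⟩ := ENNReal.nhds_top_basis.mem_iff.1 (h2 h1)
  obtain ⟨b, hab, hb⟩ := exists_between ha
  have h3 : edist (α ⊤) (α b) < 1 := hsub hab
  rw [h.isometric _ le_rfl _ le_top, sub_add_sub_top hb.ne] at h3
  simp at h3

lemma IsEndChart.isArc {p : X} {γ : ℝ≥0∞ → X} (h : IsEndChart p γ) : IsArc ⊤ γ :=
  ⟨by simp, fun s _ t _ => h.isometric s t, h.continuous.continuousOn⟩

lemma IsEndChart.not_hasValence (hX : IsEDistSpace X) {p : X} {γ : ℝ≥0∞ → X}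
    (h : IsEndChart p γ) (n : ℕ) : ¬ HasValence p n := by
  rintro ⟨r, φ, hφ⟩
  have := h.isArc.no_finite_edist hX
  rw [h.end_eq] at this
  exact this (hφ.exists_finite_edist hX)

end RealGraph

/-! ### Finite graph models of a curve. -/

namespace RealGraph

variable {X : Type u} [TopologicalSpace X] [EDist X]

/-- Each point of a curve has a neighbourhood that is covered by finitely many open arcs and their
end points. -/
lemma IsCurve.exists_local_cover (hX : IsCurve X) (p : X) :
    ∃ U ∈ 𝓝 p, ∃ W : Set X, W.Finite ∧ ∃ A : Set (ℝ≥0∞ × (ℝ≥0∞ → X)), A.Finite ∧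
      (∀ a ∈ A, IsArc a.1 a.2 ∧ a.2 0 ∈ W ∧ a.2 a.1 ∈ W ∧ IsOpen (a.2 '' Ioo 0 a.1)) ∧
      U ⊆ W ∪ ⋃ a ∈ A, a.2 '' Ioo 0 a.1 := by
  have hE := hX.toIsEDistSpace
  have := hX.t2
  rcases hX.charts p with ⟨n, r, φ, h⟩ | ⟨γ, h⟩
  · obtain ⟨ε, hε0, hεr, hε⟩ := h.exists_ball hE
    have hr := h.radius_pos
    set ρ := ε / 2 with hρ
    have hρ0 : 0 < ρ := by positivity
    have hρr : ρ < r := by linarith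
    have ha := fun k => h.isArc hE k hρ0 hρr
    have hfin := h.exists_finite_edist hE
    have hmem : ∀ y, edist p y < ENNReal.ofReal ρ → y ≠ p →
        ∃ k, ∃ t ∈ Ioo 0 (ENNReal.ofReal ρ), φ k t.toReal = y := by
      intro y hy hyp
      obtain ⟨k, hk⟩ := hε y (hy.trans ((ENNReal.ofReal_lt_ofReal_iff hε0).2 (by linarith)))
      refine ⟨k, _, ⟨pos_iff_ne_zero.2 fun h0 => hyp ?_, hy⟩, hk⟩
      exact ((hE.edist_eq_zero _ _).1 h0).symm
    have hdist : ∀ k, ∀ t ≤ ENNReal.ofReal ρ, edist p (φ k t.toReal) = t := by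
      intro k t ht
      have := (ha k).edist_zero ht
      simpa [h.center k] using this
    refine ⟨{y | edist p y < ENNReal.ofReal ρ}, (hE.nhds_basis p hfin).mem_of_mem
      (ENNReal.ofReal_pos.2 hρ0), {p} ∪ range fun k => φ k ρ,
      (finite_singleton p).union (finite_range _),
      range fun k => (ENNReal.ofReal ρ, fun t => φ k t.toReal), finite_range _, ?_, ?_⟩
    · rintro _ ⟨k, rfl⟩
      refine ⟨ha k, Or.inl (by simp [h.center k]), Or.inr ⟨k, by simp [hρ0.le]⟩, ?_⟩
      -- A star chart does not assert that its open branches are open in `X`. This holds because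
      -- each is an open ball minus the centre and the other branches, which are compact.
      have heq : (fun t : ℝ≥0∞ => φ k t.toReal) '' Ioo 0 (ENNReal.ofReal ρ) =
          {y | edist p y < ENNReal.ofReal ρ} \ ({p} ∪ ⋃ l ∈ {l | l ≠ k},
            (fun t : ℝ≥0∞ => φ l t.toReal) '' Iic (ENNReal.ofReal ρ)) := by
        ext y
        constructor
        · rintro ⟨t, ht, rfl⟩
          refine ⟨by simpa [hdist k t ht.2.le] using ht.2, ?_⟩
          rintro (h1 | h1)
          · have := hdist k t ht.2.le
            simp only [mem_singleton_iff] at h1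
            rw [h1, hE.edist_self] at this
            exact ht.1.ne this
          · simp only [mem_iUnion] at h1
            obtain ⟨l, hl, s, hs, hst⟩ := h1
            have h2 := hdist l s hs
            simp only at hst
            rw [hst, hdist k t ht.2.le] at h2
            subst h2
            have h3 : t.toReal ∈ Ioo 0 r := ⟨ENNReal.toReal_pos ht.1.ne' ht.2.ne_top,
              ((ENNReal.lt_ofReal_iff_toReal_lt ht.2.ne_top).1 ht.2).trans hρr⟩
            exact hl (h.disjoint _ _ _ h3 _ h3 hst)
        · rintro ⟨hy, hn⟩
          simp only [mem_union, mem_singleton_iff, mem_iUnion, not_or, not_exists] at hn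
          obtain ⟨l, t, ht, rfl⟩ := hmem y hy hn.1
          by_cases hl : l = k
          · exact ⟨t, ht, by rw [hl]⟩
          · exact absurd ⟨t, mem_Iic.2 ht.2.le, rfl⟩ (hn.2 l hl)
      show IsOpen ((fun t : ℝ≥0∞ => φ k t.toReal) '' Ioo 0 (ENNReal.ofReal ρ))
      rw [heq]
      exact (hE.isOpen_ball hfin).sdiff (isClosed_singleton.union
        ((toFinite _).isClosed_biUnion fun l _ => (ha l).isClosed_image hE isClosed_Iic subset_rfl))
    · intro y hy
      by_cases hyp : y = p
      · exact Or.inl (Or.inl hyp)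
      · obtain ⟨k, t, ht, rfl⟩ := hmem y hy hyp
        exact Or.inr (mem_biUnion ⟨k, rfl⟩ ⟨t, ht, rfl⟩)
  · have hγ := h.isArc
    have hinj : ∀ {s t}, γ s = γ t → s = t := fun {s t} hst =>
      hγ.injOn hE (mem_Iic.2 le_top) (mem_Iic.2 le_top) hst
    obtain ⟨U, hU, hUo, hpU⟩ := mem_nhds_iff.1 h.nhds
    have h1 : γ ⁻¹' U ∈ 𝓝 ⊤ := (hUo.preimage h.continuous).mem_nhds (by simpa [h.end_eq] using hpU)
    obtain ⟨a, ha, hsub⟩ := ENNReal.nhds_top_basis.mem_iff.1 h1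
    have hcl : IsClosed (γ '' Iic a) := hγ.isClosed_image hE isClosed_Iic fun t _ => mem_Iic.2 le_top
    have hpa : p ∉ γ '' Iic a := by
      rintro ⟨t, ht, htp⟩
      rw [← h.end_eq] at htp
      rw [hinj htp] at ht
      exact absurd ht (not_le.2 ha)
    have harc : IsArc (⊤ - a) fun t => γ (a + t) := hγ.shift ha le_rfl
    rw [ENNReal.top_sub ha.ne] at harc
    have himg : (fun t => γ (a + t)) '' Ioo 0 ⊤ = γ '' Ioo a ⊤ := by
      ext y
      constructor
      · rintro ⟨t, ht, rfl⟩
        exact ⟨a + t, ⟨ENNReal.lt_add_right ha.ne ht.1.ne', ENNReal.add_lt_top.2 ⟨ha, ht.2⟩⟩, rfl⟩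
      · rintro ⟨t, ht, rfl⟩
        exact ⟨t - a, ⟨tsub_pos_of_lt ht.1, tsub_le_self.trans_lt ht.2⟩,
          by simp [add_tsub_cancel_of_le ht.1.le]⟩
    refine ⟨U \ γ '' Iic a, (hUo.sdiff hcl).mem_nhds ⟨hpU, hpa⟩, {γ a, p}, toFinite _,
      {(⊤, fun t => γ (a + t))}, finite_singleton _, ?_, ?_⟩
    · rintro _ rfl
      refine ⟨harc, by simp, by simp [h.end_eq], ?_⟩
      have heq : γ '' Ioo a ⊤ = U \ (γ '' Iic a ∪ {p}) := by
        ext y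
        constructor
        · rintro ⟨t, ht, rfl⟩
          refine ⟨hsub ht.1, ?_⟩
          rintro (⟨s, hs, hst⟩ | h2)
          · rw [hinj hst] at hs
            exact absurd ht.1 (not_lt.2 hs)
          · rw [mem_singleton_iff, ← h.end_eq] at h2
            exact ht.2.ne (hinj h2)
        · rintro ⟨hy, hn⟩
          obtain ⟨t, rfl⟩ := hU hy
          refine ⟨t, ⟨lt_of_not_ge fun h' => hn (Or.inl ⟨t, h', rfl⟩), lt_top_iff_ne_top.2 ?_⟩, rfl⟩
          rintro rfl
          exact hn (Or.inr h.end_eq)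
      show IsOpen ((fun t => γ (a + t)) '' Ioo 0 ⊤)
      rw [himg, heq]
      exact hUo.sdiff (hcl.union isClosed_singleton)
    · rintro y ⟨hy, hn⟩
      obtain ⟨t, rfl⟩ := hU hy
      simp only [biUnion_singleton, himg]
      by_cases ht : t = ⊤
      · exact Or.inl (by simp [ht, h.end_eq])
      · refine Or.inr ⟨t, ⟨lt_of_not_ge fun h' => hn ⟨t, h', rfl⟩, lt_top_iff_ne_top.2 ht⟩, rfl⟩

lemma IsCurve.exists_cover (hX : IsCurve X) :
    ∃ W : Set X, W.Finite ∧ ∃ A : Set (ℝ≥0∞ × (ℝ≥0∞ → X)), A.Finite ∧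
      (∀ a ∈ A, IsArc a.1 a.2 ∧ a.2 0 ∈ W ∧ a.2 a.1 ∈ W ∧ IsOpen (a.2 '' Ioo 0 a.1)) ∧
      ∀ x, x ∈ W ∪ ⋃ a ∈ A, a.2 '' Ioo 0 a.1 := by
  have := hX.compact
  choose U hU W hW A hA hprop hsub using hX.exists_local_cover
  obtain ⟨T, hT⟩ := CompactSpace.elim_nhds_subcover U hU
  refine ⟨⋃ p ∈ T, W p, T.finite_toSet.biUnion fun p _ => hW p, ⋃ p ∈ T, A p,
    T.finite_toSet.biUnion fun p _ => hA p, ?_, fun x => ?_⟩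
  · intro a ha
    obtain ⟨p, hp, hap⟩ := mem_iUnion₂.1 ha
    obtain ⟨h1, h2, h3, h4⟩ := hprop p a hap
    exact ⟨h1, mem_biUnion hp h2, mem_biUnion hp h3, h4⟩
  · obtain ⟨p, hp, hx⟩ := mem_iUnion₂.1 (hT.ge (mem_univ x))
    rcases hsub p hx with h | h
    · exact Or.inl (mem_biUnion hp h)
    · obtain ⟨a, ha, hxa⟩ := mem_iUnion₂.1 h
      exact Or.inr (mem_biUnion (mem_biUnion hp ha) hxa)

/-- A description of a curve as a finite graph with the set of nodes `V`. -/
structure Model (V : Set X) where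
  finite_nodes : V.Finite
  E : Type u
  finite_edges : Finite E
  L : E → ℝ≥0∞
  α : E → ℝ≥0∞ → X
  arc : ∀ e, IsArc (L e) (α e)
  src_mem : ∀ e, α e 0 ∈ V
  tgt_mem : ∀ e, α e (L e) ∈ V
  isOpen : ∀ e, IsOpen (α e '' Ioo 0 (L e))
  not_mem : ∀ e, ∀ t ∈ Ioo 0 (L e), α e t ∉ V
  disj : ∀ e e' t t', t ∈ Ioo 0 (L e) → t' ∈ Ioo 0 (L e') → α e t = α e' t' → e = e'
  cover : ∀ x, x ∉ V → ∃ e, ∃ t ∈ Ioo 0 (L e), α e t = x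

omit [EDist X] in
/-- A preconnected subset of the complement of `V` that meets an open subset `O` whose closure is
contained in `O ∪ V` is contained in `O`. -/
lemma subset_of_isPreconnected {V S O C : Set X} (hS : IsPreconnected S) (hSV : S ∩ V = ∅)
    (hO : IsOpen O) (hC : IsClosed C) (hOC : O ⊆ C) (hCO : C ⊆ O ∪ V) (hne : (S ∩ O).Nonempty) :
    S ⊆ O := by
  refine hS.subset_left_of_subset_union hO hC.isOpen_compl
    (disjoint_compl_right.mono_left hOC) (fun x hx => ?_) hne
  by_cases hxC : x ∈ C
  · rcases hCO hxC with h | h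
    · exact Or.inl h
    · exact absurd (show x ∈ S ∩ V from ⟨hx, h⟩) (by simp [hSV])
  · exact Or.inr hxC

lemma Iic_eq_union_Ioo {L : ℝ≥0∞} : Iic L ⊆ Ioo 0 L ∪ {0, L} := by
  intro t ht
  rcases eq_or_ne t 0 with h | h
  · simp [h]
  · rcases eq_or_lt_of_le (mem_Iic.1 ht) with h' | h'
    · simp [h']
    · exact Or.inl ⟨pos_iff_ne_zero.2 h, h'⟩

/-- Every large enough finite set is the set of nodes of a model. -/
lemma IsCurve.exists_model (hX : IsCurve X) :
    ∃ W : Set X, W.Finite ∧ ∀ V : Set X, V.Finite → W ⊆ V → Nonempty (Model V) := by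
  have hE := hX.toIsEDistSpace
  obtain ⟨W, hW, A, hA, hprop, hcov⟩ := hX.exists_cover
  refine ⟨W, hW, fun V hV hWV => ?_⟩
  set T : (ℝ≥0∞ × (ℝ≥0∞ → X)) → Set ℝ≥0∞ := fun a => {t | t ≤ a.1 ∧ a.2 t ∈ V} with hT
  have hTfin : ∀ a ∈ A, (T a).Finite := by
    intro a ha
    refine Finite.of_finite_image (f := a.2) (hV.subset ?_) ?_
    · rintro _ ⟨t, ht, rfl⟩
      exact ht.2
    · exact ((hprop a ha).1.injOn hE).mono fun t ht => ht.1
  -- The arcs of the cover may overlap. An edge is therefore recorded as a subset of `X`, a piece of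
  -- an arc between consecutive points of `V`; a piece found on several arcs then counts once.
  let IsEdge : Set X → (ℝ≥0∞ × (ℝ≥0∞ → X)) × (ℝ≥0∞ × ℝ≥0∞) → Prop := fun C q =>
    q.1 ∈ A ∧ q.2.1 ∈ T q.1 ∧ q.2.2 ∈ T q.1 ∧ q.2.1 < q.2.2 ∧ Ioo q.2.1 q.2.2 ∩ T q.1 = ∅ ∧
      C = q.1.2 '' Ioo q.2.1 q.2.2
  have hfin : Finite {C : Set X // ∃ q, IsEdge C q} := by
    have : (⋃ a ∈ A, (fun b : ℝ≥0∞ × ℝ≥0∞ => a.2 '' Ioo b.1 b.2) '' (T a ×ˢ T a)).Finite :=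
      hA.biUnion fun a ha => ((hTfin a ha).prod (hTfin a ha)).image _
    refine (this.subset ?_ : {C : Set X | ∃ q, IsEdge C q}.Finite)
    rintro C ⟨q, h1, h2, h3, -, -, h6⟩
    exact mem_biUnion h1 ⟨q.2, ⟨h2, h3⟩, h6.symm⟩
  choose q hq using fun C : {C : Set X // ∃ q, IsEdge C q} => C.2
  let L : {C : Set X // ∃ q, IsEdge C q} → ℝ≥0∞ := fun C => (q C).2.2 - (q C).2.1
  let α : {C : Set X // ∃ q, IsEdge C q} → ℝ≥0∞ → X := fun C t => (q C).1.2 ((q C).2.1 + t)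
  have harc : ∀ C, IsArc (L C) (α C) := fun C =>
    (hprop _ (hq C).1).1.shift (hq C).2.2.2.1 (hq C).2.2.1.1
  have hsrc : ∀ C, α C 0 ∈ V := fun C => by simpa [α] using (hq C).2.1.2
  have htgt : ∀ C, α C (L C) ∈ V := fun C => by
    simpa [α, L, add_tsub_cancel_of_le (hq C).2.2.2.1.le] using (hq C).2.2.1.2
  have himg : ∀ C, α C '' Ioo 0 (L C) = C.1 := by
    intro C
    obtain ⟨-, -, -, h4, -, h6⟩ := hq C
    rw [h6]
    ext y
    constructor
    · rintro ⟨t, ht, rfl⟩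
      exact ⟨_, ⟨ENNReal.lt_add_right (ne_top_of_lt h4) ht.1.ne', lt_tsub_iff_left.1 ht.2⟩, rfl⟩
    · rintro ⟨t, ht, rfl⟩
      refine ⟨t - (q C).2.1, ⟨tsub_pos_of_lt ht.1, ?_⟩, by simp [α, add_tsub_cancel_of_le ht.1.le]⟩
      exact lt_tsub_iff_left.2 (by rw [add_tsub_cancel_of_le ht.1.le]; exact ht.2)
  have hopen : ∀ C, IsOpen (α C '' Ioo 0 (L C)) := by
    intro C
    rw [himg C]
    obtain ⟨h1, -, h3, -, -, h6⟩ := hq C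
    rw [h6]
    exact (hprop _ h1).1.isOpen_image_Ioo hE (hprop _ h1).2.2.2 h3.1
  have hnot : ∀ C, ∀ t ∈ Ioo 0 (L C), α C t ∉ V := by
    intro C t ht hV
    obtain ⟨h1, -, h3, h4, h5, -⟩ := hq C
    have h7 : (q C).2.1 + t < (q C).2.2 := lt_tsub_iff_left.1 ht.2
    have : (q C).2.1 + t ∈ Ioo (q C).2.1 (q C).2.2 ∩ T (q C).1 :=
      ⟨⟨ENNReal.lt_add_right (ne_top_of_lt h4) ht.1.ne', h7⟩, h7.le.trans h3.1, hV⟩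
    rw [h5] at this
    exact this
  -- An edge is connected and avoids `V`, and the closed arc of another edge adds only points of `V`
  -- to it. So edges that meet are equal.
  have hsubset : ∀ C C' : {C : Set X // ∃ q, IsEdge C q}, (C.1 ∩ C'.1).Nonempty → C.1 ⊆ C'.1 := by
    intro C C' hne
    rw [← himg C, ← himg C'] at *
    refine subset_of_isPreconnected (V := V)
      ((harc C).isPreconnected_image ordConnected_Ioo fun t ht => ht.2.le) ?_ (hopen C')
      ((harc C').isClosed_image hE isClosed_Iic subset_rfl)
      (image_mono fun t ht => ht.2.le) ?_ hne
    · rw [← disjoint_iff_inter_eq_empty, disjoint_left]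
      rintro _ ⟨t, ht, rfl⟩
      exact hnot C t ht
    · rintro _ ⟨t, ht, rfl⟩
      rcases Iic_eq_union_Ioo ht with h | h | h
      · exact Or.inl ⟨t, h, rfl⟩
      · exact Or.inr (h ▸ hsrc C')
      · exact Or.inr ((mem_singleton_iff.1 h) ▸ htgt C')
  refine ⟨⟨hV, {C : Set X // ∃ q, IsEdge C q}, hfin, L, α, harc, hsrc, htgt, hopen, hnot, ?_, ?_⟩⟩
  · intro C C' t t' ht ht' htt
    have h1 : α C t ∈ C.1 := himg C ▸ ⟨t, ht, rfl⟩
    have h2 : α C t ∈ C'.1 := htt ▸ himg C' ▸ ⟨t', ht', rfl⟩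
    exact Subtype.ext ((hsubset C C' ⟨_, h1, h2⟩).antisymm (hsubset C' C ⟨_, h2, h1⟩))
  · intro x hx
    rcases hcov x with h | h
    · exact absurd (hWV h) hx
    obtain ⟨a, ha, t, ht, rfl⟩ := mem_iUnion₂.1 h
    obtain ⟨h1, h2, h3, h4⟩ := hprop a ha
    have hlow : ({s | s ∈ T a ∧ s < t}).Finite := (hTfin a ha).subset fun s hs => hs.1
    have hup : ({s | s ∈ T a ∧ t < s}).Finite := (hTfin a ha).subset fun s hs => hs.1
    -- The parameters of nodes closest to `t` from below and from above bound the edge through the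
    -- point. They exist because the ends of the arc lie in `W ⊆ V`.
    obtain ⟨b, hb, hbmax⟩ := hlow.exists_maximal ⟨0, ⟨zero_le, hWV h2⟩, ht.1⟩
    obtain ⟨c, hc, hcmin⟩ := hup.exists_minimal ⟨a.1, ⟨le_rfl, hWV h3⟩, ht.2⟩
    have hedge : IsEdge (a.2 '' Ioo b c) (a, (b, c)) := by
      refine ⟨ha, hb.1, hc.1, hb.2.trans hc.2, ?_, rfl⟩
      rw [← disjoint_iff_inter_eq_empty, disjoint_left]
      rintro s hs hsT
      rcases lt_trichotomy s t with hst | rfl | hst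
      · exact absurd hs.1 (not_lt.2 (hbmax ⟨hsT, hst⟩ hs.1.le))
      · exact hx hsT.2
      · exact absurd hs.2 (not_lt.2 (hcmin ⟨hsT, hst⟩ hs.2.le))
    obtain ⟨s, hs, hst⟩ : a.2 t ∈ α ⟨_, _, hedge⟩ '' Ioo 0 (L ⟨_, _, hedge⟩) := by
      rw [himg]
      exact ⟨t, ⟨hb.2, hc.2⟩, rfl⟩
    exact ⟨_, s, hs, hst⟩

end RealGraph

/-! ### Local structure at interior points of edges and at finite nodes. -/

namespace RealGraph

variable {X : Type u} [TopologicalSpace X] [EDist X]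

lemma hasOrder_of_arcs (hX : IsEDistSpace X) {K : Type*} [Fintype K] [Nonempty K] {p : X}
    {L : K → ℝ≥0∞} {α : K → ℝ≥0∞ → X} (harc : ∀ k, IsArc (L k) (α k)) (h0 : ∀ k, α k 0 = p)
    (hdisj : ∀ k l s t, s ∈ Ioo 0 (L k) → t ∈ Ioo 0 (L l) → α k s = α l t → k = l)
    (hn : {p} ∪ ⋃ k, α k '' Ioo 0 (L k) ∈ 𝓝 p) {f : X → EReal} {a : ℝ} {σ : K → ℤ}
    (hf : ∀ k, ∀ t : ℝ, 0 ≤ t → ENNReal.ofReal t < L k →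
      f (α k (ENNReal.ofReal t)) = ((a + (σ k : ℝ) * t : ℝ) : EReal)) :
    HasOrder f p (∑ k, σ k) := by
  obtain ⟨r, hr0, hr, hstar⟩ := exists_isStarChart_of_arcs hX harc h0 hdisj hn
  let τ : Fin (Fintype.card K) ≃ K := (Fintype.equivFin K).symm
  refine Or.inl ⟨_, r, _, a, fun k => σ (τ k), hstar _ τ, fun k t ht => ?_, ?_⟩
  · exact hf _ t ht.1 (((ENNReal.ofReal_lt_ofReal_iff hr0).2 ht.2).trans (hr _))
  · exact (Equiv.sum_comp τ σ).symm

/-- A point near `p` lies on some branch with its distance from `p` as parameter, so continuity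
reduces to finitely many affine functions of one variable at 0. -/
lemma IsStarChart.continuousAt (hX : IsEDistSpace X) {p : X} {n : ℕ} {r : ℝ} {φ : Fin n → ℝ → X}
    (h : IsStarChart p n r φ) {f : X → EReal} {a : ℝ} {σ : Fin n → ℤ}
    (hf : ∀ k, ∀ t ∈ Ico 0 r, f (φ k t) = ((a + (σ k : ℝ) * t : ℝ) : EReal)) :
    ContinuousAt f p := by
  have hfp : f p = (a : EReal) := by
    have := hf ⟨0, h.pos⟩ 0 ⟨le_rfl, h.radius_pos⟩
    rw [h.center] at this
    simpa using this
  intro N hN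
  rw [hfp] at hN
  obtain ⟨ε, hε0, hεr, hε⟩ := h.exists_ball hX
  have key : ∀ k, ∀ᶠ t in 𝓝 (0 : ℝ), ((a + (σ k : ℝ) * t : ℝ) : EReal) ∈ N := by
    intro k
    have hc : Continuous fun t : ℝ => ((a + (σ k : ℝ) * t : ℝ) : EReal) :=
      continuous_coe_real_ereal.comp (by fun_prop)
    exact hc.continuousAt (by simpa using hN)
  obtain ⟨η, hη, hball⟩ := Metric.eventually_nhds_iff.1 (Filter.eventually_all.2 key)
  have h1 := (hX.nhds_basis p (h.exists_finite_edist hX)).mem_of_mem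
    (ENNReal.ofReal_pos.2 (lt_min hε0 hη))
  refine Filter.mem_map.2 (Filter.mem_of_superset h1 fun y hy => ?_)
  have hy' : edist p y < ENNReal.ofReal (min ε η) := hy
  have htop : edist p y ≠ ⊤ := ne_top_of_lt hy'
  have hlt := (ENNReal.lt_ofReal_iff_toReal_lt htop).1 hy'
  obtain ⟨k, hk⟩ := hε y (hy'.trans_le (ENNReal.ofReal_le_ofReal (min_le_left _ _)))
  show f y ∈ N
  rw [← hk, hf k _ ⟨ENNReal.toReal_nonneg, hlt.trans_le ((min_le_left _ _).trans hεr)⟩]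
  refine hball ?_ k
  rw [Real.dist_0_eq_abs, abs_of_nonneg ENNReal.toReal_nonneg]
  exact hlt.trans_le (min_le_right _ _)

lemma IsEndChart.continuousAt (hX : IsEDistSpace X) {p : X} {γ : ℝ≥0∞ → X} (h : IsEndChart p γ)
    {f : X → EReal} (hf : ContinuousAt (f ∘ γ) ⊤) : ContinuousAt f p := by
  intro N hN
  rw [← h.end_eq] at hN
  obtain ⟨O, hO, hOo, htop⟩ := mem_nhds_iff.1 (hf hN)
  have hcl : IsClosed (γ '' Oᶜ) := h.isArc.isClosed_image hX hOo.isClosed_compl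
    fun t _ => mem_Iic.2 le_top
  have hp : p ∉ γ '' Oᶜ := by
    rintro ⟨t, ht, htp⟩
    rw [← h.end_eq] at htp
    rw [h.isArc.injOn hX (mem_Iic.2 le_top) (mem_Iic.2 le_top) htp] at ht
    exact ht htop
  refine Filter.mem_map.2 ?_
  filter_upwards [h.nhds, hcl.isOpen_compl.mem_nhds hp] with y hy hy'
  obtain ⟨t, rfl⟩ := hy
  by_contra hcon
  exact hy' ⟨t, fun ht => hcon (hO ht), rfl⟩

/-- The two arcs into which a point divides an arc. -/
def splitArc (L : ℝ≥0∞) (α : ℝ≥0∞ → X) (t : ℝ≥0∞) : Bool → ℝ≥0∞ × (ℝ≥0∞ → X)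
  | false => (L - t, fun s => α (t + s))
  | true => (t, fun s => α (t - s))

section Split

variable {L : ℝ≥0∞} {α : ℝ≥0∞ → X} {t : ℝ≥0∞}

lemma splitArc_isArc (h : IsArc L α) (ht : t ∈ Ioo 0 L) (b : Bool) :
    IsArc (splitArc L α t b).1 (splitArc L α t b).2 := by
  cases b
  · exact h.shift ht.2 le_rfl
  · exact (h.of_le ht.1 ht.2.le).reverse ht.2.ne_top

omit [TopologicalSpace X] [EDist X] in
lemma splitArc_zero (b : Bool) : (splitArc L α t b).2 0 = α t := by
  cases b <;> simp [splitArc]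

lemma splitArc_disjoint (h : IsArc L α) (hX : IsEDistSpace X) (ht : t ∈ Ioo 0 L) (b b' : Bool)
    (s s' : ℝ≥0∞) (hs : s ∈ Ioo 0 (splitArc L α t b).1) (hs' : s' ∈ Ioo 0 (splitArc L α t b').1)
    (heq : (splitArc L α t b).2 s = (splitArc L α t b').2 s') : b = b' := by
  have key : ∀ s s' : ℝ≥0∞, s ∈ Ioo 0 (L - t) → s' ∈ Ioo 0 t → α (t + s) ≠ α (t - s') := by
    intro s s' hs hs' heq
    have := h.injOn hX (mem_Iic.2 (lt_tsub_iff_left.1 hs.2).le)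
      (mem_Iic.2 (tsub_le_self.trans ht.2.le)) heq
    have h1 : t < t + s := ENNReal.lt_add_right ht.2.ne_top hs.1.ne'
    rw [this] at h1
    exact absurd h1 (not_lt.2 tsub_le_self)
  cases b <;> cases b'
  · rfl
  · exact absurd heq (key _ _ hs hs')
  · exact absurd heq.symm (key _ _ hs' hs)
  · rfl

lemma splitArc_nhds (h : IsArc L α) (hX : IsEDistSpace X) (ht : t ∈ Ioo 0 L)
    (hn : α '' Iic L ∈ 𝓝 (α t)) :
    {α t} ∪ ⋃ b, (splitArc L α t b).2 '' Ioo 0 (splitArc L α t b).1 ∈ 𝓝 (α t) := by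
  have hcl : IsClosed (α '' {0, L}) := h.isClosed_image hX (toFinite _).isClosed (by
    rintro s (rfl | rfl) <;> simp)
  have hmem : α t ∉ α '' {0, L} := by
    rintro ⟨s, hs, hst⟩
    have hsL : s ≤ L := by rcases hs with rfl | rfl <;> simp
    rw [h.injOn hX hsL ht.2.le hst] at hs
    rcases hs with hs | hs
    · exact ht.1.ne' hs
    · exact ht.2.ne hs
  filter_upwards [hn, hcl.isOpen_compl.mem_nhds hmem] with y hy hy'
  obtain ⟨s, hs, rfl⟩ := hy
  rcases Iic_eq_union_Ioo hs with hs' | hs'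
  · rcases lt_trichotomy s t with hst | rfl | hst
    · refine Or.inr (mem_iUnion.2 ⟨true, t - s, ⟨tsub_pos_of_lt hst, ?_⟩, ?_⟩)
      · exact ENNReal.sub_lt_self ht.2.ne_top ht.1.ne' hs'.1.ne'
      · simp [splitArc, ENNReal.sub_sub_cancel ht.2.ne_top hst.le]
    · exact Or.inl rfl
    · refine Or.inr (mem_iUnion.2 ⟨false, s - t, ⟨tsub_pos_of_lt hst, ?_⟩, ?_⟩)
      · exact lt_tsub_iff_left.2 (by rw [add_tsub_cancel_of_le hst.le]; exact hs'.2)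
      · simp [splitArc, add_tsub_cancel_of_le hst.le]
  · exact absurd ⟨s, hs', rfl⟩ hy'

/-- The interior points of an arc have valence `2`. -/
lemma IsArc.hasValence_two (h : IsArc L α) (hX : IsEDistSpace X) (ht : t ∈ Ioo 0 L)
    (hn : α '' Iic L ∈ 𝓝 (α t)) : HasValence (α t) 2 := by
  obtain ⟨r, -, -, hstar⟩ := exists_isStarChart_of_arcs hX (splitArc_isArc h ht) splitArc_zero
    (splitArc_disjoint h hX ht) (splitArc_nhds h hX ht hn)
  exact ⟨r, _, hstar 2 finTwoEquiv⟩

/-- The point divides the arc into two branches on which the outgoing slopes are `c` and `-c`. -/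
lemma IsArc.hasOrder_zero (h : IsArc L α) (hX : IsEDistSpace X) (ht : t ∈ Ioo 0 L)
    (hn : α '' Iic L ∈ 𝓝 (α t)) {f : X → EReal} {a : ℝ} {c : ℤ}
    (hf : ∀ s : ℝ, 0 ≤ s → ENNReal.ofReal s < L →
      f (α (ENNReal.ofReal s)) = ((a + (c : ℝ) * s : ℝ) : EReal)) : HasOrder f (α t) 0 := by
  have htt := ht.2.ne_top
  have := hasOrder_of_arcs hX (splitArc_isArc h ht) splitArc_zero
    (splitArc_disjoint h hX ht) (splitArc_nhds h hX ht hn) (f := f) (a := a + c * t.toReal)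
    (σ := fun b => cond b (-c) c) ?_
  · simpa using this
  · rintro (_ | _) s hs0 hs
    · have hs' : t + ENNReal.ofReal s < L := lt_tsub_iff_left.1 hs
      have heq : t + ENNReal.ofReal s = ENNReal.ofReal (t.toReal + s) := by
        rw [ENNReal.ofReal_add ENNReal.toReal_nonneg hs0, ENNReal.ofReal_toReal htt]
      show f (α (t + ENNReal.ofReal s)) = _
      rw [heq] at hs' ⊢
      rw [hf _ (by positivity) hs']
      congr 1
      simp only [cond_false]; ring
    · have hs' : ENNReal.ofReal s < t := hs
      have heq : t - ENNReal.ofReal s = ENNReal.ofReal (t.toReal - s) := by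
        rw [ENNReal.ofReal_sub _ hs0, ENNReal.ofReal_toReal htt]
      show f (α (t - ENNReal.ofReal s)) = _
      have h1 : t - ENNReal.ofReal s < L := tsub_le_self.trans_lt ht.2
      rw [heq] at h1 ⊢
      rw [hf _ (sub_nonneg.2 ((ENNReal.ofReal_lt_iff_lt_toReal hs0 htt).1 hs').le) h1]
      congr 1
      simp only [cond_true]; push_cast; ring

end Split

namespace Model

variable {V : Set X} (M : Model V)

lemma src_ne_tgt (hX : IsEDistSpace X) (e : M.E) : M.α e 0 ≠ M.α e (M.L e) := fun h =>
  (M.arc e).pos.ne ((M.arc e).injOn hX (mem_Iic.2 zero_le) (mem_Iic.2 le_rfl) h)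

lemma isClosed_edge (hX : IsEDistSpace X) (e : M.E) : IsClosed (M.α e '' Iic (M.L e)) :=
  (M.arc e).isClosed_image hX isClosed_Iic subset_rfl

/-- A node together with the edges that end there is a neighbourhood of the node. -/
lemma nhds_node (hX : IsEDistSpace X) (v : X) (hv : v ∈ V) :
    {v} ∪ ⋃ e ∈ {e | M.α e 0 = v ∨ M.α e (M.L e) = v}, M.α e '' Ioo 0 (M.L e) ∈ 𝓝 v := by
  have := hX.t2
  have := M.finite_edges
  have h1 : IsClosed (V \ {v}) := (M.finite_nodes.subset sdiff_subset).isClosed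
  have h2 : IsClosed (⋃ e ∈ {e | ¬ (M.α e 0 = v ∨ M.α e (M.L e) = v)}, M.α e '' Iic (M.L e)) :=
    (toFinite _).isClosed_biUnion fun e _ => M.isClosed_edge hX e
  have h3 : v ∉ ⋃ e ∈ {e | ¬ (M.α e 0 = v ∨ M.α e (M.L e) = v)}, M.α e '' Iic (M.L e) := by
    simp only [mem_iUnion, not_exists]
    rintro e he ⟨t, ht, rfl⟩
    rcases Iic_eq_union_Ioo ht with h | rfl | rfl
    · exact M.not_mem e t h hv
    · exact he (Or.inl rfl)
    · exact he (Or.inr rfl)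
  filter_upwards [h1.isOpen_compl.mem_nhds (show v ∉ V \ {v} by simp),
    h2.isOpen_compl.mem_nhds h3] with y hy1 hy2
  by_cases hyV : y ∈ V
  · exact Or.inl (by by_contra h; exact hy1 ⟨hyV, h⟩)
  · obtain ⟨e, t, ht, rfl⟩ := M.cover y hyV
    refine Or.inr (mem_biUnion ?_ ⟨t, ht, rfl⟩)
    by_contra h
    exact hy2 (mem_biUnion h ⟨t, mem_Iic.2 ht.2.le, rfl⟩)

lemma eventually_node (hX : IsEDistSpace X) {v : X} (hv : v ∈ V) {P : X → Prop} (h0 : P v)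
    (h1 : ∀ e, M.α e 0 = v ∨ M.α e (M.L e) = v → ∀ t ∈ Ioo 0 (M.L e), P (M.α e t)) :
    ∀ᶠ y in 𝓝 v, P y := by
  filter_upwards [M.nhds_node hX v hv] with y hy
  rcases hy with rfl | hy
  · exact h0
  · obtain ⟨e, he, t, ht, rfl⟩ := mem_iUnion₂.1 hy
    exact h1 e he t ht

lemma eventually_edge {e : M.E} {t : ℝ≥0∞} (ht : t ∈ Ioo 0 (M.L e)) {P : X → Prop}
    (h : ∀ t ∈ Ioo 0 (M.L e), P (M.α e t)) : ∀ᶠ y in 𝓝 (M.α e t), P y := by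
  filter_upwards [(M.isOpen e).mem_nhds ⟨t, ht, rfl⟩] with y hy
  obtain ⟨s, hs, rfl⟩ := hy
  exact h s hs

/-- Every point is a node or lies in the interior of an edge. -/
lemma forall_of_nodes_of_edges {P : X → Prop} (h0 : ∀ v ∈ V, P v)
    (h1 : ∀ e, ∀ t ∈ Ioo 0 (M.L e), P (M.α e t)) (x : X) : P x := by
  by_cases hx : x ∈ V
  · exact h0 x hx
  · obtain ⟨e, t, ht, rfl⟩ := M.cover x hx
    exact h1 e t ht

lemma edge_mem_nhds {e : M.E} {t : ℝ≥0∞} (ht : t ∈ Ioo 0 (M.L e)) :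
    M.α e '' Iic (M.L e) ∈ 𝓝 (M.α e t) :=
  Filter.mem_of_superset ((M.isOpen e).mem_nhds ⟨t, ht, rfl⟩) (image_mono fun _ h => h.2.le)

/-- The starting point (`false`) and the end point (`true`) of an edge. -/
def endpoint (d : M.E × Bool) : X := cond d.2 (M.α d.1 (M.L d.1)) (M.α d.1 0)

/-- The parametrization of an edge that starts at the given end. -/
def path (d : M.E × Bool) (t : ℝ≥0∞) : X := cond d.2 (M.α d.1 (M.L d.1 - t)) (M.α d.1 t)

lemma path_zero (d : M.E × Bool) : M.path d 0 = M.endpoint d := by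
  obtain ⟨e, _ | _⟩ := d <;> simp [path, endpoint]

/-- The ends of edges at a point. -/
abbrev Ends (v : X) : Type u := {d : M.E × Bool // M.endpoint d = v}

lemma finite_ends (v : X) : Finite (M.Ends v) :=
  have := M.finite_edges
  Subtype.finite

/-- A node at which no unbounded edge tends to infinity. -/
def IsFiniteNode (v : X) : Prop := ∀ e, M.L e = ⊤ → M.α e ⊤ ≠ v

section FiniteNode

variable (hX : IsEDistSpace X) {v : X} (hv : M.IsFiniteNode v)
include hX hv

omit hX in
lemma path_isArc (d : M.Ends v) : IsArc (M.L d.1.1) (M.path d.1) := by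
  obtain ⟨⟨e, _ | _⟩, hd⟩ := d
  · exact M.arc e
  · refine (M.arc e).reverse fun h => hv e h ?_
    simpa [endpoint, h] using hd

omit hX in
lemma path_mem_interior (d : M.Ends v) {t : ℝ≥0∞} (ht : t ∈ Ioo 0 (M.L d.1.1)) :
    ∃ s ∈ Ioo 0 (M.L d.1.1), M.path d.1 t = M.α d.1.1 s := by
  obtain ⟨⟨e, _ | _⟩, hd⟩ := d
  · exact ⟨t, ht, rfl⟩
  · have htop : M.L e ≠ ⊤ := fun h => hv e h (by simpa [endpoint, h] using hd)
    exact ⟨M.L e - t, ⟨tsub_pos_of_lt ht.2,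
      ENNReal.sub_lt_self htop (M.arc e).pos.ne' ht.1.ne'⟩, rfl⟩

lemma path_disjoint (d d' : M.Ends v) (s t : ℝ≥0∞) (hs : s ∈ Ioo 0 (M.L d.1.1))
    (ht : t ∈ Ioo 0 (M.L d'.1.1)) (heq : M.path d.1 s = M.path d'.1 t) : d = d' := by
  obtain ⟨s', hs', h1⟩ := M.path_mem_interior hv d hs
  obtain ⟨t', ht', h2⟩ := M.path_mem_interior hv d' ht
  have := M.disj _ _ _ _ hs' ht' (by rw [← h1, ← h2, heq])
  obtain ⟨⟨e, b⟩, hd⟩ := d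
  obtain ⟨⟨e', b'⟩, hd'⟩ := d'
  simp only at this
  subst this
  have hne := M.src_ne_tgt hX e
  cases b <;> cases b' <;> first | rfl | skip
  · exact absurd (hd.trans hd'.symm) hne
  · exact absurd (hd'.trans hd.symm) hne

lemma path_nhds (hvV : v ∈ V) :
    {v} ∪ ⋃ d : M.Ends v, M.path d.1 '' Ioo 0 (M.L d.1.1) ∈ 𝓝 v := by
  refine M.eventually_node hX hvV (P := fun y => y ∈ {v} ∪ ⋃ d : M.Ends v, M.path d.1 '' Ioo 0 (M.L d.1.1)) (Or.inl rfl) ?_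
  rintro e (he | he) t ht
  · exact Or.inr (mem_iUnion.2 ⟨⟨(e, false), he⟩, t, ht, rfl⟩)
  · have htop : M.L e ≠ ⊤ := fun h => hv e h (by rwa [h] at he)
    refine Or.inr (mem_iUnion.2 ⟨⟨(e, true), he⟩, M.L e - t, ⟨tsub_pos_of_lt ht.2,
      ENNReal.sub_lt_self htop (M.arc e).pos.ne' ht.1.ne'⟩, ?_⟩)
    simp [path, ENNReal.sub_sub_cancel htop ht.2.le]

end FiniteNode

/-- A node without edges would be open and closed, hence the whole connected space; but every chart
contains at least two points. -/
lemma nonempty_ends (hX : IsCurve X) {v : X} (hvV : v ∈ V) : Nonempty (M.Ends v) := by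
  have hE := hX.toIsEDistSpace
  have := hX.t2
  have := hX.connected
  by_contra hcon
  have hno : ∀ e, ¬ (M.α e 0 = v ∨ M.α e (M.L e) = v) := by
    rintro e (he | he)
    · exact hcon ⟨⟨(e, false), he⟩⟩
    · exact hcon ⟨⟨(e, true), he⟩⟩
  have hopen : IsOpen ({v} : Set X) := by
    rw [isOpen_iff_mem_nhds]
    rintro _ rfl
    exact M.eventually_node hE hvV rfl fun e he => absurd he (hno e)
  have huniv : ({v} : Set X) = univ :=
    IsClopen.eq_univ ⟨isClosed_singleton, hopen⟩ ⟨v, rfl⟩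
  have hsub : ∀ y, y = v := fun y => by
    have := mem_univ y
    rwa [← huniv] at this
  rcases hX.charts v with ⟨n, r, φ, h⟩ | ⟨γ, h⟩
  · obtain ⟨y, hy, -⟩ := h.exists_finite_edist hE
    exact hy (hsub y)
  · have := h.isArc.injOn hE (mem_Iic.2 zero_le) (mem_Iic.2 le_top) ((hsub (γ 0)).trans (hsub (γ ⊤)).symm)
    simp at this

lemma hasValence_node (hX : IsCurve X) {v : X} (hvV : v ∈ V) (hv : M.IsFiniteNode v) :
    HasValence v (Nat.card (M.Ends v)) := by
  have hE := hX.toIsEDistSpace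
  have := M.finite_ends v
  have := M.nonempty_ends hX hvV
  obtain ⟨r, -, -, hstar⟩ := exists_isStarChart_of_arcs hE (M.path_isArc hv)
    (fun d => (M.path_zero d.1).trans d.2) (M.path_disjoint hE hv) (M.path_nhds hE hv hvV)
  exact ⟨r, _, hstar _ (Finite.equivFin _).symm⟩

end Model

end RealGraph

/-! ### Points at infinity, and principal divisors of edgewise affine functions. -/

namespace RealGraph

variable {X : Type u} [TopologicalSpace X] [EDist X]

namespace Model

variable {V : Set X} (M : Model V)

/-- A point at infinity is an end of one edge only. -/
lemma eq_of_endpoint_eq_top (hX : IsCurve X) {e : M.E} (he : M.L e = ⊤) {d : M.E × Bool}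
    (hd : M.endpoint d = M.α e ⊤) : d = (e, true) := by
  have hE := hX.toIsEDistSpace
  have := hX.t2
  have harc := fun e' (h : M.L e' = ⊤) => h ▸ M.arc e'
  have hno := (harc e he).no_finite_edist hE
  obtain ⟨e', b⟩ := d
  cases b
  · rw [← hd] at hno
    exact absurd ((M.arc e').exists_finite_edist hE zero_le (by simp)) hno
  by_cases he' : M.L e' = ⊤
  swap
  · rw [← hd] at hno
    exact absurd ((M.arc e').exists_finite_edist hE le_rfl he') hno
  have hd' : M.α e' ⊤ = M.α e ⊤ := by
    have : M.α e' (M.L e') = M.α e ⊤ := hd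
    rwa [he'] at this
  rcases hX.charts (M.α e ⊤) with ⟨n, r, φ, h⟩ | ⟨γ, h⟩
  · exact absurd (h.exists_finite_edist hE) hno
  have hinj : ∀ {s t}, γ s = γ t → s = t := fun {s t} hst =>
    h.isArc.injOn hE (mem_Iic.2 le_top) (mem_Iic.2 le_top) hst
  have h1 : IsClosed (V \ {M.α e ⊤}) := (M.finite_nodes.subset sdiff_subset).isClosed
  have h2 : γ ⁻¹' (V \ {M.α e ⊤})ᶜ ∈ 𝓝 ⊤ :=
    (h1.isOpen_compl.preimage h.continuous).mem_nhds (by simp [h.end_eq])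
  obtain ⟨a, ha, hsub⟩ := ENNReal.nhds_top_basis.mem_iff.1 h2
  have hSV : γ '' Ioo a ⊤ ∩ V = ∅ := by
    rw [← disjoint_iff_inter_eq_empty, disjoint_left]
    rintro _ ⟨t, ht, rfl⟩ hV
    refine hsub ht.1 ⟨hV, fun heq => ht.2.ne (hinj ?_)⟩
    rw [mem_singleton_iff.1 heq, h.end_eq]
  -- A tail of the end chart, without the point at infinity, is connected and free of nodes. It
  -- meets each edge that tends to the point, so it is contained in that edge; two such edges then
  -- share a point.
  have hmeet : ∀ e', M.L e' = ⊤ → M.α e' ⊤ = M.α e ⊤ →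
      γ '' Ioo a ⊤ ⊆ M.α e' '' Ioo 0 (M.L e') := by
    intro e' he' hv
    refine subset_of_isPreconnected (h.isArc.isPreconnected_image ordConnected_Ioo
      fun t _ => mem_Iic.2 le_top) hSV (M.isOpen e') (M.isClosed_edge hE e')
      (image_mono fun t ht => ht.2.le) ?_ ?_
    · rintro _ ⟨t, ht, rfl⟩
      rcases Iic_eq_union_Ioo ht with h | rfl | rfl
      · exact Or.inl ⟨t, h, rfl⟩
      · exact Or.inr (M.src_mem e')
      · exact Or.inr (M.tgt_mem e')
    · have hcl : IsClosed (γ '' Iic a) := h.isArc.isClosed_image hE isClosed_Iic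
        fun t _ => mem_Iic.2 le_top
      have hn : range γ \ γ '' Iic a ∈ 𝓝 (M.α e' ⊤) := by
        rw [hv]
        refine Filter.inter_mem h.nhds (hcl.isOpen_compl.mem_nhds ?_)
        rintro ⟨t, ht, htp⟩
        rw [← h.end_eq] at htp
        rw [hinj htp] at ht
        exact absurd ha (not_lt.2 ht)
      have hc : ContinuousWithinAt (M.α e') (Iic ⊤) ⊤ := (harc e' he').continuousOn ⊤ (by simp)
      rw [Iic_top, continuousWithinAt_univ] at hc
      obtain ⟨b, hb, hsub'⟩ := ENNReal.nhds_top_basis.mem_iff.1 (hc hn)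
      obtain ⟨c, hbc, hc⟩ := exists_between hb
      obtain ⟨⟨t, ht⟩, h3⟩ := hsub' hbc
      refine ⟨M.α e' c, ⟨t, ⟨lt_of_not_ge fun h' => h3 ⟨t, h', ht⟩, lt_top_iff_ne_top.2 ?_⟩, ht⟩,
        c, ⟨pos_of_gt hbc, by rwa [he']⟩, rfl⟩
      rintro rfl
      rw [h.end_eq, ← hv] at ht
      have := (harc e' he').injOn hE (mem_Iic.2 le_top) (mem_Iic.2 le_top) ht
      exact hc.ne this.symm
  obtain ⟨b, hb⟩ := exists_between ha
  obtain ⟨s, hs, h3⟩ := hmeet e he rfl ⟨b, hb, rfl⟩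
  obtain ⟨s', hs', h4⟩ := hmeet e' he' hd' ⟨b, hb, rfl⟩
  rw [M.disj _ _ _ _ hs' hs (h4.trans h3.symm)]

/-- No other edge ends at this point, so the edge alone covers a neighbourhood of it. -/
lemma isEndChart (hX : IsCurve X) {e : M.E} (he : M.L e = ⊤) : IsEndChart (M.α e ⊤) (M.α e) := by
  have harc : IsArc ⊤ (M.α e) := he ▸ M.arc e
  refine ⟨fun s t => harc.isometric s le_top t le_top, ?_, rfl, ?_⟩
  · have := harc.continuousOn
    rwa [Iic_top, continuousOn_univ] at this
  · refine M.eventually_node hX.toIsEDistSpace (he ▸ M.tgt_mem e) (P := fun y => y ∈ range (M.α e))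
      ⟨_, rfl⟩ ?_
    rintro e' (h | h) t -
    · have := M.eq_of_endpoint_eq_top hX he (d := (e', false)) h
      simp at this
    · have := M.eq_of_endpoint_eq_top hX he (d := (e', true)) h
      rw [(Prod.mk.inj this).1]
      exact ⟨t, rfl⟩

open Classical in
lemma sum_ends {R : Type*} [AddCommMonoid R] [Fintype M.E] {v : X} [Fintype (M.Ends v)]
    (g : M.E × Bool → R) : ∑ d : M.Ends v, g d.1 =
      ∑ e, ((if M.endpoint (e, false) = v then g (e, false) else 0) +
        (if M.endpoint (e, true) = v then g (e, true) else 0)) := by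
  rw [← Finset.sum_subtype (Finset.univ.filter fun d : M.E × Bool => M.endpoint d = v) (by simp) g,
    Finset.sum_filter, Fintype.sum_prod_type]
  simp [add_comm]

open Classical in
/-- The divisor of a flow `u` on the edges: the net flow out of a point. -/
noncomputable def order {R : Type*} [AddCommGroup R] (u : M.E → R) (v : X) : R :=
  haveI := M.finite_edges
  haveI := Fintype.ofFinite M.E
  ∑ e, ((if M.α e 0 = v then u e else 0) - (if M.α e (M.L e) = v then u e else 0))

/-- The outgoing slopes cancel inside an edge. At a finite node the ends of edges form a star, with
slope `u e` at a source and `-u e` at a target, which adds up to the net flow. Continuity follows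
from the star charts, and only at infinity must it be assumed. -/
lemma hasPrincipalDivisor (hX : IsCurve X) {f : X → EReal} {a : M.E → ℝ} {u : M.E → ℤ}
    (hf : ∀ e, ∀ s : ℝ, 0 ≤ s → ENNReal.ofReal s ≤ M.L e →
      f (M.α e (ENNReal.ofReal s)) = ((a e + (u e : ℝ) * s : ℝ) : EReal))
    (hcont : ∀ e, M.L e = ⊤ → ContinuousAt (f ∘ M.α e) ⊤) {D : X →₀ ℤ}
    (hD : ∀ v ∈ V, D v = M.order u v) (hD0 : ∀ x, x ∉ V → D x = 0) :
    HasPrincipalDivisor f D := by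
  classical
  have hE := hX.toIsEDistSpace
  have := M.finite_edges
  have := Fintype.ofFinite M.E
  have hord : ∀ x, HasOrder f x (D x) := by
    refine M.forall_of_nodes_of_edges (fun v hv => ?_) fun e t ht => ?_
    · rw [hD v hv]
      by_cases hfin : M.IsFiniteNode v
      · have hne := M.nonempty_ends hX hv
        have := M.finite_ends v
        have := Fintype.ofFinite (M.Ends v)
        have hval : ∀ d : M.Ends v,
            f v = ((cond d.1.2 (a d.1.1 + u d.1.1 * (M.L d.1.1).toReal) (a d.1.1) : ℝ) : EReal) := by
          rintro ⟨⟨e, _ | _⟩, hd⟩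
          · have := hf e 0 le_rfl (by simp)
            rw [ENNReal.ofReal_zero] at this
            have hd' : M.α e 0 = v := hd
            simpa [hd'] using this
          · have htop : M.L e ≠ ⊤ := fun h => hfin e h (by simpa [endpoint, h] using hd)
            have := hf e (M.L e).toReal ENNReal.toReal_nonneg (by rw [ENNReal.ofReal_toReal htop])
            rw [ENNReal.ofReal_toReal htop] at this
            have hd' : M.α e (M.L e) = v := hd
            simpa [hd'] using this
        obtain ⟨b, hb⟩ : ∃ b : ℝ, f v = b := ⟨_, hval hne.some⟩
        have h := hasOrder_of_arcs hE (M.path_isArc hfin)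
          (fun d => (M.path_zero d.1).trans d.2) (M.path_disjoint hE hfin)
          (M.path_nhds hE hfin hv) (f := f) (a := b)
          (σ := fun d => cond d.1.2 (- u d.1.1) (u d.1.1)) ?_
        · convert h using 1
          rw [M.sum_ends fun d => cond d.2 (- u d.1) (u d.1), order]
          refine Finset.sum_congr (by ext; simp) fun e _ => ?_
          by_cases h : M.α e (M.L e) = v <;> by_cases h' : M.α e 0 = v <;>
            simp [endpoint, h, h', sub_eq_add_neg]
        · rintro ⟨⟨e, _ | _⟩, hd⟩ s hs0 hs
          · have h1 := hval ⟨(e, false), hd⟩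
            rw [hb] at h1
            have h2 := EReal.coe_injective h1
            simp only [cond_false] at h2
            simpa [path, h2] using hf e s hs0 hs.le
          · have h1 := hval ⟨(e, true), hd⟩
            rw [hb] at h1
            have h2 := EReal.coe_injective h1
            simp only [cond_true] at h2
            have htop : M.L e ≠ ⊤ := fun h => hfin e h (by simpa [endpoint, h] using hd)
            have h3 : M.L e - ENNReal.ofReal s = ENNReal.ofReal ((M.L e).toReal - s) := by
              rw [ENNReal.ofReal_sub _ hs0, ENNReal.ofReal_toReal htop]
            have h4 : ENNReal.ofReal ((M.L e).toReal - s) ≤ M.L e := h3 ▸ tsub_le_self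
            have h5 := hf e ((M.L e).toReal - s)
              (sub_nonneg.2 ((ENNReal.ofReal_lt_iff_lt_toReal hs0 htop).1 hs).le) h4
            show f (M.α e (M.L e - ENNReal.ofReal s)) = _
            rw [h3, h5]
            congr 1
            simp only [cond_true, h2]; push_cast; ring
      · simp only [IsFiniteNode, not_forall, not_not] at hfin
        obtain ⟨e, he, rfl⟩ := hfin
        refine Or.inr ⟨M.α e, a e, u e, M.isEndChart hX he, fun t => ?_, ?_⟩
        · simpa using hf e t t.2 (by simp [he])
        -- Only the target of `e` is at this point at infinity, so the single term `-u e` survives.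
        · unfold order
          rw [Finset.sum_eq_single e]
          · have h1 : M.α e 0 ≠ M.α e ⊤ := by have := M.src_ne_tgt hE e; rwa [he] at this
            simp [he, h1]
          · intro e' _ hne
            have h1 : M.α e' 0 ≠ M.α e ⊤ := fun h => by
              have := M.eq_of_endpoint_eq_top hX he (d := (e', false)) h
              simp at this
            have h2 : M.α e' (M.L e') ≠ M.α e ⊤ := fun h => by
              have := M.eq_of_endpoint_eq_top hX he (d := (e', true)) h
              exact hne (Prod.mk.inj this).1
            simp [h1, h2]
          · simp
    · rw [hD0 _ (M.not_mem e t ht)]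
      exact (M.arc e).hasOrder_zero hE ht (M.edge_mem_nhds ht) fun s hs hs' => hf e s hs hs'.le
  refine ⟨continuous_iff_continuousAt.2 fun x => ?_, hord⟩
  rcases hord x with ⟨n, r, φ, a', σ, h1, h2, -⟩ | ⟨γ, a', c, h1, -, -⟩
  · exact h1.continuousAt hE h2
  · by_cases hx : ∃ e, M.L e = ⊤ ∧ M.α e ⊤ = x
    · obtain ⟨e, he, rfl⟩ := hx
      exact (M.isEndChart hX he).continuousAt hE (hcont e he)
    -- A point with an end chart has no valence, whereas every point that is not the end of an
    -- unbounded edge of the model has one.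
    · exfalso
      have hval := h1.not_hasValence hE
      by_cases hxV : x ∈ V
      · exact hval _ (M.hasValence_node hX hxV fun e he h => hx ⟨e, he, h⟩)
      · obtain ⟨e, t, ht, rfl⟩ := M.cover x hxV
        exact hval 2 ((M.arc e).hasValence_two hE ht (M.edge_mem_nhds ht))

/-- A function on the nodes whose differences along the bounded edges are integer multiples of the
lengths extends to a rational function that is affine on the edges. -/
lemma exists_hasPrincipalDivisor (hX : IsCurve X) (h : X → ℝ) (u : M.E → ℤ)
    (hh : ∀ e, M.L e ≠ ⊤ → h (M.α e (M.L e)) - h (M.α e 0) = u e * (M.L e).toReal) {D : X →₀ ℤ}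
    (hD : ∀ v ∈ V, D v = M.order u v) (hD0 : ∀ x, x ∉ V → D x = 0) :
    ∃ f, HasPrincipalDivisor f D := by
  classical
  have hE := hX.toIsEDistSpace
  let lim : M.E → EReal := fun e =>
    if u e = 0 then (h (M.α e 0) : EReal) else if 0 < u e then ⊤ else ⊥
  -- The value at a point must be the same for all edges through it. At a finite node this is where
  -- `hh` is used; a point at infinity belongs to one edge only and receives the limit along it.
  have hex : ∀ x, ∃ y : EReal,
      (∀ e, ∀ s : ℝ, 0 ≤ s → ENNReal.ofReal s ≤ M.L e → M.α e (ENNReal.ofReal s) = x →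
        y = ((h (M.α e 0) + u e * s : ℝ) : EReal)) ∧
      (∀ e, M.L e = ⊤ → M.α e ⊤ = x → y = lim e) := by
    have hcase : ∀ e, ∀ s : ℝ, ENNReal.ofReal s ≤ M.L e → M.α e (ENNReal.ofReal s) ∈ V →
        ENNReal.ofReal s = 0 ∨ ENNReal.ofReal s = M.L e := by
      intro e s hs hV
      rcases Iic_eq_union_Ioo hs with h' | h' | h'
      · exact absurd hV (M.not_mem e _ h')
      · exact Or.inl h'
      · exact Or.inr h'
    refine M.forall_of_nodes_of_edges (fun v hv => ?_) fun e t ht => ?_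
    · by_cases hfin : M.IsFiniteNode v
      · refine ⟨h v, ?_, fun e he hev => absurd hev (hfin e he)⟩
        rintro e s hs0 hs rfl
        rcases hcase e s hs hv with h' | h'
        · have : s = 0 := le_antisymm (ENNReal.ofReal_eq_zero.1 h') hs0
          simp [this]
        · have htop : M.L e ≠ ⊤ := h' ▸ ENNReal.ofReal_ne_top
          have := hh e htop
          rw [← h', ENNReal.toReal_ofReal hs0] at this
          rw [← this]
          congr 1; ring
      · simp only [IsFiniteNode, not_forall, not_not] at hfin
        obtain ⟨e, he, rfl⟩ := hfin
        refine ⟨lim e, ?_, fun e' he' hv' => ?_⟩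
        · intro e' s hs0 hs hv'
          rcases hcase e' s hs (hv' ▸ hv) with h' | h'
          · have := M.eq_of_endpoint_eq_top hX he (d := (e', false)) (by rw [← hv', h']; rfl)
            simp at this
          · have := M.eq_of_endpoint_eq_top hX he (d := (e', true)) (by rw [← hv', h']; rfl)
            rw [(Prod.mk.inj this).1, he] at h'
            exact absurd h' ENNReal.ofReal_ne_top
        · have := M.eq_of_endpoint_eq_top hX he (d := (e', true)) (by rw [← hv', ← he']; rfl)
          rw [(Prod.mk.inj this).1]
    · refine ⟨((h (M.α e 0) + u e * t.toReal : ℝ) : EReal), ?_, fun e' he' hv => ?_⟩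
      · intro e' s hs0 hs hst
        rcases Iic_eq_union_Ioo hs with h' | h' | h'
        · have := M.disj _ _ _ _ h' ht hst
          subst this
          have := (M.arc e').injOn hE (mem_Iic.2 hs) (mem_Iic.2 ht.2.le) hst
          rw [← this, ENNReal.toReal_ofReal hs0]
        · exact absurd (by rw [← hst, h']; exact M.src_mem e') (M.not_mem e t ht)
        · exact absurd (by rw [← hst, h']; exact M.tgt_mem e') (M.not_mem e t ht)
      · exact absurd (by rw [← hv, ← he']; exact M.tgt_mem e') (M.not_mem e t ht)
  choose f hf hlim using hex
  refine ⟨f, M.hasPrincipalDivisor hX (a := fun e => h (M.α e 0)) (u := u)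
    (fun e s hs0 hs => hf _ e s hs0 hs rfl) (fun e he => ?_) hD hD0⟩
  have hval : ∀ t : ℝ≥0∞, t ≠ ⊤ →
      (f ∘ M.α e) t = ((h (M.α e 0) + u e * t.toReal : ℝ) : EReal) := by
    intro t ht
    have := hf _ e t.toReal ENNReal.toReal_nonneg (by rw [he]; exact le_top) rfl
    rwa [ENNReal.ofReal_toReal ht] at this
  have hvalt : (f ∘ M.α e) ⊤ = lim e := hlim _ e he rfl
  rw [ContinuousAt, hvalt]
  have hlarge : ∀ b : ℝ, ∀ᶠ t in 𝓝 (⊤ : ℝ≥0∞), t ≠ ⊤ → b < t.toReal := by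
    intro b
    filter_upwards [lt_mem_nhds (ENNReal.ofReal_lt_top (r := b))] with t ht htop
    refine lt_of_not_ge fun h' => absurd ht (not_lt.2 ?_)
    rw [← ENNReal.ofReal_toReal htop]
    exact ENNReal.ofReal_le_ofReal h'
  rcases lt_trichotomy (u e) 0 with h0 | h0 | h0
  · have hlim' : lim e = ⊥ := by simp [lim, h0.ne, h0.not_gt]
    rw [hlim', EReal.tendsto_nhds_bot_iff_real]
    intro x
    have hu : (u e : ℝ) < 0 := by exact_mod_cast h0
    filter_upwards [hlarge ((x - h (M.α e 0)) / u e)] with t ht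
    by_cases htop : t = ⊤
    · rw [htop, hvalt, hlim']; exact EReal.bot_lt_coe x
    · rw [hval t htop, EReal.coe_lt_coe_iff]
      have := (div_lt_iff_of_neg hu).1 (ht htop)
      linarith
  · have hlim' : lim e = (h (M.α e 0) : EReal) := by simp [lim, h0]
    rw [hlim']
    refine tendsto_const_nhds.congr fun t => ?_
    by_cases htop : t = ⊤
    · rw [htop, hvalt, hlim']
    · rw [hval t htop, h0]; simp
  · have hlim' : lim e = ⊤ := by simp [lim, h0.ne', h0]
    rw [hlim', EReal.tendsto_nhds_top_iff_real]
    intro x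
    have hu : (0 : ℝ) < u e := by exact_mod_cast h0
    filter_upwards [hlarge ((x - h (M.α e 0)) / u e)] with t ht
    by_cases htop : t = ⊤
    · rw [htop, hvalt, hlim']; exact EReal.coe_lt_top x
    · rw [hval t htop, EReal.coe_lt_coe_iff]
      have := (div_lt_iff₀ hu).1 (ht htop)
      linarith

end Model

end RealGraph

namespace RealGraph

/-! ### Linear algebra of finite graphs -/

open Module

/-- The coboundary of a function on the nodes of the graph with links from `s i` to `t i`. -/
def coboundary {N I : Type*} (s t : I → N) : (N → ℝ) →ₗ[ℝ] (I → ℝ) :=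
  LinearMap.funLeft ℝ ℝ t - LinearMap.funLeft ℝ ℝ s

@[simp]
lemma coboundary_apply {N I : Type*} (s t : I → N) (h : N → ℝ) (i : I) :
    coboundary s t h i = h (t i) - h (s i) := rfl

lemma mem_ker_coboundary {N I : Type*} {s t : I → N} {h : N → ℝ} :
    h ∈ LinearMap.ker (coboundary s t) ↔ ∀ i, h (s i) = h (t i) := by
  rw [LinearMap.mem_ker, funext_iff]
  simp only [coboundary_apply, Pi.zero_apply, sub_eq_zero]
  exact forall_congr' fun _ => eq_comm

/-- A proper subspace lies in the kernel of a nonzero functional, and a functional on `I → ℝ` is a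
weighted sum of coordinates. Surjectivity of a coboundary thus becomes the absence of nonzero
cycles. -/
lemma surjective_of_annihilator {I : Type*} [Fintype I] {W : Type*} [AddCommGroup W] [Module ℝ W]
    {f : W →ₗ[ℝ] (I → ℝ)} (h : ∀ c : I → ℝ, (∀ w, ∑ i, c i * f w i = 0) → c = 0) :
    Function.Surjective f := by
  classical
  rw [← LinearMap.range_eq_top]
  by_contra hne
  obtain ⟨g, hg, hle⟩ := Submodule.exists_le_ker_of_lt_top _ (lt_top_iff_ne_top.2 hne)
  refine hg ?_
  have hsum : ∀ w, g w = ∑ i, w i * g (fun j => if i = j then 1 else 0) := fun w => by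
    simpa using LinearMap.pi_apply_eq_sum_univ g w
  have hc := h (fun i => g fun j => if i = j then 1 else 0) fun w => by
    have h1 : g (f w) = 0 := hle ⟨w, rfl⟩
    rw [hsum] at h1
    exact (Finset.sum_congr rfl fun i _ => mul_comm _ _).trans h1
  refine LinearMap.ext fun w => ?_
  rw [hsum]
  exact Finset.sum_eq_zero fun i _ => by rw [show g _ = 0 from congrFun hc i, mul_zero]

/-- The number of connected components of a space that is described by a graph. -/
lemma card_connectedComponents_eq_finrank {A N I : Type*} [TopologicalSpace A] [Finite N]
    (s t : I → N) (b : N → A) (hcover : ∀ x, ∃ n, x ∈ connectedComponent (b n))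
    (hlink : ∀ i, b (s i) ∈ connectedComponent (b (t i)))
    (hext : ∀ h : N → ℝ, (∀ i, h (s i) = h (t i)) →
      ∃ H : A → ℝ, IsLocallyConstant H ∧ ∀ n, H (b n) = h n) :
    Nat.card (ConnectedComponents A) = finrank ℝ (LinearMap.ker (coboundary s t)) := by
  have hsurj : Function.Surjective fun n => (b n : ConnectedComponents A) := by
    intro c
    obtain ⟨x, rfl⟩ := ConnectedComponents.surjective_coe c
    obtain ⟨n, hn⟩ := hcover x
    exact ⟨n, (ConnectedComponents.coe_eq_coe'.2 hn).symm⟩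
  have := Finite.of_surjective _ hsurj
  have := Fintype.ofFinite (ConnectedComponents A)
  -- Evaluation at the base points `b n`. It is injective since every component contains a base
  -- point, and surjective by `hext`.
  let F : (ConnectedComponents A → ℝ) →ₗ[ℝ] LinearMap.ker (coboundary s t) :=
    LinearMap.codRestrict _ (LinearMap.funLeft ℝ ℝ fun n => (b n : ConnectedComponents A))
      fun g => mem_ker_coboundary.2 fun i => by
        simp only [LinearMap.funLeft_apply]
        rw [ConnectedComponents.coe_eq_coe'.2 (hlink i)]
  have hF : Function.Bijective F := by
    constructor
    · intro g g' hgg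
      funext c
      obtain ⟨n, rfl⟩ := hsurj c
      exact congrFun (congrArg Subtype.val hgg) n
    · rintro ⟨h, hh⟩
      obtain ⟨H, hH, hHb⟩ := hext h (mem_ker_coboundary.1 hh)
      refine ⟨Quotient.lift H fun x y hxy => ?_, Subtype.ext (funext fun n => hHb n)⟩
      have hxy' : connectedComponent x = connectedComponent y := hxy
      exact hH.apply_eq_of_isPreconnected isPreconnected_connectedComponent
        (mem_connectedComponent (x := x)) (hxy' ▸ mem_connectedComponent (x := y))
  rw [← (LinearEquiv.ofBijective F hF).finrank_eq, finrank_fintype_fun_eq_card, Nat.card_eq_fintype_card]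

/-- The functions that are invariant under `σ`. -/
def invariants {N : Type*} (σ : N → N) : Submodule ℝ (N → ℝ) where
  carrier := {h | ∀ n, h (σ n) = h n}
  add_mem' h h' n := by simp [h n, h' n]
  zero_mem' n := rfl
  smul_mem' c h hh n := by simp [hh n]

/-- An invariant function is determined freely by its values on one representative of each orbit.
With respect to a numbering of `N` the representatives with the smaller number and those with the
larger number are equally many, cover `N` together and overlap in the fixed points. -/
lemma two_mul_finrank_invariants {N : Type*} [Fintype N] [DecidableEq N] {σ : N → N}
    (hσ : Function.Involutive σ) :
    2 * finrank ℝ (invariants σ) = Fintype.card N + Fintype.card {n // σ n = n} := by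
  let k : N → ℕ := fun n => Fintype.equivFin N n
  have hk : Function.Injective k := fun a b hab => (Fintype.equivFin N).injective (Fin.ext hab)
  let F : invariants σ →ₗ[ℝ] ({n // k n ≤ k (σ n)} → ℝ) :=
    LinearMap.funLeft ℝ ℝ Subtype.val ∘ₗ (invariants σ).subtype
  have hF : Function.Bijective F := by
    constructor
    · rintro ⟨h, hh⟩ ⟨h', hh'⟩ heq
      refine Subtype.ext (funext fun n => ?_)
      rcases le_total (k n) (k (σ n)) with hn | hn
      · exact congrFun heq ⟨n, hn⟩
      · have : h (σ n) = h' (σ n) := congrFun heq ⟨σ n, by rwa [hσ n]⟩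
        show h n = h' n
        rw [← hh n, ← hh' n, this]
    · intro g
      have hc : ∀ n, ¬ k n ≤ k (σ n) → k (σ n) ≤ k (σ (σ n)) := fun n hn => by
        rw [hσ n]; exact (not_le.1 hn).le
      refine ⟨⟨fun n => if hn : k n ≤ k (σ n) then g ⟨n, hn⟩ else g ⟨σ n, hc n hn⟩, fun n => ?_⟩,
        funext fun n => dif_pos n.2⟩
      by_cases h1 : k n ≤ k (σ n)
      · by_cases h2 : k (σ n) ≤ k (σ (σ n))
        · have : σ n = n := hk (le_antisymm (by rwa [hσ n] at h2) h1)
          simp only [h1, h2, dif_pos]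
          congr 1
          exact Subtype.ext this
        · simp only [h1, h2, dif_pos, dif_neg, not_false_iff]
          congr 1
          exact Subtype.ext (hσ n)
      · simp only [h1, hc n h1, dif_pos, dif_neg, not_false_iff]
  rw [(LinearEquiv.ofBijective F hF).finrank_eq, finrank_fintype_fun_eq_card]
  have h1 : Fintype.card {n // k n ≤ k (σ n)} = (Finset.univ.filter fun n => k n ≤ k (σ n)).card :=
    Fintype.card_subtype _
  have h2 : (Finset.univ.filter fun n => k n ≤ k (σ n)).card =
      (Finset.univ.filter fun n => k (σ n) ≤ k n).card := by
    refine Finset.card_bij' (fun n _ => σ n) (fun n _ => σ n) ?_ ?_ ?_ ?_ <;> simp [hσ _]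
  have h3 := Finset.card_union_add_card_inter (Finset.univ.filter fun n => k n ≤ k (σ n))
    (Finset.univ.filter fun n => k (σ n) ≤ k n)
  have h4 : (Finset.univ.filter fun n => k n ≤ k (σ n)) ∪ (Finset.univ.filter fun n => k (σ n) ≤ k n)
      = Finset.univ := by
    ext n; simp [le_total]
  have h5 : (Finset.univ.filter fun n => k n ≤ k (σ n)) ∩ (Finset.univ.filter fun n => k (σ n) ≤ k n)
      = Finset.univ.filter fun n => σ n = n := by
    ext n
    simp only [Finset.mem_inter, Finset.mem_filter, Finset.mem_univ, true_and]
    exact ⟨fun h => hk (le_antisymm h.2 h.1), fun h => by simp [h]⟩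
  rw [h4, h5, Finset.card_univ, ← Fintype.card_subtype] at h3
  rw [h1]
  omega

section Core

variable {N I : Type*} [Fintype N] [Fintype I] {s t : I → N}

omit [Fintype N] in
/-- In a connected graph the constants are the only functions with coboundary zero. -/
lemma finrank_ker_eq_one [Nonempty N] {W : Submodule ℝ (N → ℝ)} (h1 : (fun _ => 1) ∈ W)
    (hW : ∀ h ∈ W, ∀ v w, h v = h w) : finrank ℝ W = 1 := by
  obtain ⟨v⟩ := ‹Nonempty N›
  refine finrank_eq_one (⟨_, h1⟩ : W) (fun h0 => ?_) fun h => ⟨h.1 v, Subtype.ext (funext fun w => ?_)⟩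
  · have := congrFun (congrArg Subtype.val h0) v
    simp at this
  · simpa using hW h.1 h.2 v w

/-- An involution of a connected graph whose graph of fixed points has `g + 1` components: every
invariant function on the links is the coboundary of an invariant function on the nodes. -/
theorem exists_invariant_primitive [Nonempty N] [DecidableEq N] [DecidableEq I] {σ : N → N}
    {τ : I → I} (hσ : Function.Involutive σ) (hτ : Function.Involutive τ)
    (hs : ∀ i, s (τ i) = σ (s i)) (ht : ∀ i, t (τ i) = σ (t i))
    (hker : ∀ h : N → ℝ, (∀ i, h (s i) = h (t i)) → ∀ v w, h v = h w)
    (sF tF : {i // τ i = i} → {n // σ n = n}) (hsF : ∀ i, (sF i : N) = s i)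
    (htF : ∀ i, (tF i : N) = t i)
    (hF : finrank ℝ (LinearMap.ker (coboundary sF tF)) + Fintype.card N = Fintype.card I + 2)
    {ω : I → ℝ} (hω : ∀ i, ω (τ i) = ω i) :
    ∃ h : N → ℝ, (∀ n, h (σ n) = h n) ∧ ∀ i, h (t i) - h (s i) = ω i := by
  let δ : invariants σ →ₗ[ℝ] invariants τ := (coboundary s t).restrict fun h hh i => by
    simp only [coboundary_apply]
    rw [hs, ht, hh, hh]
  have hδ : finrank ℝ (LinearMap.ker δ) = 1 := by
    have h1 : finrank ℝ (LinearMap.ker δ) =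
        finrank ℝ ((LinearMap.ker δ).map (invariants σ).subtype) :=
      (LinearEquiv.finrank_eq (Submodule.equivMapOfInjective _ (Submodule.injective_subtype _) _))
    rw [h1]
    refine finrank_ker_eq_one ?_ ?_
    · refine ⟨⟨fun _ => 1, fun _ => rfl⟩, ?_, rfl⟩
      exact Subtype.ext (funext fun i => sub_self _)
    · rintro _ ⟨h, hh, rfl⟩
      refine hker _ fun i => ?_
      have : (δ h).1 i = 0 := by rw [LinearMap.mem_ker.1 hh]; rfl
      exact (sub_eq_zero.1 this).symm
  let r : invariants τ →ₗ[ℝ] ({i // τ i = i} → ℝ) :=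
    LinearMap.funLeft ℝ ℝ Subtype.val ∘ₗ (invariants τ).subtype
  have hr : Function.Surjective r := by
    intro g
    refine ⟨⟨fun i => if hi : τ i = i then g ⟨i, hi⟩ else 0, fun i => ?_⟩,
      funext fun i => dif_pos i.2⟩
    by_cases hi : τ i = i
    · simp only [hi]
    · have : ¬ τ (τ i) = τ i := fun h => hi (hτ.injective h)
      simp only [hi, this, dif_neg, not_false_iff]
  let R := LinearMap.range (coboundary sF tF)
  -- The target is the first cohomology of the fixed graph. Coboundaries of invariant functions map
  -- to zero in it, because they restrict to coboundaries on the fixed graph.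
  let π : invariants τ →ₗ[ℝ] ({i // τ i = i} → ℝ) ⧸ R := R.mkQ ∘ₗ r
  have hπ : Function.Surjective π := (Submodule.mkQ_surjective R).comp hr
  have hle : LinearMap.range δ ≤ LinearMap.ker π := by
    rintro _ ⟨h, rfl⟩
    rw [LinearMap.mem_ker]
    refine (Submodule.Quotient.mk_eq_zero R).2 ⟨fun n => h.1 n, funext fun i => ?_⟩
    simp only [coboundary_apply, hsF, htF]
    rfl
  have e1 := LinearMap.finrank_range_add_finrank_ker δ
  have e2 := LinearMap.finrank_range_add_finrank_ker π
  rw [LinearMap.range_eq_top.2 hπ, finrank_top] at e2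
  have e3 := Submodule.finrank_mono hle
  have e4 := LinearMap.finrank_range_add_finrank_ker (coboundary sF tF)
  rw [finrank_fintype_fun_eq_card] at e4
  have e5 := Submodule.finrank_quotient_add_finrank R
  rw [finrank_fintype_fun_eq_card] at e5
  have e6 := two_mul_finrank_invariants hσ
  have e7 := two_mul_finrank_invariants hτ
  -- With `hF`, the bound `e3` shows that the fixed graph has at most |N^σ| - |I^τ| components,
  -- while `e4` and `e5` give at least that many. Equality makes the two dimensions agree.
  have e8 : finrank ℝ (LinearMap.range δ) = finrank ℝ (invariants τ) := by
    refine le_antisymm (Submodule.finrank_le _) ?_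
    have : finrank ℝ R = finrank ℝ (LinearMap.range (coboundary sF tF)) := rfl
    omega
  have e9 := Submodule.eq_top_of_finrank_eq e8
  obtain ⟨h, hh⟩ : (⟨ω, hω⟩ : invariants τ) ∈ LinearMap.range δ := e9 ▸ Submodule.mem_top
  exact ⟨h.1, h.2, fun i => congrFun (congrArg Subtype.val hh) i⟩

end Core

end RealGraph

/-! ### Halving the edges, and models compatible with the real structure. -/

namespace RealGraph

variable {X : Type u} [TopologicalSpace X] [EDist X]

namespace Model

variable {V : Set X} (M : Model V)

/-- The ends of edges other than the ends at infinity. -/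
abbrev FiniteEnd : Type u := {d : M.E × Bool // d.2 = true → M.L d.1 ≠ ⊤}

lemma isArc_path (d : M.FiniteEnd) : IsArc (M.L d.1.1) (M.path d.1) := by
  obtain ⟨⟨e, _ | _⟩, hd⟩ := d
  · exact M.arc e
  · exact (M.arc e).reverse (hd rfl)

lemma path_length_mem (d : M.FiniteEnd) : M.path d.1 (M.L d.1.1) ∈ V := by
  obtain ⟨⟨e, _ | _⟩, hd⟩ := d
  · exact M.tgt_mem e
  · simpa [path] using M.src_mem e

lemma path_zero_mem (d : M.FiniteEnd) : M.path d.1 0 ∈ V := by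
  obtain ⟨⟨e, _ | _⟩, hd⟩ := d
  · exact M.src_mem e
  · simpa [path] using M.tgt_mem e

lemma exists_path_eq (d : M.FiniteEnd) {t : ℝ≥0∞} (ht : t ∈ Ioo 0 (M.L d.1.1)) :
    ∃ s ∈ Ioo 0 (M.L d.1.1), M.path d.1 t = M.α d.1.1 s := by
  obtain ⟨⟨e, _ | _⟩, hd⟩ := d
  · exact ⟨t, ht, rfl⟩
  · exact ⟨M.L e - t, ⟨tsub_pos_of_lt ht.2,
      ENNReal.sub_lt_self (hd rfl) (M.arc e).pos.ne' ht.1.ne'⟩, rfl⟩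

/-- An arc between two nodes that does not meet other nodes is an edge, possibly reversed. -/
lemma exists_finiteEnd_of_isArc (hX : IsEDistSpace X) {L : ℝ≥0∞} {α : ℝ≥0∞ → X} (h : IsArc L α)
    (h0 : α 0 ∈ V) (h1 : α L ∈ V) (hV : ∀ t ∈ Ioo 0 L, α t ∉ V) :
    ∃ d : M.FiniteEnd, M.L d.1.1 = L ∧ ∀ t ≤ L, α t = M.path d.1 t := by
  have hint : ∃ e, α '' Ioo 0 L ⊆ M.α e '' Ioo 0 (M.L e) := by
    obtain ⟨t, ht⟩ := exists_between h.pos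
    obtain ⟨e, s, hs, hst⟩ := M.cover _ (hV t ht)
    refine ⟨e, subset_of_isPreconnected (V := V)
      (h.isPreconnected_image ordConnected_Ioo fun t ht => ht.2.le) ?_ (M.isOpen e)
      (M.isClosed_edge hX e) (image_mono fun t ht => ht.2.le) ?_ ⟨α t, ⟨t, ht, rfl⟩, s, hs, hst⟩⟩
    · rw [← disjoint_iff_inter_eq_empty, disjoint_left]
      rintro _ ⟨t, ht, rfl⟩
      exact hV t ht
    · rintro _ ⟨t, ht, rfl⟩
      rcases Iic_eq_union_Ioo ht with h | rfl | rfl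
      · exact Or.inl ⟨t, h, rfl⟩
      · exact Or.inr (M.src_mem e)
      · exact Or.inr (M.tgt_mem e)
  obtain ⟨e, he⟩ := hint
  have hcl : α '' Iic L ⊆ M.α e '' Iic (M.L e) := by
    have hsub : α '' closure (Ioo 0 L) ⊆ closure (α '' Ioo 0 L) :=
      (h.continuousOn.mono (by
        rw [closure_Ioo h.pos.ne]; exact fun t ht => ht.2)).image_closure
    rw [closure_Ioo h.pos.ne] at hsub
    have hIcc : Iic L ⊆ Icc 0 L := fun t ht => ⟨zero_le, ht⟩
    refine (image_mono hIcc).trans (hsub.trans ?_)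
    exact closure_minimal (he.trans (image_mono fun t ht => ht.2.le)) (M.isClosed_edge hX e)
  have hend : ∀ t ≤ L, α t ∈ V → α t = M.α e 0 ∨ α t = M.α e (M.L e) := by
    intro t ht htV
    obtain ⟨s, hs, hst⟩ := hcl ⟨t, ht, rfl⟩
    rcases Iic_eq_union_Ioo hs with h' | rfl | rfl
    · exact absurd (hst ▸ htV) (M.not_mem e s h')
    · exact Or.inl hst.symm
    · exact Or.inr hst.symm
  have hne : α 0 ≠ α L := fun h' =>
    h.pos.ne (h.injOn hX (mem_Iic.2 zero_le) (mem_Iic.2 le_rfl) h')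
  -- The length of an arc is the distance of its ends, and a parameter is the distance from the
  -- start. So the position of the start decides both the length and the parametrization.
  have hlen : edist (α 0) (α L) = L := h.edist_zero le_rfl
  have hlen' : edist (M.α e 0) (M.α e (M.L e)) = M.L e := (M.arc e).edist_zero le_rfl
  rcases hend 0 zero_le h0 with hs | hs
  · have hL : α L = M.α e (M.L e) := (hend L le_rfl h1).resolve_left fun h' => hne (hs.trans h'.symm)
    have hLL : M.L e = L := by rw [← hlen, hs, hL, hlen']
    refine ⟨⟨(e, false), by simp⟩, hLL, fun t ht => ?_⟩
    show α t = M.α e t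
    obtain ⟨s, hs', hst⟩ := hcl ⟨t, ht, rfl⟩
    have h2 := h.edist_zero ht
    rw [hs, ← hst, (M.arc e).edist_zero hs'] at h2
    rw [← hst, h2]
  · have hL : α L = M.α e 0 := (hend L le_rfl h1).resolve_right fun h' => hne (hs.trans h'.symm)
    have hLL : M.L e = L := by rw [← hlen, hs, hL, hX.edist_comm, hlen']
    have hdist : ∀ t ≤ L, ∃ s ≤ M.L e, M.α e s = α t ∧ (M.L e - s) + (s - M.L e) = t := by
      intro t ht
      obtain ⟨s, hs', hst⟩ := hcl ⟨t, ht, rfl⟩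
      have h2 := h.edist_zero ht
      rw [hs, ← hst, (M.arc e).isometric _ le_rfl _ hs'] at h2
      exact ⟨s, hs', hst, h2⟩
    have htop : M.L e ≠ ⊤ := by
      intro htop
      obtain ⟨t, ht⟩ := exists_between h.pos
      obtain ⟨s, hs1, hs2⟩ := he ⟨t, ht, rfl⟩
      have h2 := h.edist_zero ht.2.le
      rw [hs, ← hs2, (M.arc e).isometric _ le_rfl _ hs1.2.le, htop, sub_add_sub_top hs1.2.ne_top] at h2
      exact ht.2.ne_top h2.symm
    refine ⟨⟨(e, true), fun _ => htop⟩, hLL, fun t ht => ?_⟩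
    show α t = M.α e (M.L e - t)
    obtain ⟨s, hs', hst, h2⟩ := hdist t ht
    rw [tsub_eq_zero_of_le hs', add_zero] at h2
    rw [← hst, ← h2, ENNReal.sub_sub_cancel htop hs']

lemma finiteEnd_ext (hX : IsEDistSpace X) {d d' : M.FiniteEnd} {L : ℝ≥0∞} (h0 : 0 < L)
    (hd : L ≤ M.L d.1.1) (hd' : L ≤ M.L d'.1.1) (h : ∀ t ≤ L, M.path d.1 t = M.path d'.1 t) :
    d = d' := by
  obtain ⟨t, ht⟩ := exists_between h0
  obtain ⟨s, hs, h1⟩ := M.exists_path_eq d ⟨ht.1, ht.2.trans_le hd⟩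
  obtain ⟨s', hs', h2⟩ := M.exists_path_eq d' ⟨ht.1, ht.2.trans_le hd'⟩
  have h3 := M.disj _ _ _ _ hs hs' (by rw [← h1, ← h2, h t ht.2.le])
  have h4 := h 0 zero_le
  rw [M.path_zero, M.path_zero] at h4
  obtain ⟨⟨e, b⟩, hd⟩ := d
  obtain ⟨⟨e', b'⟩, hd'⟩ := d'
  simp only at h3
  subst h3
  have hne := M.src_ne_tgt hX e
  cases b <;> cases b' <;> first | rfl | skip
  · exact absurd h4 hne
  · exact absurd h4.symm hne

/-- Opposite parametrizations of an edge assign to a point two parameters that add up to the length;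
hence the open halves of an edge are disjoint. -/
lemma path_eq_path (hX : IsEDistSpace X) {d d' : M.FiniteEnd} {t t' : ℝ≥0∞}
    (ht : t ∈ Ioo 0 (M.L d.1.1)) (ht' : t' ∈ Ioo 0 (M.L d'.1.1))
    (h : M.path d.1 t = M.path d'.1 t') :
    (d = d' ∧ t = t') ∨ (d.1.1 = d'.1.1 ∧ M.L d.1.1 ≠ ⊤ ∧ t + t' = M.L d.1.1) := by
  obtain ⟨⟨e, b⟩, hd⟩ := d
  obtain ⟨⟨e', b'⟩, hd'⟩ := d'
  obtain ⟨s, hs, h1⟩ := M.exists_path_eq ⟨(e, b), hd⟩ ht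
  obtain ⟨s', hs', h2⟩ := M.exists_path_eq ⟨(e', b'), hd'⟩ ht'
  have h3 := M.disj _ _ _ _ hs hs' (by rw [← h1, ← h2, h])
  simp only at h3 ht ht' h
  subst h3
  by_cases hbb : b = b'
  · subst hbb
    exact Or.inl ⟨rfl, (M.isArc_path ⟨(e, b), hd⟩).injOn hX (mem_Iic.2 ht.2.le)
      (mem_Iic.2 ht'.2.le) h⟩
  · right
    have hinj := (M.arc e).injOn hX
    cases b <;> cases b' <;> first | exact absurd rfl hbb | skip
    · have h5 : t = M.L e - t' := hinj (mem_Iic.2 ht.2.le) (mem_Iic.2 tsub_le_self) h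
      exact ⟨rfl, hd' rfl, by rw [h5, tsub_add_cancel_of_le ht'.2.le]⟩
    · have h5 : M.L e - t = t' := hinj (mem_Iic.2 tsub_le_self) (mem_Iic.2 ht'.2.le) h
      exact ⟨rfl, hd rfl, by rw [← h5, add_tsub_cancel_of_le ht.2.le]⟩

/-- The midpoints of the bounded edges and the points at infinity. -/
def midpoints : Set X := range fun d : M.FiniteEnd => M.path d.1 (M.L d.1.1 / 2)

/-- The model in which all bounded edges are halved and directed towards the midpoints. -/
noncomputable def half (hX : IsEDistSpace X) : Model (V ∪ M.midpoints) where
  finite_nodes := by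
    have := M.finite_edges
    exact M.finite_nodes.union (finite_range _)
  E := M.FiniteEnd
  finite_edges := by
    have := M.finite_edges
    exact Subtype.finite
  -- Since `⊤ / 2 = ⊤`, an unbounded edge stays whole and its end at infinity takes the place of the
  -- midpoint.
  L d := M.L d.1.1 / 2
  α d := M.path d.1
  arc d := (M.isArc_path d).of_le (ENNReal.half_pos (M.arc _).pos.ne') ENNReal.half_le_self
  src_mem d := Or.inl (M.path_zero_mem d)
  tgt_mem d := Or.inr ⟨d, rfl⟩
  isOpen d := by
    refine (M.isArc_path d).isOpen_image_Ioo hX ?_ ENNReal.half_le_self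
    convert M.isOpen d.1.1 using 1
    obtain ⟨⟨e, _ | _⟩, hd⟩ := d
    · rfl
    · have hd' : M.L e ≠ ⊤ := hd rfl
      ext y
      constructor
      · rintro ⟨t, ht, rfl⟩
        obtain ⟨s, hs, h⟩ := M.exists_path_eq ⟨(e, true), hd⟩ ht
        exact ⟨s, hs, h.symm⟩
      · rintro ⟨t, ht, rfl⟩
        refine ⟨M.L e - t, ⟨tsub_pos_of_lt ht.2,
          ENNReal.sub_lt_self hd' (M.arc e).pos.ne' ht.1.ne'⟩, ?_⟩
        simp [path, ENNReal.sub_sub_cancel hd' ht.2.le]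
  not_mem d t ht := by
    have ht' : t ∈ Ioo 0 (M.L d.1.1) := ⟨ht.1, ht.2.trans_le ENNReal.half_le_self⟩
    obtain ⟨s, hs, h⟩ := M.exists_path_eq d ht'
    rintro (hV | ⟨d', hd'⟩)
    · rw [h] at hV
      exact M.not_mem _ s hs hV
    · simp only at hd'
      by_cases htop : M.L d'.1.1 = ⊤
      · have hhalf : M.L d'.1.1 / 2 = M.L d'.1.1 := by
          rw [htop, ENNReal.top_div_of_ne_top (by simp)]
        rw [hhalf, h] at hd'
        exact M.not_mem _ s hs (hd' ▸ M.path_length_mem d')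
      · have hd0 : M.L d'.1.1 / 2 ∈ Ioo 0 (M.L d'.1.1) :=
          ⟨ENNReal.half_pos (M.arc _).pos.ne', ENNReal.half_lt_self (M.arc _).pos.ne' htop⟩
        rcases M.path_eq_path hX hd0 ht' hd' with ⟨rfl, h2⟩ | ⟨h1, h2, h3⟩
        · exact ht.2.ne h2.symm
        · rw [← h1] at ht
          have h4 : M.L d'.1.1 / 2 + t < M.L d'.1.1 / 2 + M.L d'.1.1 / 2 :=
            (ENNReal.add_lt_add_iff_left hd0.2.ne_top).2 ht.2
          rw [ENNReal.add_halves, h3] at h4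
          exact lt_irrefl _ h4
  disj d d' t t' ht ht' h := by
    rcases M.path_eq_path hX ⟨ht.1, ht.2.trans_le ENNReal.half_le_self⟩
      ⟨ht'.1, ht'.2.trans_le ENNReal.half_le_self⟩ h with ⟨h1, -⟩ | ⟨h1, h2, h3⟩
    · exact h1
    · rw [← h1] at ht'
      have h4 := ENNReal.add_lt_add ht.2 ht'.2
      rw [ENNReal.add_halves, h3] at h4
      exact absurd h4 (lt_irrefl _)
  cover x hx := by
    obtain ⟨e, t, ht, rfl⟩ := M.cover x fun h => hx (Or.inl h)
    rcases lt_trichotomy t (M.L e / 2) with h | rfl | h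
    · exact ⟨⟨(e, false), by simp⟩, t, ⟨ht.1, h⟩, rfl⟩
    · exact absurd (Or.inr ⟨⟨(e, false), by simp⟩, rfl⟩) hx
    · have htop : M.L e ≠ ⊤ := by
        intro htop
        rw [htop, ENNReal.top_div_of_ne_top (by simp)] at h
        exact absurd h not_top_lt
      refine ⟨⟨(e, true), fun _ => htop⟩, M.L e - t, ⟨tsub_pos_of_lt ht.2, ?_⟩, ?_⟩
      · rw [ENNReal.sub_lt_iff_lt_right ht.2.ne_top ht.2.le]
        calc M.L e = M.L e / 2 + M.L e / 2 := (ENNReal.add_halves _).symm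
          _ < M.L e / 2 + t := (ENNReal.add_lt_add_iff_left (ne_top_of_lt h)).2 h
      · simp [path, ENNReal.sub_sub_cancel htop ht.2.le]

/-- A real structure maps the edges of the model to edges, compatibly with parametrizations. -/
structure IsEquivariant (M : Model V) (ι : X → X) (τ : M.E → M.E) : Prop where
  involutive : Function.Involutive τ
  nodes : ∀ v ∈ V, ι v ∈ V
  length : ∀ e, M.L (τ e) = M.L e
  map : ∀ e, ∀ t ≤ M.L e, ι (M.α e t) = M.α (τ e) t

end Model

/-- If `V` is stable under `ι`, then `ι` carries edges to edges but may reverse a bounded one. After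
halving, every edge points from `V` towards a midpoint or to infinity, a direction that conjugation
preserves. -/
lemma exists_equivariant_model (hX : IsCurve X) {ι : X → X} (hι : IsRealStructure ι) {S : Set X}
    (hS : S.Finite) : ∃ V : Set X, S ⊆ V ∧ ∃ (M : Model V) (τ : M.E → M.E), M.IsEquivariant ι τ := by
  have hE := hX.toIsEDistSpace
  obtain ⟨W, hW, hmodel⟩ := hX.exists_model
  set V : Set X := (W ∪ S) ∪ ι '' (W ∪ S) with hV
  obtain ⟨M⟩ := hmodel V ((hW.union hS).union ((hW.union hS).image _))
    fun x hx => Or.inl (Or.inl hx)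
  have hVι : ∀ v ∈ V, ι v ∈ V := by
    rintro v (hv | ⟨w, hw, rfl⟩)
    · exact Or.inr ⟨v, hv, rfl⟩
    · rw [hι.involutive w]; exact Or.inl hw
  have hVι' : ∀ v, ι v ∈ V → v ∈ V := fun v hv => hι.involutive v ▸ hVι _ hv
  have key : ∀ d : M.FiniteEnd, ∃ d' : M.FiniteEnd, M.L d'.1.1 = M.L d.1.1 ∧
      ∀ t ≤ M.L d.1.1, ι (M.path d.1 t) = M.path d'.1 t := by
    intro d
    have hd := M.isArc_path d
    refine M.exists_finiteEnd_of_isArc hE (α := fun t => ι (M.path d.1 t))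
      ⟨hd.pos, fun s hs t ht => ?_, hι.continuous.comp_continuousOn hd.continuousOn⟩
      (hVι _ (M.path_zero_mem d)) (hVι _ (M.path_length_mem d)) fun t ht hmem => ?_
    · rw [hι.isometric, hd.isometric s hs t ht]
    · obtain ⟨s, hs, h⟩ := M.exists_path_eq d ht
      exact M.not_mem _ s hs (h ▸ hVι' _ hmem)
  choose τ hτL hτ using key
  refine ⟨V ∪ M.midpoints, fun x hx => Or.inl (Or.inl (Or.inr hx)), M.half hE, τ, ⟨?_, ?_, ?_, ?_⟩⟩
  · exact fun d : M.FiniteEnd => M.finiteEnd_ext hE (M.arc d.1.1).pos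
      (by rw [hτL, hτL]) le_rfl fun t ht => by
        rw [← hτ _ t (by rwa [hτL]), ← hτ _ t ht, hι.involutive]
  · rintro v (hv | ⟨d, rfl⟩)
    · exact Or.inl (hVι v hv)
    · refine Or.inr ⟨τ d, ?_⟩
      simp only
      rw [hτL, hτ d _ ENNReal.half_le_self]
  · exact fun d : M.FiniteEnd => congrArg (· / 2) (hτL d)
  · exact fun d t ht => hτ d t (ht.trans ENNReal.half_le_self)

end RealGraph

/-! ### Connected components and the genus in terms of a model. -/

namespace RealGraph

variable {X : Type u} [TopologicalSpace X] [EDist X]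

omit [EDist X] in
lemma mem_connectedComponent_of_isPreconnected {p : X → Prop} {S : Set X} (hS : IsPreconnected S)
    (hSp : ∀ x ∈ S, p x) {x y : X} (hx : x ∈ S) (hy : y ∈ S) :
    (⟨y, hSp y hy⟩ : {x // p x}) ∈ connectedComponent (⟨x, hSp x hx⟩ : {x // p x}) := by
  have himg : Subtype.val '' (Subtype.val ⁻¹' S : Set {x // p x}) = S := by
    ext z
    exact ⟨by rintro ⟨w, hw, rfl⟩; exact hw, fun hz => ⟨⟨z, hSp z hz⟩, hz, rfl⟩⟩
  have h : IsPreconnected (Subtype.val ⁻¹' S : Set {x // p x}) :=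
    (Topology.IsInducing.isPreconnected_image (f := (Subtype.val : {x // p x} → X))
      Topology.IsInducing.subtypeVal).1 (himg.symm ▸ hS)
  exact h.subset_connectedComponent (x := ⟨x, hSp x hx⟩) hx
    (show (⟨y, hSp y hy⟩ : {x // p x}) ∈ Subtype.val ⁻¹' S from hy)

namespace Model

variable {V : Set X} (M : Model V)

/-- The starting node of an edge. -/
def src (e : M.E) : V := ⟨M.α e 0, M.src_mem e⟩

/-- The end node of an edge. -/
def tgt (e : M.E) : V := ⟨M.α e (M.L e), M.tgt_mem e⟩

open Classical in
/-- The function with given values on the nodes and given constant values on the edges. -/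
noncomputable def extend (h : V → ℝ) (k : M.E → ℝ) (x : X) : ℝ :=
  if hx : x ∈ V then h ⟨x, hx⟩ else k (M.cover x hx).choose

lemma extend_node (h : V → ℝ) (k : M.E → ℝ) (v : V) : M.extend h k v = h v := dif_pos v.2

lemma extend_edge (h : V → ℝ) (k : M.E → ℝ) {e : M.E} {t : ℝ≥0∞} (ht : t ∈ Ioo 0 (M.L e)) :
    M.extend h k (M.α e t) = k e := by
  have hV := M.not_mem e t ht
  obtain ⟨s, hs, hst⟩ := (M.cover _ hV).choose_spec
  rw [extend, dif_neg hV, M.disj _ _ _ _ hs ht hst]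

/-- Near a node only the edges that end there occur, and inside an edge the value is constant. An
edge that misses the subspace imposes no condition. -/
lemma isLocallyConstant_extend (hX : IsEDistSpace X) {p : X → Prop} {h : V → ℝ} {k : M.E → ℝ}
    (hp : ∀ v : V, p v → ∀ e, M.src e = v ∨ M.tgt e = v →
      (∃ t ∈ Ioo 0 (M.L e), p (M.α e t)) → k e = h v) :
    IsLocallyConstant fun x : {x // p x} => M.extend h k x := by
  rw [IsLocallyConstant.iff_eventually_eq]
  rintro ⟨x, hx⟩
  have key : ∀ x, p x → ∀ᶠ y in 𝓝 x, p y → M.extend h k y = M.extend h k x := by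
    refine M.forall_of_nodes_of_edges (fun v hv hpv => ?_) fun e t ht _ => ?_
    · refine M.eventually_node hX hv (fun _ => rfl) fun e he t ht hpt => ?_
      rw [M.extend_edge h k ht, M.extend_node h k ⟨v, hv⟩]
      refine hp ⟨v, hv⟩ hpv e ?_ ⟨t, ht, hpt⟩
      rcases he with he | he
      · exact Or.inl (Subtype.ext he)
      · exact Or.inr (Subtype.ext he)
    · refine M.eventually_edge ht fun s hs _ => ?_
      rw [M.extend_edge h k ht, M.extend_edge h k hs]
  have := (continuous_subtype_val (p := p)).continuousAt (x := ⟨x, hx⟩) (key x hx)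
  filter_upwards [this] with y hy
  exact hy y.2

/-- Connectedness of `X` in combinatorial form: such a function extends, by its common value on the
ends of each edge, to a locally constant function on `X`. -/
lemma eq_of_forall_src_eq_tgt (hX : IsCurve X) {h : V → ℝ}
    (hh : ∀ e, h (M.src e) = h (M.tgt e)) (v w : V) : h v = h w := by
  have := hX.connected
  have hloc := M.isLocallyConstant_extend hX.toIsEDistSpace (p := fun _ => True) (h := h)
    (k := fun e => h (M.src e)) (by
      rintro v - e (rfl | rfl) -
      · rfl
      · exact hh e)
  have := hloc.apply_eq_of_isPreconnected isPreconnected_connectedComponent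
    mem_connectedComponent (mem_connectedComponent_of_isPreconnected (p := fun _ => True)
      isPreconnected_univ (fun _ _ => trivial) (mem_univ (v : X)) (mem_univ (w : X)))
  simpa [extend_node] using this

include M in
lemma nonempty_nodes (hX : IsCurve X) : Nonempty V := by
  have := hX.connected
  obtain ⟨x⟩ := (inferInstance : Nonempty X)
  by_cases hx : x ∈ V
  · exact ⟨⟨x, hx⟩⟩
  · obtain ⟨e, -⟩ := M.cover x hx
    exact ⟨M.src e⟩

include M in
lemma vertices_subset (hX : IsCurve X) : vertices X ⊆ V := by
  intro x hx
  by_contra hV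
  obtain ⟨e, t, ht, rfl⟩ := M.cover x hV
  exact hx ((M.arc e).hasValence_two hX.toIsEDistSpace ht (M.edge_mem_nhds ht))

lemma edge_not_mem_vertices (hX : IsCurve X) {e : M.E} {t : ℝ≥0∞} (ht : t ∈ Ioo 0 (M.L e)) :
    M.α e t ∉ vertices X := fun h => M.not_mem e t ht (M.vertices_subset hX h)

lemma card_ends_eq_two (hX : IsCurve X) {v : X} (hv : v ∈ V) (hv' : v ∉ vertices X) :
    Nat.card (M.Ends v) = 2 := by
  have hE := hX.toIsEDistSpace
  have h2 : HasValence v 2 := not_not.1 hv'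
  refine HasValence.unique hE (M.hasValence_node hX hv fun e he hev => ?_) h2
  exact (M.isEndChart hX he).not_hasValence hE 2 (hev ▸ h2)

open Module

section Components


/-- In the dual graph the nodes are the edges of the model, and each node of the model of valence 2
is a link between the two edges `a v` and `b v` that meet there. Its components are those of the
complement of the vertices. -/
lemma finrank_ker_dual [Finite M.E] (hX : IsCurve X) {a b : {v : V // (v : X) ∉ vertices X} → M.E × Bool}
    (ha : ∀ v, M.endpoint (a v) = v.1) (hb : ∀ v, M.endpoint (b v) = v.1)
    (hab : ∀ v d, M.endpoint d = v.1 → d = a v ∨ d = b v) :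
    Nat.card (ConnectedComponents ((vertices X)ᶜ : Set X)) =
      finrank ℝ (LinearMap.ker (coboundary (fun v => (a v).1) (fun v => (b v).1))) := by
  have hE := hX.toIsEDistSpace
  choose t ht using fun e => exists_between (M.arc e).pos
  have hpt : ∀ e, M.α e (t e) ∉ vertices X := fun e => M.edge_not_mem_vertices hX (ht e)
  have hIco : ∀ d : M.E × Bool, M.endpoint d ∉ vertices X → ∃ S : Set X, IsPreconnected S ∧
      (∀ x ∈ S, x ∉ vertices X) ∧ M.endpoint d ∈ S ∧ M.α d.1 (t d.1) ∈ S := by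
    rintro ⟨e, _ | _⟩ hd
    · refine ⟨M.α e '' Ico 0 (M.L e), (M.arc e).isPreconnected_image ordConnected_Ico
        fun t ht => ht.2.le, ?_, ⟨0, ⟨le_rfl, (M.arc e).pos⟩, rfl⟩, ⟨_, ⟨zero_le, (ht e).2⟩, rfl⟩⟩
      rintro _ ⟨s, hs, rfl⟩
      rcases eq_or_ne s 0 with rfl | h0
      · exact hd
      · exact M.edge_not_mem_vertices hX ⟨pos_iff_ne_zero.2 h0, hs.2⟩
    · refine ⟨M.α e '' Ioc 0 (M.L e), (M.arc e).isPreconnected_image ordConnected_Ioc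
        fun t ht => ht.2, ?_, ⟨_, ⟨(M.arc e).pos, le_rfl⟩, rfl⟩, ⟨_, ⟨(ht e).1, (ht e).2.le⟩, rfl⟩⟩
      rintro _ ⟨s, hs, rfl⟩
      rcases hs.2.eq_or_lt with rfl | h0
      · exact hd
      · exact M.edge_not_mem_vertices hX ⟨hs.1, h0⟩
  have hlink : ∀ v : {v : V // (v : X) ∉ vertices X}, ∀ d, M.endpoint d = v.1 →
      (⟨v.1, v.2⟩ : {x // x ∈ (vertices X)ᶜ}) ∈ connectedComponent ⟨M.α d.1 (t d.1), hpt d.1⟩ := by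
    intro v d hd
    obtain ⟨S, hS, hSp, h1, h2⟩ := hIco d (hd ▸ v.2)
    rw [hd] at h1
    exact mem_connectedComponent_of_isPreconnected hS hSp h2 h1
  refine card_connectedComponents_eq_finrank _ _ (fun e => ⟨M.α e (t e), hpt e⟩) ?_ ?_ ?_
  · rintro ⟨x, hx⟩
    by_cases hxV : x ∈ V
    · exact ⟨_, hlink ⟨⟨x, hxV⟩, hx⟩ _ (ha _)⟩
    · obtain ⟨e, s, hs, rfl⟩ := M.cover x hxV
      refine ⟨e, mem_connectedComponent_of_isPreconnected (S := M.α e '' Ioo 0 (M.L e))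
        ((M.arc e).isPreconnected_image ordConnected_Ioo fun t ht => ht.2.le) ?_
        ⟨_, ht e, rfl⟩ ⟨s, hs, rfl⟩⟩
      rintro _ ⟨s, hs, rfl⟩
      exact M.edge_not_mem_vertices hX hs
  · intro v
    have h1 := connectedComponent_eq (hlink v _ (ha v))
    have h2 := connectedComponent_eq (hlink v _ (hb v))
    rw [h2, ← h1]
    exact mem_connectedComponent
  · intro h hh
    classical
    refine ⟨_, M.isLocallyConstant_extend hE (p := fun x => x ∈ (vertices X)ᶜ)
      (h := fun v => if hv : (v : X) ∉ vertices X then h (a ⟨v, hv⟩).1 else 0) (k := h) ?_,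
      fun e => M.extend_edge _ _ (ht e)⟩
    intro v hv e he _
    refine Eq.trans ?_ (dif_pos (show (v : X) ∉ vertices X from hv)).symm
    have : ∃ c, M.endpoint (e, c) = v := by
      rcases he with he | he
      · exact ⟨false, congrArg Subtype.val he⟩
      · exact ⟨true, congrArg Subtype.val he⟩
    obtain ⟨c, hc⟩ := this
    rcases hab ⟨v, hv⟩ _ hc with h' | h'
    · rw [← h']
    · rw [hh ⟨v, hv⟩, ← h']

/-- Let `c` be a cycle of the dual graph, extended by zero to the vertices. At each edge the
contributions of its two ends cancel, so |c| agrees at both ends, and is constant by connectedness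
of `X`. It vanishes at a vertex, so `c = 0`. -/
lemma surjective_dual [Fintype V] (hX : IsCurve X) {a b : {v : V // (v : X) ∉ vertices X} → M.E × Bool}
    [Fintype {v : V // (v : X) ∉ vertices X}]
    (ha : ∀ v, M.endpoint (a v) = v.1) (hb : ∀ v, M.endpoint (b v) = v.1)
    (hne : ∀ v, a v ≠ b v)
    (hab : ∀ v d, M.endpoint d = v.1 → d = a v ∨ d = b v) (hvert : (vertices X).Nonempty) :
    Function.Surjective (coboundary (fun v => (a v).1) (fun v => (b v).1)) := by
  classical
  have hE := hX.toIsEDistSpace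
  have hne' : ∀ v, (a v).1 ≠ (b v).1 := by
    intro v h
    have h1 := ha v
    have h2 := hb v
    have h3 := hne v
    rcases hav : a v with ⟨e, c⟩
    rcases hbv : b v with ⟨e', c'⟩
    rw [hav] at h h1 h3
    rw [hbv] at h h2 h3
    simp only at h
    subst h
    have := M.src_ne_tgt hE e
    cases c <;> cases c' <;> first | exact h3 rfl | skip
    · exact this (h1.trans h2.symm)
    · exact this (h2.trans h1.symm)
  refine surjective_of_annihilator fun c hc => ?_
  let k : V → ℝ := fun v => if hv : (v : X) ∉ vertices X then |c ⟨v, hv⟩| else 0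
  have hk : ∀ e, k (M.src e) = k (M.tgt e) := by
    intro e
    -- The terms of the pairing of `c` with the coboundary of the indicator function of `e`. Only
    -- the two ends of `e` contribute.
    let g : V → ℝ := fun v => if hv : (v : X) ∉ vertices X then
      c ⟨v, hv⟩ * ((if (b ⟨v, hv⟩).1 = e then 1 else 0) - (if (a ⟨v, hv⟩).1 = e then 1 else 0)) else 0
    have hg : ∀ v : V, (∃ i, M.endpoint (e, i) = v) → |g v| = k v := by
      rintro v ⟨i, hi⟩
      by_cases hv : (v : X) ∉ vertices X
      · simp only [g, k, dif_pos hv]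
        rcases hab ⟨v, hv⟩ _ hi with h | h
        · have h1 : (a ⟨v, hv⟩).1 = e := by rw [← h]
          have h2 : (b ⟨v, hv⟩).1 ≠ e := fun h' => hne' ⟨v, hv⟩ (h1.trans h'.symm)
          simp [h1, h2]
        · have h1 : (b ⟨v, hv⟩).1 = e := by rw [← h]
          have h2 : (a ⟨v, hv⟩).1 ≠ e := fun h' => hne' ⟨v, hv⟩ (h'.trans h1.symm)
          simp [h1, h2]
      · simp only [g, k, dif_neg hv, abs_zero]
    have hg0 : ∀ v, v ∉ ({M.src e, M.tgt e} : Finset V) → g v = 0 := by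
      intro v hv
      simp only [Finset.mem_insert, Finset.mem_singleton, not_or] at hv
      by_cases hv' : (v : X) ∉ vertices X
      · have key : ∀ d : M.E × Bool, M.endpoint d = v → d.1 ≠ e := by
          rintro ⟨e', _ | _⟩ hd rfl
          · exact hv.1 (Subtype.ext hd.symm)
          · exact hv.2 (Subtype.ext hd.symm)
        simp [g, key _ (ha ⟨v, hv'⟩), key _ (hb ⟨v, hv'⟩)]
      · simp only [g, dif_neg hv']
    have hsum : ∑ v, g v = 0 := by
      have h1 := hc fun e' => if e' = e then 1 else 0
      simp only [coboundary_apply] at h1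
      rw [← h1, ← Finset.sum_subset (Finset.subset_univ
        (Finset.univ.filter fun v : V => (v : X) ∉ vertices X))]
      · rw [Finset.sum_subtype _ (p := fun v : V => (v : X) ∉ vertices X) (by simp)]
        exact Finset.sum_congr rfl fun v _ => dif_pos v.2
      · intro v _ hv
        simp only [Finset.mem_filter, Finset.mem_univ, true_and] at hv
        exact dif_neg hv
    rw [← Finset.sum_subset (Finset.subset_univ _) fun v _ hv => hg0 v hv,
      Finset.sum_pair fun h => M.src_ne_tgt hE e (congrArg Subtype.val h)] at hsum
    rw [← hg (M.src e) ⟨false, rfl⟩, ← hg (M.tgt e) ⟨true, rfl⟩, eq_neg_of_add_eq_zero_left hsum,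
      abs_neg]
  obtain ⟨x, hx⟩ := hvert
  funext v
  have h1 := M.eq_of_forall_src_eq_tgt hX hk v.1 ⟨x, M.vertices_subset hX hx⟩
  simp only [k, dif_pos v.2, dif_neg (not_not.2 hx)] at h1
  exact abs_eq_zero.1 h1

/-- The genus is the first Betti number of any model. -/
theorem genus_eq [Fintype V] [Fintype M.E] (hX : IsCurve X) :
    genus X = 1 + (Fintype.card M.E : ℤ) - (Fintype.card V : ℤ) := by
  classical
  have hE := hX.toIsEDistSpace
  have hfin := M.finite_ends
  by_cases hvert : vertices X = ∅
  · rw [genus, if_pos hvert]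
    -- Without vertices every node has exactly two ends of edges, so there are as many edges as
    -- nodes.
    have h1 : Fintype.card (M.E × Bool) = ∑ v : V, 2 := by
      let F : M.E × Bool → V := fun d => ⟨M.endpoint d, by
        obtain ⟨e, _ | _⟩ := d
        · exact M.src_mem e
        · exact M.tgt_mem e⟩
      rw [Fintype.card, Finset.card_eq_sum_card_fiberwise (f := F) (t := Finset.univ) (by simp)]
      refine Finset.sum_congr rfl fun v _ => ?_
      rw [← M.card_ends_eq_two hX v.2 (by simp [hvert])]
      rw [Nat.card_eq_fintype_card, Fintype.card_subtype]
      congr 1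
      ext d
      simp [F, Subtype.ext_iff]
    rw [Fintype.card_prod, Fintype.card_bool, Finset.sum_const, Finset.card_univ, smul_eq_mul] at h1
    omega
  · rw [genus, if_neg hvert]
    have h2 : ∀ v : {v : V // (v : X) ∉ vertices X}, ∃ a b : M.E × Bool, a ≠ b ∧
        M.endpoint a = v.1 ∧ M.endpoint b = v.1 ∧ ∀ d, M.endpoint d = v.1 → d = a ∨ d = b := by
      intro v
      obtain ⟨a, b, hab, huniv⟩ := Nat.card_eq_two_iff.1 (M.card_ends_eq_two hX v.1.2 v.2)
      refine ⟨a.1, b.1, fun h => hab (Subtype.ext h), a.2, b.2, fun d hd => ?_⟩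
      have := mem_univ (⟨d, hd⟩ : M.Ends v.1)
      rw [← huniv] at this
      rcases this with h | h
      · exact Or.inl (congrArg Subtype.val h)
      · exact Or.inr (congrArg Subtype.val h)
    choose a b hne ha hb hab using h2
    -- The dual coboundary is onto, so the number of edges of the model is the number of components
    -- of the complement of the vertices plus the number of nodes of valence 2.
    rw [M.finrank_ker_dual hX ha hb hab]
    have e1 := LinearMap.finrank_range_add_finrank_ker
      (coboundary (fun v => (a v).1) (fun v => (b v).1))
    rw [LinearMap.range_eq_top.2 (M.surjective_dual hX ha hb hne hab
      (nonempty_iff_ne_empty.2 hvert)), finrank_top, finrank_fintype_fun_eq_card,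
      finrank_fintype_fun_eq_card] at e1
    have e2 : (vertices X).ncard = Fintype.card {v : V // (v : X) ∈ vertices X} := by
      have : Subtype.val '' {v : V | (v : X) ∈ vertices X} = vertices X := by
        ext x
        exact ⟨by rintro ⟨v, hv, rfl⟩; exact hv, fun h => ⟨⟨x, M.vertices_subset hX h⟩, h, rfl⟩⟩
      rw [← congrArg Set.ncard this, ncard_image_of_injective _ Subtype.val_injective, ← Nat.card_coe_set_eq,
        Nat.card_eq_fintype_card]
      rfl
    have e3 := Fintype.card_subtype_compl fun v : V => (v : X) ∈ vertices X
    have e4 := Fintype.card_subtype_le fun v : V => (v : X) ∈ vertices X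
    omega

/-- Conjugation reverses no edge, so an edge with a fixed interior point is fixed pointwise. The
real locus is therefore the subgraph of fixed nodes and edges. -/
lemma card_fixed_components (hX : IsCurve X) {ι : X → X} {τ : M.E → M.E}
    (hτ : M.IsEquivariant ι τ) {σ : V → V} (hσ : ∀ v : V, (σ v : X) = ι v)
    (sF tF : {e // τ e = e} → {v // σ v = v}) (hsF : ∀ e, (sF e : V) = M.src e)
    (htF : ∀ e, (tF e : V) = M.tgt e) :
    Nat.card (ConnectedComponents {x // ι x = x}) =
      finrank ℝ (LinearMap.ker (coboundary sF tF)) := by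
  classical
  have hE := hX.toIsEDistSpace
  have : Finite V := M.finite_nodes
  have hnode : ∀ n : {v // σ v = v}, ι n.1 = n.1 := fun n => by rw [← hσ, n.2]
  have hedge : ∀ e : {e // τ e = e}, ∀ t ≤ M.L e.1, ι (M.α e.1 t) = M.α e.1 t := fun e t ht => by
    rw [hτ.map _ t ht, e.2]
  have hfix : ∀ e, ∀ t ∈ Ioo 0 (M.L e), ι (M.α e t) = M.α e t → τ e = e := fun e t ht h => by
    rw [hτ.map _ t ht.2.le] at h
    exact M.disj _ _ _ _ (by rwa [hτ.length]) ht h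
  have hconn : ∀ e : {e // τ e = e}, ∀ t (ht : t ≤ M.L e.1),
      (⟨M.α e.1 t, hedge e t ht⟩ : {x // ι x = x}) ∈
        connectedComponent ⟨(sF e).1, hnode (sF e)⟩ := by
    intro e t ht
    have h1 : ((sF e).1 : X) ∈ M.α e.1 '' Iic (M.L e.1) := ⟨0, mem_Iic.2 zero_le, by rw [hsF]; rfl⟩
    have h2 : ∀ x ∈ M.α e.1 '' Iic (M.L e.1), ι x = x := by
      rintro _ ⟨s, hs, rfl⟩
      exact hedge e s hs
    exact mem_connectedComponent_of_isPreconnected (p := fun x => ι x = x)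
      ((M.arc e.1).isPreconnected_image ordConnected_Iic subset_rfl) h2 h1 ⟨t, ht, rfl⟩
  refine card_connectedComponents_eq_finrank sF tF (fun n => ⟨n.1, hnode n⟩) ?_ ?_ ?_
  · rintro ⟨x, hx⟩
    by_cases hxV : x ∈ V
    · exact ⟨⟨⟨x, hxV⟩, Subtype.ext ((hσ _).trans hx)⟩, mem_connectedComponent⟩
    · obtain ⟨e, t, ht, rfl⟩ := M.cover x hxV
      exact ⟨_, hconn ⟨e, hfix e t ht hx⟩ t ht.2.le⟩
  · intro e
    have h1 := connectedComponent_eq (hconn e _ le_rfl)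
    have h2 : (⟨(tF e).1, hnode (tF e)⟩ : {x // ι x = x}) = ⟨M.α e.1 (M.L e.1), hedge e _ le_rfl⟩ :=
      Subtype.ext (show ((tF e).1 : X) = _ from congrArg Subtype.val (htF e))
    rw [h2, ← h1]
    exact mem_connectedComponent
  · intro h hh
    let h' : V → ℝ := fun v => if hv : σ v = v then h ⟨v, hv⟩ else 0
    have hh' : ∀ n : {v // σ v = v}, h' n.1 = h n := fun n => dif_pos n.2
    refine ⟨_, M.isLocallyConstant_extend hE (p := fun x => ι x = x) (h := h')
      (k := fun e => h' (M.src e)) ?_, fun n => (M.extend_node _ _ n.1).trans (hh' n)⟩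
    rintro v hv e (rfl | rfl) ⟨t, ht, hp⟩
    · rfl
    · have he := hfix e t ht hp
      have h1 := hh ⟨e, he⟩
      rwa [← hh', ← hh', hsF, htF] at h1

end Components

end Model

end RealGraph

/-! ### Flows, rank at least 1, and nonseparating points. -/

namespace RealGraph

variable {X : Type u}

lemma exists_le_single_of_degree_eq_one {D : X →₀ ℤ} (h0 : 0 ≤ D) (h1 : degree D = 1) :
    ∃ p, D ≤ Finsupp.single p 1 := by
  classical
  obtain ⟨p, hp⟩ : ∃ p, D p ≠ 0 := by
    by_contra! hcon
    rw [show D = 0 from Finsupp.ext hcon] at h1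
    simp [degree] at h1
  refine ⟨p, fun q => ?_⟩
  have hsum : degree D = D p + ∑ q ∈ D.support.erase p, D q :=
    (Finset.add_sum_erase _ _ (Finsupp.mem_support_iff.2 hp)).symm
  have hpos : 0 < D p := lt_of_le_of_ne (h0 p) (Ne.symm hp)
  have hnn : 0 ≤ ∑ q ∈ D.support.erase p, D q := Finset.sum_nonneg fun q _ => h0 q
  by_cases hpq : p = q
  · subst hpq
    rw [Finsupp.single_eq_same]
    omega
  · rw [Finsupp.single_eq_of_ne' hpq]
    by_cases hq : D q = 0
    · rw [hq]
    · have := Finset.single_le_sum (f := fun q => D q) (fun q _ => h0 q)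
        (Finset.mem_erase.2 ⟨Ne.symm hpq, Finsupp.mem_support_iff.2 hq⟩)
      omega

lemma degree_add (D D' : X →₀ ℤ) : degree (D + D') = degree D + degree D' :=
  Finsupp.sum_add_index' (fun _ => rfl) fun _ _ _ => rfl

lemma degree_single (p : X) (n : ℤ) : degree (Finsupp.single p n) = n :=
  Finsupp.sum_single_index rfl

variable [TopologicalSpace X] [EDist X]

namespace Model

variable {V : Set X} (M : Model V)

lemma order_add {R : Type*} [AddCommGroup R] (u u' : M.E → R) (v : X) :
    M.order (u + u') v = M.order u v + M.order u' v := by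
  simp only [order, ← Finset.sum_add_distrib]
  refine Finset.sum_congr rfl fun e _ => ?_
  split_ifs <;> simp [Pi.add_apply]; abel

lemma exists_flow (hX : IsCurve X) (p q : V) :
    ∃ c : M.E → ℤ, ∀ v, M.order c v = Finsupp.single (q : X) 1 v - Finsupp.single (p : X) 1 v := by
  classical
  let P : V → Prop := fun w =>
    ∃ c : M.E → ℤ, ∀ v, M.order c v = Finsupp.single (q : X) 1 v - Finsupp.single (w : X) 1 v
  have hsingle : ∀ e (n : ℤ) v, M.order (Pi.single e n) v =
      Finsupp.single (M.src e : X) n v - Finsupp.single (M.tgt e : X) n v := by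
    intro e n v
    rw [order, Finset.sum_eq_single e]
    · rw [Finsupp.single_apply, Finsupp.single_apply]
      simp [src, tgt]
      congr
    · intro e' _ hne
      simp [Pi.single_eq_of_ne hne]
    · simp
  have hstep : ∀ e, P (M.src e) ↔ P (M.tgt e) := by
    intro e
    constructor
    · rintro ⟨c, hc⟩
      refine ⟨c + Pi.single e 1, fun v => ?_⟩
      rw [order_add, hc, hsingle]; ring
    · rintro ⟨c, hc⟩
      refine ⟨c + Pi.single e (-1), fun v => ?_⟩
      rw [order_add, hc, hsingle, Finsupp.single_neg, Finsupp.single_neg]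
      simp only [Finsupp.coe_neg, Pi.neg_apply]; ring
  have h1 := M.eq_of_forall_src_eq_tgt hX (h := fun w => if P w then (1 : ℝ) else 0)
    (fun e => by simp only [hstep e]) p q
  have hq : P q := ⟨0, fun v => by simp [order]⟩
  simp only [hq, if_true] at h1
  by_contra hp
  have hp' : ¬ P p := hp
  simp [hp'] at h1

lemma order_comp {ι : X → X} (hι : IsRealStructure ι) {τ : M.E → M.E} (hτ : M.IsEquivariant ι τ)
    (c : M.E → ℤ) (v : X) : M.order (c ∘ τ) v = M.order c (ι v) := by
  classical
  have hiff : ∀ x, ι x = v ↔ x = ι v := fun x =>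
    ⟨fun h => by rw [← h, hι.involutive], fun h => by rw [h, hι.involutive]⟩
  have := M.finite_edges
  let := Fintype.ofFinite M.E
  rw [order, order, ← Equiv.sum_comp hτ.involutive.toPerm]
  refine Finset.sum_congr rfl fun e _ => ?_
  have h0 := hτ.map e 0 zero_le
  have h1 := hτ.map e (M.L e) le_rfl
  simp only [Function.Involutive.coe_toPerm, Function.comp_apply, hτ.involutive e, hτ.length, ← h0,
    ← h1, hiff]

end Model

-- It suffices to join `p + ι p` to `q + ι q` for an arbitrary point `q`, by a rational function
-- whose slopes form a conjugation invariant flow.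
open Module in
lemma rankAtLeast_one (hX : IsCurve X) {ι : X → X} (hι : IsRealStructure ι) (hM : IsStrongM ι)
    (p : X) : RankAtLeast (Finsupp.single p 1 + Finsupp.single (ι p) 1) 1 := by
  classical
  intro E hE0 hE1
  obtain ⟨q, hq⟩ := exists_le_single_of_degree_eq_one hE0 hE1
  refine ⟨Finsupp.single q 1 + Finsupp.single (ι q) 1, ?_, ?_, hq.trans ?_⟩
  rotate_left
  · exact add_nonneg (Finsupp.single_nonneg.2 zero_le_one) (Finsupp.single_nonneg.2 zero_le_one)
  · exact le_add_of_nonneg_right (Finsupp.single_nonneg.2 zero_le_one)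
  obtain ⟨V, hSV, M, τ, hτ⟩ := exists_equivariant_model hX hι (S := {p, q, ι p, ι q}) (toFinite _)
  have hpV : p ∈ V := hSV (by simp)
  have hqV : q ∈ V := hSV (by simp)
  have hpV' : ι p ∈ V := hSV (by simp)
  have hqV' : ι q ∈ V := hSV (by simp)
  have : Finite V := M.finite_nodes
  have := M.finite_edges
  have := Fintype.ofFinite V
  have := Fintype.ofFinite M.E
  have := M.nonempty_nodes hX
  obtain ⟨c, hc⟩ := M.exists_flow hX ⟨p, hpV⟩ ⟨q, hqV⟩
  let u : M.E → ℤ := c + c ∘ τ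
  have hu : ∀ e, u (τ e) = u e := fun e => by
    simp only [u, Pi.add_apply, Function.comp_apply, hτ.involutive e]; ring
  let σ : V → V := fun v => ⟨ι v, hτ.nodes v v.2⟩
  have hσ : Function.Involutive σ := fun v => Subtype.ext (hι.involutive v)
  have hs : ∀ e, M.src (τ e) = σ (M.src e) := fun e => Subtype.ext (hτ.map e 0 zero_le).symm
  have ht : ∀ e, M.tgt (τ e) = σ (M.tgt e) := fun e => by
    refine Subtype.ext ?_
    simp only [Model.tgt, σ, hτ.length]
    exact (hτ.map e _ le_rfl).symm
  let sF : {e // τ e = e} → {v // σ v = v} := fun e => ⟨M.src e, by rw [← hs, e.2]⟩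
  let tF : {e // τ e = e} → {v // σ v = v} := fun e => ⟨M.tgt e, by rw [← ht, e.2]⟩
  have hF : finrank ℝ (LinearMap.ker (coboundary sF tF)) + Fintype.card V =
      Fintype.card M.E + 2 := by
    have h1 := M.card_fixed_components hX hτ (fun _ => rfl) sF tF (fun _ => rfl) fun _ => rfl
    have h2 : (Nat.card (ConnectedComponents {x : X // ι x = x}) : ℤ) = genus X + 1 := hM
    rw [h1, M.genus_eq hX] at h2
    omega
  -- On an unbounded edge `toReal` turns the prescribed difference into 0. This is harmless: the
  -- extension to a rational function uses `h` at finite nodes only.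
  obtain ⟨h, -, hh⟩ := exists_invariant_primitive (s := M.src) (t := M.tgt) hσ hτ.involutive hs ht
    (fun h => M.eq_of_forall_src_eq_tgt hX) sF tF (fun _ => rfl) (fun _ => rfl) hF
    (ω := fun e => u e * (M.L e).toReal) fun e => by simp only [hu, hτ.length]
  let D : X →₀ ℤ := (Finsupp.single q 1 + Finsupp.single (ι q) 1) -
    (Finsupp.single p 1 + Finsupp.single (ι p) 1)
  have hD : ∀ v ∈ V, D v = M.order u v := by
    intro v _
    have hiff : ∀ x, ι v = x ↔ v = ι x := fun x =>
      ⟨fun h => by rw [← h, hι.involutive], fun h => by rw [h, hι.involutive]⟩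
    rw [M.order_add, M.order_comp hι hτ, hc, hc]
    simp only [D, Finsupp.coe_sub, Finsupp.coe_add, Pi.sub_apply, Pi.add_apply,
      Finsupp.single_apply, eq_comm (b := ι v), hiff, eq_comm (b := v)]
    ring
  have hD0 : ∀ x, x ∉ V → D x = 0 := by
    intro x hx
    have hne : ∀ y ∈ V, y ≠ x := fun y hy h => hx (h ▸ hy)
    simp [D, hne _ hpV, hne _ hqV, hne _ hpV', hne _ hqV']
  exact M.exists_hasPrincipalDivisor hX (M.extend h fun _ => 0) u (fun e _ => by
    rw [← hh e]
    exact congrArg₂ (· - ·) (M.extend_node h _ (M.tgt e)) (M.extend_node h _ (M.src e))) hD hD0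

/-- If the genus is not zero then some point of valence `2` does not separate the curve. -/
lemma exists_nonseparating (hX : IsCurve X) (hg : genus X ≠ 0) :
    ∃ x : X, HasValence x 2 ∧ IsPreconnected ({x}ᶜ : Set X) := by
  classical
  have hE := hX.toIsEDistSpace
  obtain ⟨V, hV, hmodel⟩ := hX.exists_model
  obtain ⟨M⟩ := hmodel V hV subset_rfl
  have : Finite V := M.finite_nodes
  have := M.finite_edges
  have := Fintype.ofFinite V
  have := Fintype.ofFinite M.E
  have hne := M.nonempty_nodes hX
  -- Its kernel consists of the constants, so surjectivity would mean one edge fewer than nodes,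
  -- that is, genus 0.
  have hnot : ¬ Function.Surjective (coboundary M.src M.tgt) := by
    intro hsurj
    have e1 := LinearMap.finrank_range_add_finrank_ker (coboundary M.src M.tgt)
    have e2 : Module.finrank ℝ (LinearMap.ker (coboundary M.src M.tgt)) = 1 :=
      finrank_ker_eq_one (mem_ker_coboundary.2 fun _ => rfl)
        fun h hh => M.eq_of_forall_src_eq_tgt hX (mem_ker_coboundary.1 hh)
    rw [LinearMap.range_eq_top.2 hsurj, finrank_top, Module.finrank_fintype_fun_eq_card,
      Module.finrank_fintype_fun_eq_card] at e1
    rw [M.genus_eq hX] at hg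
    omega
  -- A nonzero cycle. An edge on which it does not vanish is not a bridge, so the interior points of
  -- that edge do not separate the curve.
  obtain ⟨c, hc, hc0⟩ : ∃ c : M.E → ℝ,
      (∀ w, ∑ e, c e * coboundary M.src M.tgt w e = 0) ∧ c ≠ 0 := by
    by_contra! hcon
    exact hnot (surjective_of_annihilator hcon)
  obtain ⟨e, he⟩ := Function.ne_iff.1 hc0
  obtain ⟨t, ht⟩ := exists_between (M.arc e).pos
  refine ⟨M.α e t, (M.arc e).hasValence_two hE ht (M.edge_mem_nhds ht), ?_⟩
  set x := M.α e t with hx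
  have hxV : x ∉ V := M.not_mem e t ht
  obtain ⟨v₀⟩ := hne
  set C := connectedComponentIn ({x}ᶜ : Set X) v₀ with hC
  have hVx : ∀ v ∈ V, v ∈ ({x}ᶜ : Set X) := fun v hv h => hxV (mem_singleton_iff.1 h ▸ hv)
  have hmem : ∀ (S : Set X) (a b : X), IsPreconnected S → S ⊆ {x}ᶜ → a ∈ S → b ∈ S → a ∈ C →
      b ∈ C := by
    intro S a b hS hSx ha hb haC
    rw [hC, connectedComponentIn_eq haC]
    exact hS.subset_connectedComponentIn ha hSx hb
  have hedge : ∀ e' ≠ e, IsPreconnected (M.α e' '' Iic (M.L e')) ∧ M.α e' '' Iic (M.L e') ⊆ {x}ᶜ := by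
    intro e' hne
    refine ⟨(M.arc e').isPreconnected_image ordConnected_Iic subset_rfl, ?_⟩
    rintro _ ⟨s, hs, rfl⟩ hsx
    have hsx' : M.α e' s = x := hsx
    rcases Iic_eq_union_Ioo hs with h | rfl | rfl
    · exact hne (M.disj _ _ _ _ h ht hsx')
    · exact hxV (hsx' ▸ M.src_mem e')
    · exact hxV (hsx' ▸ M.tgt_mem e')
  let h : V → ℝ := fun v => if (v : X) ∈ C then 1 else 0
  have hh : ∀ e' ≠ e, h (M.src e') = h (M.tgt e') := by
    intro e' hne
    obtain ⟨h1, h2⟩ := hedge e' hne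
    have h3 : (M.src e' : X) ∈ M.α e' '' Iic (M.L e') := ⟨0, mem_Iic.2 zero_le, rfl⟩
    have h4 : (M.tgt e' : X) ∈ M.α e' '' Iic (M.L e') := ⟨_, mem_Iic.2 le_rfl, rfl⟩
    have : (M.src e' : X) ∈ C ↔ (M.tgt e' : X) ∈ C :=
      ⟨hmem _ _ _ h1 h2 h3 h4, hmem _ _ _ h1 h2 h4 h3⟩
    simp only [h, this]
  -- In the pairing of the cycle with the coboundary of `h` all terms except that of `e` vanish.
  -- Hence that term is zero too, and both ends of `e` lie on the same side.
  have hhe : ∀ e', h (M.src e') = h (M.tgt e') := by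
    intro e'
    by_cases hne : e' = e
    · subst hne
      have h1 := hc h
      rw [Finset.sum_eq_single e'] at h1
      · rcases mul_eq_zero.1 h1 with h2 | h2
        · exact absurd h2 he
        · exact (sub_eq_zero.1 h2).symm
      · intro e'' _ hne
        simp [hh e'' hne]
      · simp
    · exact hh e' hne
  have hVC : ∀ v : V, (v : X) ∈ C := by
    intro v
    have h1 := M.eq_of_forall_src_eq_tgt hX hhe v v₀
    have h2 : (v₀ : X) ∈ C := mem_connectedComponentIn (hVx _ v₀.2)
    by_contra h3
    simp [h, h2, h3] at h1
  have hall : ({x}ᶜ : Set X) ⊆ C := by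
    refine M.forall_of_nodes_of_edges (fun v hv _ => hVC ⟨v, hv⟩) fun e' s hs hsx => ?_
    by_cases hne : e' = e
    · subst hne
      have hinj := (M.arc e').injOn hE
      rcases lt_trichotomy s t with hst | rfl | hst
      · refine hmem (M.α e' '' Icc 0 s) _ _ ((M.arc e').isPreconnected_image ordConnected_Icc
          fun r hr => hr.2.trans hs.2.le) ?_ ⟨0, by simp, rfl⟩ ⟨s, by simp, rfl⟩ (hVC (M.src e'))
        rintro _ ⟨r, hr, rfl⟩ hrx
        have := hinj (mem_Iic.2 (hr.2.trans hs.2.le)) (mem_Iic.2 ht.2.le) hrx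
        exact absurd hst (not_lt.2 (this ▸ hr.2))
      · exact absurd rfl hsx
      · refine hmem (M.α e' '' Icc s (M.L e')) _ _ ((M.arc e').isPreconnected_image ordConnected_Icc
          fun r hr => hr.2) ?_ ⟨M.L e', ⟨hs.2.le, le_rfl⟩, rfl⟩ ⟨s, ⟨le_rfl, hs.2.le⟩, rfl⟩
          (hVC (M.tgt e'))
        rintro _ ⟨r, hr, rfl⟩ hrx
        have := hinj (mem_Iic.2 hr.2) (mem_Iic.2 ht.2.le) hrx
        exact absurd hst (not_lt.2 (this ▸ hr.1))
    · obtain ⟨h1, h2⟩ := hedge e' hne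
      exact hmem _ _ _ h1 h2 ⟨0, mem_Iic.2 zero_le, rfl⟩ ⟨s, mem_Iic.2 hs.2.le, rfl⟩ (hVC (M.src e'))
  rw [show ({x}ᶜ : Set X) = C from hall.antisymm (connectedComponentIn_subset _ _)]
  exact isPreconnected_connectedComponentIn

end RealGraph

/-! ### The maximum principle and rank at most 1. -/

namespace RealGraph

variable {X : Type u} [TopologicalSpace X] [EDist X]

/-- A maximum principle: if a divisor is effective apart from a simple pole at a point `x` of valence
`2` that does not separate the curve and has another point in its support, then it is not principal. -/
lemma not_hasPrincipalDivisor (hX : IsCurve X) {x y : X} (hx : HasValence x 2)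
    (hconn : IsPreconnected ({x}ᶜ : Set X)) {A : X →₀ ℤ} (hA : ∀ p, p ≠ x → 0 ≤ A p)
    (hAx : -1 ≤ A x) (hy : 0 < A y) (hyx : y ≠ x) (f : X → EReal) :
    ¬ HasPrincipalDivisor f A := by
  classical
  rintro ⟨hcont, hord⟩
  have hE := hX.toIsEDistSpace
  have := hX.t2
  have := hX.compact
  have := hX.connected
  obtain ⟨m, -, hm⟩ := isCompact_univ.exists_isMaxOn univ_nonempty hcont.continuousOn
  have hmax : ∀ z, f z ≤ f m := fun z => hm (mem_univ z)
  set S : Set X := {p | f p = f m} with hS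
  have hScl : IsClosed S := isClosed_eq hcont continuous_const
  have hSne : S.Nonempty := ⟨m, rfl⟩
  -- slopes at a maximum are not positive
  have hslope : ∀ p ∈ S, ∀ n r (φ : Fin n → ℝ → X) (a : ℝ) (σ : Fin n → ℤ), IsStarChart p n r φ →
      (∀ k, ∀ t ∈ Ico 0 r, f (φ k t) = ((a + (σ k : ℝ) * t : ℝ) : EReal)) →
      f m = (a : EReal) ∧ ∀ k, σ k ≤ 0 := by
    intro p hp n r φ a σ h hf
    have hr := h.radius_pos
    have hfm : f m = (a : EReal) := by
      have h1 := hf ⟨0, h.pos⟩ 0 ⟨le_rfl, hr⟩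
      rw [h.center, show f p = f m from hp] at h1
      simpa using h1
    refine ⟨hfm, fun k => ?_⟩
    have h1 := hmax (φ k (r / 2))
    rw [hf k (r / 2) ⟨by positivity, by linarith⟩, hfm, EReal.coe_le_coe_iff] at h1
    by_contra hk
    have h2 : (0 : ℝ) < σ k := by exact_mod_cast not_le.1 hk
    have : 0 < σ k * (r / 2) := by positivity
    linarith
  -- If the slope `c` towards infinity is not positive, the limit is at most the starting value `a`.
  -- As the limit is the maximum, both are equal and `f` is constant along the ray.
  have hend : ∀ p ∈ S, ∀ (γ : ℝ≥0∞ → X) (a : ℝ) (c : ℤ), IsEndChart p γ →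
      (∀ t : ℝ≥0, f (γ (t : ℝ≥0∞)) = ((a + (c : ℝ) * (t : ℝ) : ℝ) : EReal)) → c ≤ 0 →
      c = 0 ∧ S ∈ 𝓝 p := by
    intro p hp γ a c h hf hc
    have htend : Filter.Tendsto (fun n : ℕ => f (γ ((n : ℝ≥0) : ℝ≥0∞))) Filter.atTop (𝓝 (f m)) := by
      have h1 : Filter.Tendsto (fun n : ℕ => ((n : ℝ≥0) : ℝ≥0∞)) Filter.atTop (𝓝 ⊤) := by
        simpa using ENNReal.tendsto_nat_nhds_top
      have h2 := ((hcont.comp h.continuous).tendsto ⊤).comp h1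
      have h3 : (f ∘ γ) ⊤ = f m := by
        show f (γ ⊤) = f m
        rw [h.end_eq]; exact hp
      rwa [h3] at h2
    have hle : f m ≤ (a : EReal) := by
      refine le_of_tendsto' htend fun n => ?_
      rw [hf, EReal.coe_le_coe_iff]
      have : (c : ℝ) * ((n : ℝ≥0) : ℝ) ≤ 0 :=
        mul_nonpos_of_nonpos_of_nonneg (by exact_mod_cast hc) NNReal.zero_le_coe
      linarith
    have hge : (a : EReal) ≤ f m := by
      have := hmax (γ ((0 : ℝ≥0) : ℝ≥0∞))
      rw [hf] at this
      simpa using this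
    have heq : f m = (a : EReal) := le_antisymm hle hge
    have hc0 : c = 0 := by
      by_contra hne
      have hc' : (c : ℝ) ≤ -1 := by
        have : c ≤ -1 := by omega
        exact_mod_cast this
      have hle' : f m ≤ ((a - 1 : ℝ) : EReal) := by
        refine le_of_tendsto htend ?_
        filter_upwards [Filter.eventually_ge_atTop 1] with n hn
        rw [hf, EReal.coe_le_coe_iff]
        have hn' : (1 : ℝ) ≤ ((n : ℝ≥0) : ℝ) := by simpa using hn
        nlinarith
      rw [heq, EReal.coe_le_coe_iff] at hle'
      linarith
    refine ⟨hc0, Filter.mem_of_superset h.nhds ?_⟩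
    rintro _ ⟨t, rfl⟩
    by_cases ht : t = ⊤
    · rw [ht, h.end_eq]; exact hp
    · lift t to ℝ≥0 using ht
      show f (γ t) = f m
      rw [hf, heq, hc0]; simp
  -- No outgoing slope at a maximum is positive, and away from `x` their sum is not negative, so all
  -- of them vanish.
  have hnhds : ∀ p ∈ S, p ≠ x → S ∈ 𝓝 p ∧ A p = 0 := by
    intro p hp hpx
    rcases hord p with ⟨n, r, φ, a, σ, h, hf, hs⟩ | ⟨γ, a, c, h, hf, hs⟩
    · obtain ⟨hfm, hσ⟩ := hslope p hp n r φ a σ h hf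
      have hA0 := hA p hpx
      have hsum : ∑ k, σ k = 0 :=
        le_antisymm (Finset.sum_nonpos fun k _ => hσ k) (hs ▸ hA0)
      have h0 := (Finset.sum_eq_zero_iff_of_nonpos fun k _ => hσ k).1 hsum
      refine ⟨Filter.mem_of_superset h.nhds ?_, hs.trans hsum⟩
      intro z hz
      obtain ⟨k, t, ht, rfl⟩ := mem_iUnion.1 hz
      show f (φ k t) = f m
      rw [hf k t ht, hfm, h0 k (Finset.mem_univ k)]; simp
    · have hA0 := hA p hpx
      obtain ⟨h1, h2⟩ := hend p hp γ a c h hf (by omega)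
      exact ⟨h2, by omega⟩
  have hyS : y ∉ S := fun h => by
    have := (hnhds y h hyx).2
    omega
  have hxS : x ∈ S ∧ S ∉ 𝓝 x := by
    by_contra hcon
    have hopen : IsOpen S := by
      rw [isOpen_iff_mem_nhds]
      intro p hp
      by_cases hpx : p = x
      · subst hpx
        by_contra h
        exact hcon ⟨hp, h⟩
      · exact (hnhds p hp hpx).1
    have := IsClopen.eq_univ ⟨hScl, hopen⟩ hSne
    exact hyS (this ▸ mem_univ y)
  -- Both integer slopes at `x` are at most 0 and their sum is at least -1, so one is 0 and a whole
  -- branch at `x` lies in `S`. Then `S` without `x` and the complement of `S` disconnect the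
  -- complement of `x`.
  obtain ⟨z, hzS, hzx⟩ : ∃ z ∈ S, z ≠ x := by
    rcases hord x with ⟨n, r, φ, a, σ, h, hf, hs⟩ | ⟨γ, a, c, h, hf, hs⟩
    · obtain rfl := HasValence.unique hE ⟨r, φ, h⟩ hx
      obtain ⟨hfm, hσ⟩ := hslope x hxS.1 2 r φ a σ h hf
      rw [Fin.sum_univ_two] at hs
      have h0 := hσ 0
      have h1 := hσ 1
      obtain ⟨k, hk⟩ : ∃ k, σ k = 0 := by
        by_cases h2 : σ 0 = 0
        · exact ⟨0, h2⟩
        · exact ⟨1, by omega⟩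
      have hr := h.radius_pos
      have hmem : r / 2 ∈ Ico 0 r := ⟨by positivity, by linarith⟩
      refine ⟨φ k (r / 2), ?_, fun heq => ?_⟩
      · show f (φ k (r / 2)) = f m
        rw [hf k _ hmem, hfm, hk]; simp
      · have h3 := h.edist_center k hmem
        rw [heq, hE.edist_self] at h3
        exact absurd h3.symm (by simpa using hr)
    · exact absurd hx (h.not_hasValence hE 2)
  have hopen : IsOpen (S ∩ {x}ᶜ) := by
    rw [isOpen_iff_mem_nhds]
    rintro p ⟨hp, hpx⟩
    exact Filter.inter_mem (hnhds p hp hpx).1 (isOpen_compl_singleton.mem_nhds hpx)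
  obtain ⟨w, -, hw1, hw2⟩ := hconn _ _ hopen hScl.isOpen_compl
    (fun p hp => (em (p ∈ S)).imp (fun h => ⟨h, hp⟩) id) ⟨z, hzx, hzS, hzx⟩ ⟨y, hyx, hyS⟩
  exact hw2 hw1.1

lemma not_rankAtLeast (hX : IsCurve X) {x x' : X} (hx : HasValence x' 2)
    (hconn : IsPreconnected ({x'}ᶜ : Set X)) {r : ℕ} (hr : 2 ≤ r) :
    ¬ RankAtLeast (Finsupp.single x 1 + Finsupp.single x' 1) r := by
  classical
  intro h
  obtain ⟨ρ, φ, hφ⟩ := hx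
  obtain ⟨y, hyx, -⟩ := hφ.exists_finite_edist hX.toIsEDistSpace
  have hr' : (2 : ℤ) ≤ r := by exact_mod_cast hr
  -- The point `x` cancels against the divisor itself. What remains is a positive multiple of `y`,
  -- as `r ≥ 2`, and a pole at `x'` that is at most simple.
  obtain ⟨D', ⟨f, hf⟩, -, hD'⟩ := h (Finsupp.single x 1 + Finsupp.single y (r - 1 : ℤ))
    (add_nonneg (Finsupp.single_nonneg.2 zero_le_one) (Finsupp.single_nonneg.2 (by omega)))
    (by rw [degree_add, degree_single, degree_single]; ring)
  have key : ∀ p, Finsupp.single y (r - 1 : ℤ) p - Finsupp.single x' 1 p ≤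
      (D' - (Finsupp.single x 1 + Finsupp.single x' 1) : X →₀ ℤ) p := by
    intro p
    have := hD' p
    simp only [Finsupp.coe_add, Pi.add_apply, Finsupp.coe_sub, Pi.sub_apply] at this ⊢
    omega
  have hsy : ∀ p, (0 : ℤ) ≤ Finsupp.single y (r - 1 : ℤ) p :=
    fun p => (Finsupp.single_nonneg.2 (by omega) : (0 : X →₀ ℤ) ≤ Finsupp.single y (r - 1 : ℤ)) p
  refine not_hasPrincipalDivisor hX ⟨ρ, φ, hφ⟩ hconn (y := y) (fun p hp => ?_) ?_ ?_ hyx f hf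
  · have h1 := key p
    rw [Finsupp.single_eq_of_ne (a := x') hp] at h1
    have := hsy p
    omega
  · have h1 := key x'
    rw [Finsupp.single_eq_same] at h1
    have := hsy x'
    omega
  · have h1 := key y
    rw [Finsupp.single_eq_same, Finsupp.single_eq_of_ne (a := x') hyx] at h1
    omega

theorem exists_isRealG12 (hX : IsCurve X) {ι : X → X} (hι : IsRealStructure ι)
    (hM : IsStrongM ι) : ∃ D : X →₀ ℤ, IsRealG12 ι D := by
  classical
  have hD : ∀ p : X, IsRealDivisor ι (Finsupp.single p 1 + Finsupp.single (ι p) 1) := by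
    intro p q
    have hiff : ∀ x, x = ι q ↔ ι x = q := fun x =>
      ⟨fun h => by rw [h, hι.involutive], fun h => by rw [← h, hι.involutive]⟩
    simp only [Finsupp.coe_add, Pi.add_apply, Finsupp.single_apply, hiff, hι.involutive p]
    ring
  have hD0 : ∀ p : X, (0 : X →₀ ℤ) ≤ Finsupp.single p 1 + Finsupp.single (ι p) 1 := fun p =>
    add_nonneg (Finsupp.single_nonneg.2 zero_le_one) (Finsupp.single_nonneg.2 zero_le_one)
  have hD2 : ∀ p : X, degree (Finsupp.single p 1 + Finsupp.single (ι p) 1) = 2 := fun p => by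
    rw [degree_add, degree_single, degree_single]; norm_num
  by_cases hg : genus X = 0
  · have := hX.connected
    obtain ⟨p⟩ := (inferInstance : Nonempty X)
    exact ⟨_, hD p, hD0 p, hD2 p, rankAtLeast_one hX hι hM p, fun h => absurd hg h⟩
  · obtain ⟨x, hx, hconn⟩ := exists_nonseparating hX hg
    have hrank := rankAtLeast_one hX hι hM x
    refine ⟨_, hD x, hD0 x, hD2 x, hrank, fun _ => ⟨hrank, fun r hr => ?_⟩⟩
    by_contra hlt
    have hr' : RankAtLeast (Finsupp.single (ι x) 1 + Finsupp.single x 1) r := by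
      rw [add_comm]; exact hr
    exact not_rankAtLeast hX hx hconn (not_le.1 hlt) hr'

end RealGraph

/-! ### Metric graphs and tropical curves are curves. -/

namespace RealGraph

lemma isEDistSpace_of_metricSpace (Γ : Type u) [MetricSpace Γ] : IsEDistSpace Γ where
  edist_eq_zero _ _ := edist_eq_zero
  edist_comm := edist_comm
  edist_triangle := edist_triangle
  nhds_basis x _ := by
    have := Metric.nhds_basis_eball (x := x)
    refine this.congr (fun _ => Iff.rfl) fun ε _ => ?_
    ext y
    simp [Metric.mem_eball, edist_comm]
  t2 := inferInstance

lemma IsMetricGraph.isCurve {Γ : Type u} [MetricSpace Γ] (h : IsMetricGraph Γ) : IsCurve Γ where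
  toIsEDistSpace := isEDistSpace_of_metricSpace Γ
  compact := h.compact
  connected := h.connected
  charts p := by
    obtain ⟨n, -, hn⟩ := h.star p
    exact Or.inl ⟨n, hn⟩

variable {X : Type u} [TopologicalSpace X] [EDist X]

/-- Finitely many arcs of the same length that start at `p`, coincide or are disjoint otherwise, and
cover a neighbourhood of `p` make up a star. -/
lemma hasValence_of_arcs (hX : IsEDistSpace X) {K : Type*} [Finite K] [Nonempty K] {p : X}
    {L : ℝ≥0∞} {α : K → ℝ≥0∞ → X} (harc : ∀ k, IsArc L (α k)) (h0 : ∀ k, α k 0 = p)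
    (hdisj : ∀ k l, ∀ s ∈ Ioo 0 L, ∀ t ∈ Ioo 0 L, α k s = α l t → ∀ t ∈ Ioo 0 L, α k t = α l t)
    (hn : {p} ∪ ⋃ k, α k '' Ioo 0 L ∈ 𝓝 p) : ∃ n, HasValence p n := by
  let R : Setoid K := ⟨fun k l => ∀ t ∈ Ioo 0 L, α k t = α l t,
    fun k t _ => rfl, fun h t ht => (h t ht).symm, fun h h' t ht => (h t ht).trans (h' t ht)⟩
  have : Nonempty (Quotient R) := ‹Nonempty K›.map fun k => ⟦k⟧
  obtain ⟨r, -, -, hstar⟩ := exists_isStarChart_of_arcs hX (K := Quotient R)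
    (L := fun _ => L) (α := fun c => α c.out) (fun c => harc _) (fun c => h0 _)
    (fun c d s t hs ht hst => by
      rw [← Quotient.out_eq c, ← Quotient.out_eq d]
      exact Quotient.sound (hdisj _ _ s hs t ht hst))
    (Filter.mem_of_superset hn (union_subset_union_right _ (iUnion_subset fun k => by
      rintro _ ⟨t, ht, rfl⟩
      have h1 : R (⟦k⟧ : Quotient R).out k := Quotient.exact (Quotient.out_eq _)
      exact mem_iUnion.2 ⟨⟦k⟧, t, ht, h1 t ht⟩)))
  exact ⟨_, r, _, hstar _ (Finite.equivFin _).symm⟩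

/-- Two arcs that start at the same point coincide if they meet again and the interior of one of them
is open. -/
lemma IsArc.eqOn_of_meet (hX : IsEDistSpace X) {L : ℝ≥0∞} {α β : ℝ≥0∞ → X} (hα : IsArc L α)
    (hβ : IsArc L β)
    {O : Set X} (hO : IsOpen O)
    (hβO : ∀ t ∈ Ioo 0 L, β t ∈ O)
    (hOβ : ∀ t ∈ Ioo 0 L, α t ∈ O → α t = β t)
    {s : ℝ≥0∞} (hs : s ∈ Ioo 0 L) (hst : α s ∈ O) : ∀ t ∈ Ioo 0 L, α t = β t := by
  have := hX.t2
  have hpre : IsPreconnected (Ioo 0 L) := isPreconnected_Ioo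
  have hcl : IsClosed {t | t ≤ L ∧ α t = β t} := by
    have h1 : ContinuousOn (fun t => (α t, β t)) (Iic L) := hα.continuousOn.prodMk hβ.continuousOn
    exact h1.preimage_isClosed_of_isClosed isClosed_Iic isClosed_diagonal
  have hop : IsOpen (Ioo 0 L ∩ α ⁻¹' O) :=
    (hα.continuousOn.mono fun t ht => ht.2.le).isOpen_inter_preimage isOpen_Ioo hO
  by_contra! hcon
  obtain ⟨t, ht, hne⟩ := hcon
  obtain ⟨r, hr, h1, h2⟩ := hpre _ _ hop hcl.isOpen_compl (fun r hr => by
    by_cases h : α r ∈ O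
    · exact Or.inl ⟨hr, h⟩
    · exact Or.inr fun h' => h (h'.2 ▸ hβO r hr)) ⟨s, hs, hs, hst⟩
    ⟨t, ht, fun h' => hne h'.2⟩
  exact h2 ⟨hr.2.le, hOβ r hr h1.2⟩

lemma IsTropicalCurve.isEDistSpace (h : IsTropicalCurve X) : IsEDistSpace X :=
  ⟨h.edist_eq_zero, h.edist_comm, h.edist_triangle, h.nhds_basis, h.t2⟩

/-- The only delicate points are those of the compact part. The decomposition does not prevent this
part from containing pieces of the unbounded edges, so branches of its star may coincide with
unbounded edges and have to be identified. -/
lemma IsTropicalCurve.isCurve (h : IsTropicalCurve X) : IsCurve X := by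
  classical
  have hE := h.isEDistSpace
  have := h.t2
  obtain ⟨Γ, _, j, N, e, hΓ, hj, hjd, hemb, hiso, hcl, he0, hcov⟩ := h.decomposition
  have hΓE := isEDistSpace_of_metricSpace Γ
  have := hΓ.compact
  have harc : ∀ i, IsArc ⊤ (e i) := fun i =>
    ⟨by simp, fun s _ t _ => hiso i s t, (hemb i).continuous.continuousOn⟩
  have hrange : ∀ i, IsClosed (range (e i)) := fun i =>
    (isCompact_range (hemb i).continuous).isClosed
  have hinner : ∀ i t, t ≠ 0 → range (e i) ∈ 𝓝 (e i t) := by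
    intro i t ht
    by_contra hn
    have h1 : e i t ∈ closure (range (e i))ᶜ := by
      rw [closure_compl, mem_compl_iff, mem_interior_iff_mem_nhds]
      exact hn
    have h2 : e i t ∈ ({e i 0} : Set X) := hcl i ▸ ⟨h1, t, rfl⟩
    exact ht ((hemb i).injective h2)
  refine ⟨hE, ?_, h.connected, fun p => ?_⟩
  · rw [← isCompact_univ_iff, ← hcov]
    exact (isCompact_range hj.continuous).union
      (isCompact_iUnion fun i => isCompact_range (hemb i).continuous)
  by_cases hp : ∃ i t, t ≠ 0 ∧ e i t = p
  · obtain ⟨i, t, ht, rfl⟩ := hp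
    by_cases htop : t = ⊤
    · subst htop
      exact Or.inr ⟨e i, hiso i, (hemb i).continuous, rfl, hinner i _ ht⟩
    · refine Or.inl ⟨2, (harc i).hasValence_two hE ⟨pos_iff_ne_zero.2 ht, lt_top_iff_ne_top.2 htop⟩ ?_⟩
      rw [Iic_top, image_univ]
      exact hinner i t ht
  · push Not at hp
    have hpj : p ∈ range j := by
      rcases hcov ▸ mem_univ p with h' | h'
      · exact h'
      · obtain ⟨i, t, rfl⟩ := mem_iUnion.1 h'
        by_cases ht : t = 0
        · rw [ht]; exact he0 i
        · exact absurd rfl (hp i t ht)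
    obtain ⟨x, rfl⟩ := hpj
    obtain ⟨n, -, r, φ, hφ⟩ := hΓ.star x
    obtain ⟨ε, hε0, hεr, hε⟩ := hφ.exists_ball hΓE
    set ρ := ε / 2 with hρ
    have hρ0 : 0 < ρ := by positivity
    have hρr : ρ < r := by linarith
    set L := ENNReal.ofReal ρ with hL
    have hL0 : 0 < L := ENNReal.ofReal_pos.2 hρ0
    have hLε : L < ENNReal.ofReal ε := (ENNReal.ofReal_lt_ofReal_iff hε0).2 (by linarith)
    -- The candidates for branches: those of the star in the compact part, and the unbounded edges
    -- attached at the point.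
    let K := Fin n ⊕ {i : Fin N // e i 0 = j x}
    let α : K → ℝ≥0∞ → X := Sum.elim (fun k t => j (φ k t.toReal)) (fun i => e i.1)
    have hα : ∀ k, IsArc L (α k) := by
      rintro (k | i)
      · have h1 := hφ.isArc hΓE k hρ0 hρr
        exact ⟨hL0, fun s hs t ht => (hjd _ _).trans (h1.isometric s hs t ht),
          hj.continuous.comp_continuousOn h1.continuousOn⟩
      · exact (harc i.1).of_le hL0 le_top
    have hα0 : ∀ k, α k 0 = j x := by
      rintro (k | i)
      · simp [α, hφ.center k]
      · exact i.2
    have hαd : ∀ k, ∀ t ≤ L, edist (j x) (α k t) = t := fun k t ht => by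
      rw [← hα0 k, (hα k).edist_zero ht]
    have hdisj : ∀ k l, ∀ s ∈ Ioo 0 L, ∀ t ∈ Ioo 0 L, α k s = α l t →
        ∀ t ∈ Ioo 0 L, α k t = α l t := by
      have hray : ∀ k (i : {i : Fin N // e i 0 = j x}), ∀ s ∈ Ioo 0 L, ∀ t ∈ Ioo 0 L,
          α k s = e i.1 t → ∀ t ∈ Ioo 0 L, α k t = e i.1 t := by
        intro k i s hs t ht hst
        have hO : IsOpen (range (e i.1) \ {e i.1 0}) := by
          rw [isOpen_iff_mem_nhds]
          rintro _ ⟨⟨t, rfl⟩, ht⟩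
          exact Filter.inter_mem (hinner i.1 t fun h0 => ht (by rw [h0]; rfl))
            (isOpen_compl_singleton.mem_nhds ht)
        have hβO : ∀ t ∈ Ioo 0 L, e i.1 t ∈ range (e i.1) \ {e i.1 0} := fun t ht =>
          ⟨⟨t, rfl⟩, fun h0 => ht.1.ne' ((hemb i.1).injective h0)⟩
        refine (hα k).eqOn_of_meet hE (hα (Sum.inr i)) hO hβO
          ?_ hs (hst ▸ hβO t ht)
        -- Both arcs are parametrized by the distance from `j x`, so a common point has the same
        -- parameter on both.
        rintro s hs ⟨⟨t, ht⟩, -⟩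
        have h1 := hαd k s hs.2.le
        have h2 : edist (e i.1 0) (e i.1 t) = t := (harc i.1).edist_zero le_top
        rw [i.2, ht, h1] at h2
        rw [← ht, h2]
      rintro (k | i) (l | i') s hs t ht hst
      · have h1 : ∀ s ∈ Ioo 0 L, s.toReal ∈ Ioo 0 r := fun s hs =>
          ⟨ENNReal.toReal_pos hs.1.ne' hs.2.ne_top,
            ((ENNReal.lt_ofReal_iff_toReal_lt hs.2.ne_top).1 hs.2).trans hρr⟩
        have := hφ.disjoint k l _ (h1 s hs) _ (h1 t ht) (hj.injective hst)
        intro t _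
        rw [this]
      · exact hray _ i' s hs t ht hst
      · exact fun r hr => (hray (Sum.inl l) i t ht s hs hst.symm r hr).symm
      · exact hray _ i' s hs t ht hst
    have : Nonempty K := ⟨Sum.inl ⟨0, hφ.pos⟩⟩
    refine Or.inl (hasValence_of_arcs hE hα hα0 hdisj ?_)
    have hfin : ∃ y, y ≠ j x ∧ edist (j x) y < ⊤ := by
      have := (hα (Sum.inl ⟨0, hφ.pos⟩)).exists_finite_edist hE zero_le ENNReal.zero_ne_top
      rwa [hα0] at this
    have hclosed : IsClosed (⋃ i ∈ {i | e i 0 ≠ j x}, range (e i)) :=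
      (toFinite _).isClosed_biUnion fun i _ => hrange i
    have hnot : j x ∉ ⋃ i ∈ {i | e i 0 ≠ j x}, range (e i) := by
      simp only [mem_iUnion, not_exists]
      rintro i hi ⟨t, ht⟩
      by_cases h0 : t = 0
      · exact hi (h0 ▸ ht)
      · exact hp i t h0 ht
    filter_upwards [(hE.nhds_basis _ hfin).mem_of_mem hL0, hclosed.isOpen_compl.mem_nhds hnot]
      with y hy hy'
    by_cases hyp : y = j x
    · exact Or.inl hyp
    have hd : edist (j x) y < L := hy
    have hd0 : 0 < edist (j x) y := pos_iff_ne_zero.2 fun h0 => hyp ((hE.edist_eq_zero _ _).1 h0).symm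
    right
    rw [mem_iUnion]
    rcases hcov ▸ mem_univ y with h' | h'
    · obtain ⟨z, rfl⟩ := h'
      rw [hjd] at hd hd0
      obtain ⟨k, hk⟩ := hε z (hd.trans hLε)
      exact ⟨Sum.inl k, edist x z, ⟨hd0, hd⟩, congrArg j hk⟩
    · obtain ⟨i, t, rfl⟩ := mem_iUnion.1 h'
      by_cases hi : e i 0 = j x
      · refine ⟨Sum.inr ⟨i, hi⟩, t, ?_, rfl⟩
        rw [← hi, (harc i).edist_zero le_top] at hd hd0
        exact ⟨hd0, hd⟩
      · exact (hy' (mem_iUnion₂.2 ⟨i, hi, t, rfl⟩)).elim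

end RealGraph

theorem proposition7 :
    (∀ (Γ : Type u) [MetricSpace Γ], RealGraph.IsMetricGraph Γ →
      ∀ ι : Γ → Γ, RealGraph.IsRealStructure ι → RealGraph.IsStrongM ι →
        ∃ D : Γ →₀ ℤ, RealGraph.IsRealG12 ι D) ∧
    (∀ (T : Type u) [TopologicalSpace T] [EDist T], RealGraph.IsTropicalCurve T →
      ∀ ι : T → T, RealGraph.IsRealStructure ι → RealGraph.IsStrongM ι →
        ∃ D : T →₀ ℤ, RealGraph.IsRealG12 ι D) :=
  ⟨fun _ _ h _ hι hM => RealGraph.exists_isRealG12 h.isCurve hι hM,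
    fun _ _ _ h _ hι hM => RealGraph.exists_isRealG12 h.isCurve hι hM⟩
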